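/- Let $L>0$, let $U\in C^\infty(\mathbb R)$ be real-valued, even and $L$-periodic, and let $H_\infty=-\frac{d^2}{dy^2}+U(y)$ on $L^2(\mathbb R)$ (complex-valued functions) with domain $H^2(\mathbb R)$. Let $E_*\in\mathbb R$ lie in an open gap of $\mathrm{spec}(H_\infty)$, i.e. $E_*\in(a,b)$ with $a,b\in\mathrm{spec}(H_\infty)$ and $(a,b)\cap\mathrm{spec}(H_\infty)=\varnothing$. Put $Q_\infty=H_\infty-E_*I$ and $$D_\infty=\begin{pmatrix}0&Q_\infty\\Q_\infty&0\end{pmatrix}\quad\text{on } L^2(\mathbb R)\oplus L^2(\mathbb R),\qquad D(D_\infty)=H^2(\mathbb R)\oplus H^2(\mathbb R).$$ For each prime $p$ let $d^\times x_p$ be the Haar measure on $\mathbb Q_p^\times$ with $d^\times x_p(\mathbb Z_p^\times)=1$, and let $\mathcal H_{\mathrm{fin}}=\bigotimes_p' L^2(\mathbb Q_p^\times,d^\times x_p)$ be the restricted Hilbert tensor product over all primes with respect to the vectors $1_{\mathbb Z_p^\times}$, i.e. the completion of the span of the pure tensors $\bigotimes_p\psi_p$ with $\psi_p=1_{\mathbb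 Z_p^\times}$ for all but finitely many $p$, where $\langle\otimes_p\psi_p,\otimes_p\varphi_p\rangle=\prod_p\langle\psi_p,\varphi_p\rangle$. Let $I_{\mathrm{fin}}$ be the identity on $\mathcal H_{\mathrm{fin}}$, and let $D_{\mathrm{glob}}=D_\infty\,\hat\otimes\, I_{\mathrm{fin}}$ on $(L^2(\mathbb R)\oplus L^2(\mathbb R))\,\hat\otimes\,\mathcal H_{\mathrm{fin}}$ be the closure of $D_\infty\otimes I_{\mathrm{fin}}$ on the algebraic tensor product $D(D_\infty)\otimes\mathcal H_{\mathrm{fin}}$. Then: 1. $D_{\mathrm{glob}}$ is self-adjoint. 2. $\mathrm{spec}(D_{\mathrm{glob}})=\mathrm{spec}(D_\infty)=\{\pm(\lambda-E_*):\lambda\in\mathrm{spec}(H_\infty)\}$. 3. Every spectral value $z$ of $D_{\mathrm{glob}}$ has infinite multiplicity: $D_{\mathrm{glob}}$ has infinitely many mutually orthogonal reducing parts, all unitarily equivalent to one self-adjoint operator whose spectrum contains $z$. Moreover the multiplicity is uniformly infinite: $D_{\mathrm{glob}}$ is unitarily equivalent to an orthogonal sum of infinitely many copies of one self-adjoint operator.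 4. $D_{\mathrm{glob}}$ has a band-gap spectrum symmetric about $0$. There are real numbers $\alpha_0\le\beta_0\le\alpha_1\le\beta_1\le\cdots$ with $\alpha_n\to\infty$ such that $\mathrm{spec}(H_\infty)=\bigcup_{n\ge0}[\alpha_n,\beta_n]$, $E_*\in(\beta_m,\alpha_{m+1})$ for some $m$, and $$\mathrm{spec}(D_{\mathrm{glob}})=\bigcup_{n\ge0}\bigl([\alpha_n-E_*,\beta_n-E_*]\cup[-(\beta_n-E_*),-(\alpha_n-E_*)]\bigr).$$ Moreover $\mathrm{spec}(D_{\mathrm{glob}})=-\mathrm{spec}(D_{\mathrm{glob}})$, and there is an open gap around $0$: for some $\delta>0$, $\pm\delta\in\mathrm{spec}(D_{\mathrm{glob}})$ and $(-\delta,\delta)\cap\mathrm{spec}(D_{\mathrm{glob}})=\varnothing$. -/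

import Mathlib

open MeasureTheory TensorProduct Filter
open scoped ENNReal ContDiff SchwartzMap InnerProductSpace ComplexConjugate

noncomputable section

/-! ### Unbounded operators on complex Hilbert spaces -/

namespace UnboundedOp

universe u

variable {H : Type u} [NormedAddCommGroup H] [InnerProductSpace ℂ H]

/-- `z` lies in the resolvent set of `A`: the map `A - z`, defined on the domain of `A`, has an
everywhere defined bounded two-sided inverse `R`. -/
def IsResolventPoint (A : H →ₗ.[ℂ] H) (z : ℂ) : Prop :=
  ∃ R : H →L[ℂ] H,
    (∀ x : H, ∃ h : R x ∈ A.domain, A ⟨R x, h⟩ - z • R x = x) ∧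
      ∀ x : A.domain, R (A x - z • (x : H)) = x

/-- The spectrum of an unbounded operator: the complement of the resolvent set. -/
def spec (A : H →ₗ.[ℂ] H) : Set ℂ := {z | ¬ IsResolventPoint A z}

/-- The operator `A - E` with the same domain as `A`. -/
def shift (A : H →ₗ.[ℂ] H) (E : ℝ) : H →ₗ.[ℂ] H where
  domain := A.domain
  toFun := A.toFun - (E : ℂ) • A.domain.subtype

/-- The chiral doubling `(0 Q; Q 0)` of `Q` on the Hilbert sum `H ⊕ H`, with domain
`D(Q) ⊕ D(Q)`. -/
def chiralDouble (Q : H →ₗ.[ℂ] H) : WithLp 2 (H × H) →ₗ.[ℂ] WithLp 2 (H × H) where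
  domain :=
    { carrier := {v | v.fst ∈ Q.domain ∧ v.snd ∈ Q.domain}
      add_mem' := fun ha hb => ⟨Q.domain.add_mem ha.1 hb.1, Q.domain.add_mem ha.2 hb.2⟩
      zero_mem' := ⟨Q.domain.zero_mem, Q.domain.zero_mem⟩
      smul_mem' := fun c _ ha => ⟨Q.domain.smul_mem c ha.1, Q.domain.smul_mem c ha.2⟩ }
  toFun :=
    { toFun := fun v => WithLp.toLp 2 (Q ⟨v.1.snd, v.2.2⟩, Q ⟨v.1.fst, v.2.1⟩)
      map_add' := fun v w => by
        rw [← WithLp.toLp_add, Prod.mk_add_mk, ← LinearPMap.map_add, ← LinearPMap.map_add]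
        rfl
      map_smul' := fun c v => by
        rw [RingHom.id_apply, ← WithLp.toLp_smul, Prod.smul_mk, ← LinearPMap.map_smul,
          ← LinearPMap.map_smul]
        rfl }

section Tensor

variable (K : Type*) [NormedAddCommGroup K] [InnerProductSpace ℂ K]

/-- The Hilbert space tensor product: the completion of the algebraic tensor product. -/
abbrev HilbertTensor (H : Type*) [NormedAddCommGroup H] [InnerProductSpace ℂ H]
    (K : Type*) [NormedAddCommGroup K] [InnerProductSpace ℂ K] : Type _ :=
  UniformSpace.Completion (H ⊗[ℂ] K)

/-- The inclusion of `D ⊗ K` (algebraic tensor product) into the Hilbert tensor product of `H`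
and `K`, for a linear subspace `D` of `H`. -/
def tensorIncl (D : Submodule ℂ H) : D ⊗[ℂ] K →ₗ[ℂ] HilbertTensor H K :=
  (UniformSpace.Completion.toComplL (𝕜 := ℂ) (E := H ⊗[ℂ] K)).toLinearMap ∘ₗ
    LinearMap.rTensor K D.subtype

theorem tensorIncl_injective (D : Submodule ℂ H) : Function.Injective (tensorIncl K D) := by
  intro x y h
  have h1 : ((LinearMap.rTensor K D.subtype x : H ⊗[ℂ] K) : HilbertTensor H K) =
      ((LinearMap.rTensor K D.subtype y : H ⊗[ℂ] K) : HilbertTensor H K) := h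
  exact Module.Flat.rTensor_preserves_injective_linearMap (M := K) D.subtype
    D.subtype_injective (UniformSpace.Completion.coe_injective _ h1)

/-- The operator `A ⊗ I_K` on the algebraic tensor product `D(A) ⊗ K`. -/
def algTensorId (A : H →ₗ.[ℂ] H) : HilbertTensor H K →ₗ.[ℂ] HilbertTensor H K where
  domain := LinearMap.range (tensorIncl K A.domain)
  toFun := (UniformSpace.Completion.toComplL (𝕜 := ℂ) (E := H ⊗[ℂ] K)).toLinearMap ∘ₗ
    LinearMap.rTensor K A.toFun ∘ₗ
      (LinearEquiv.ofInjective _ (tensorIncl_injective K A.domain)).symm.toLinearMap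

/-- The operator `A ⊗ I_K` on the Hilbert tensor product: the closure of `A ⊗ I_K` on the
algebraic tensor product `D(A) ⊗ K`. -/
def tensorId (A : H →ₗ.[ℂ] H) : HilbertTensor H K →ₗ.[ℂ] HilbertTensor H K :=
  (algTensorId K A).closure

end Tensor

/-- The isometries `V i` embed copies of the operator `B` into `A`, with mutually orthogonal
ranges: `V i B ⊆ A V i`. For self-adjoint `A` and `B` the ranges are then reducing subspaces, and
the part of `A` in each of them is unitarily equivalent to `B`. -/
structure IsOrthogonalCopies {ι : Type} {K : Type u} [NormedAddCommGroup K]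
    [InnerProductSpace ℂ K] (A : H →ₗ.[ℂ] H) (B : K →ₗ.[ℂ] K) (V : ι → K →ₗᵢ[ℂ] H) : Prop where
  orthogonal : ∀ i j, i ≠ j → ∀ x y : K, ⟪V i x, V j y⟫_ℂ = 0
  intertwines : ∀ i, ∀ x : B.domain, ∃ h : V i x ∈ A.domain, A ⟨V i x, h⟩ = V i (B x)

/-- The spectral value `z` of `A` has infinite multiplicity: `A` has infinitely many mutually
orthogonal reducing parts which are all unitarily equivalent to one self-adjoint operator whose
spectrum contains `z`. -/
def HasInfiniteMultiplicityAt (A : H →ₗ.[ℂ] H) (z : ℂ) : Prop :=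
  ∃ (ι : Type) (_ : Infinite ι) (K : Type u) (_ : NormedAddCommGroup K)
    (_ : InnerProductSpace ℂ K) (_ : CompleteSpace K) (B : K →ₗ.[ℂ] K) (V : ι → K →ₗᵢ[ℂ] H),
    IsSelfAdjoint B ∧ z ∈ spec B ∧ IsOrthogonalCopies A B V

/-- `A` has uniformly infinite multiplicity: `A` is unitarily equivalent to an orthogonal sum of
infinitely many copies of one self-adjoint operator. -/
def HasUniformInfiniteMultiplicity (A : H →ₗ.[ℂ] H) : Prop :=
  ∃ (ι : Type) (_ : Infinite ι) (K : Type u) (_ : NormedAddCommGroup K)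
    (_ : InnerProductSpace ℂ K) (_ : CompleteSpace K) (B : K →ₗ.[ℂ] K) (V : ι → K →ₗᵢ[ℂ] H),
    IsSelfAdjoint B ∧ IsOrthogonalCopies A B V ∧
      (⨆ i, LinearMap.range (V i).toLinearMap).topologicalClosure = ⊤

end UnboundedOp

/-! ### The real place -/

namespace RealPlace

/-- `L²(ℝ, dy)`. -/
abbrev L2R : Type := Lp ℂ 2 (volume : Measure ℝ)

/-- The Sobolev space `H²(ℝ)` as a subspace of `L²(ℝ)`. -/
def sobolevH2 : Submodule ℂ L2R where
  carrier := {f | TemperedDistribution.MemSobolev 2 2 (f : 𝓢'(ℝ, ℂ))}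
  add_mem' {f g} hf hg := by
    have := TemperedDistribution.MemSobolev.add hf hg
    simp only [Set.mem_ofPred_eq] at *
    rw [← Lp.toTemperedDistributionCLM_apply, map_add]
    simpa using this
  zero_mem' := by
    simp only [Set.mem_ofPred_eq]
    rw [← Lp.toTemperedDistributionCLM_apply, map_zero]
    exact TemperedDistribution.memSobolev_fun_zero ℝ ℂ 2 2
  smul_mem' c f hf := by
    have := TemperedDistribution.MemSobolev.smul c hf
    simp only [Set.mem_ofPred_eq] at *
    rw [← Lp.toTemperedDistributionCLM_apply, map_smul]
    simpa using this

/-- `g` is the second distributional derivative of `f`. -/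
def IsSecondDeriv (f g : L2R) : Prop :=
  TemperedDistribution.derivCLM ℂ (TemperedDistribution.derivCLM ℂ (f : 𝓢'(ℝ, ℂ))) =
    (g : 𝓢'(ℝ, ℂ))

theorem derivCLM_eq_lineDerivOp (f : 𝓢'(ℝ, ℂ)) :
    TemperedDistribution.derivCLM ℂ f = LineDeriv.lineDerivOp (1 : ℝ) f := by
  ext g
  rw [TemperedDistribution.derivCLM_apply_apply, TemperedDistribution.lineDerivOp_apply_apply]
  congr 2

theorem exists_isSecondDeriv (f : sobolevH2) : ∃ g : L2R, IsSecondDeriv f g := by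
  have hf : TemperedDistribution.MemSobolev 2 2 ((f : L2R) : 𝓢'(ℝ, ℂ)) := f.2
  have h := (hf.lineDerivOp (m := (1 : ℝ))).lineDerivOp (m := (1 : ℝ))
  rw [show (2 : ℝ) - 1 - 1 = 0 by norm_num, TemperedDistribution.memSobolev_zero_iff] at h
  obtain ⟨g, hg⟩ := h
  refine ⟨g, ?_⟩
  rw [IsSecondDeriv, derivCLM_eq_lineDerivOp, derivCLM_eq_lineDerivOp]
  exact hg

theorem toTemperedDistribution_injective {f g : L2R} (h : (f : 𝓢'(ℝ, ℂ)) = (g : 𝓢'(ℝ, ℂ))) :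
    f = g := by
  have hk := Lp.ker_toTemperedDistributionCLM_eq_bot (F := ℂ) (μ := (volume : Measure ℝ)) (p := 2)
  exact LinearMap.ker_eq_bot.mp hk h

theorem IsSecondDeriv.unique {f g g' : L2R} (h : IsSecondDeriv f g) (h' : IsSecondDeriv f g') :
    g = g' :=
  toTemperedDistribution_injective (h.symm.trans h')

theorem IsSecondDeriv.add {f g f' g' : L2R} (h : IsSecondDeriv f g) (h' : IsSecondDeriv f' g') :
    IsSecondDeriv (f + f') (g + g') := by
  unfold IsSecondDeriv at *
  simp only [← Lp.toTemperedDistributionCLM_apply] at *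
  simp only [map_add, h, h']

theorem IsSecondDeriv.smul {f g : L2R} (c : ℂ) (h : IsSecondDeriv f g) :
    IsSecondDeriv (c • f) (c • g) := by
  unfold IsSecondDeriv at *
  simp only [← Lp.toTemperedDistributionCLM_apply] at *
  simp only [map_smul, h]

/-- The second derivative `H²(ℝ) → L²(ℝ)`. -/
def secondDeriv : sobolevH2 →ₗ[ℂ] L2R where
  toFun f := (exists_isSecondDeriv f).choose
  map_add' f g :=
    (exists_isSecondDeriv (f + g)).choose_spec.unique
      ((exists_isSecondDeriv f).choose_spec.add (exists_isSecondDeriv g).choose_spec)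
  map_smul' c f :=
    (exists_isSecondDeriv (c • f)).choose_spec.unique
      ((exists_isSecondDeriv f).choose_spec.smul c)

/-- A smooth, real-valued, even potential on `ℝ` of period `L > 0`. -/
structure EvenPeriodicPotential (L : ℝ) where
  toFun : ℝ → ℝ
  period_pos : 0 < L
  smooth : ContDiff ℝ ∞ toFun
  even : ∀ y, toFun (-y) = toFun y
  periodic : Function.Periodic toFun L

theorem EvenPeriodicPotential.memLp_top {L : ℝ} (U : EvenPeriodicPotential L) :
    MemLp (fun y => (U.toFun y : ℂ)) ∞ (volume : Measure ℝ) := by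
  have hb := U.periodic.isBounded_of_continuous U.period_pos.ne' U.smooth.continuous
  obtain ⟨C, hC⟩ := hb.exists_norm_le
  refine memLp_top_of_bound
    (Complex.continuous_ofReal.comp U.smooth.continuous).aestronglyMeasurable C
    (Eventually.of_forall fun y => ?_)
  rw [Complex.norm_real]
  exact hC _ ⟨y, rfl⟩

/-- Multiplication by the potential, `f ↦ U f`, on `L²(ℝ)`. -/
def EvenPeriodicPotential.mul {L : ℝ} (U : EvenPeriodicPotential L) : L2R →L[ℂ] L2R :=
  (ContinuousLinearMap.mul ℂ ℂ).holderL volume ∞ 2 2 (U.memLp_top.toLp _)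

theorem EvenPeriodicPotential.coeFn_mul {L : ℝ} (U : EvenPeriodicPotential L) (f : L2R) :
    U.mul f =ᵐ[volume] fun y => (U.toFun y : ℂ) * f y := by
  have h : U.mul f =ᵐ[volume] fun y => (U.memLp_top.toLp _ : Lp ℂ ∞ (volume : Measure ℝ)) y * f y :=
    (ContinuousLinearMap.mul ℂ ℂ).coeFn_holder (r := 2) (U.memLp_top.toLp _) f
  filter_upwards [h, U.memLp_top.coeFn_toLp] with y h1 h2
  rw [h1, h2]

/-- The Hill operator `-d²/dy² + U` on `L²(ℝ)` with domain `H²(ℝ)`. -/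
def hill {L : ℝ} (U : EvenPeriodicPotential L) : L2R →ₗ.[ℂ] L2R where
  domain := sobolevH2
  toFun := -secondDeriv + U.mul.toLinearMap ∘ₗ sobolevH2.subtype

/-- The real-place Dirac operator `(0 Q; Q 0)` on `L²(ℝ) ⊕ L²(ℝ)`, where `Q = -d²/dy² + U - E`. -/
def dirac {L : ℝ} (U : EvenPeriodicPotential L) (E : ℝ) :
    WithLp 2 (L2R × L2R) →ₗ.[ℂ] WithLp 2 (L2R × L2R) :=
  UnboundedOp.chiralDouble (UnboundedOp.shift (hill U) E)

/-- `E` lies in an open gap of `S`: a bounded open interval with endpoints in `S`, disjoint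
from `S`. -/
def InOpenGap (S : Set ℂ) (E : ℝ) : Prop :=
  ∃ a b : ℝ, (a : ℂ) ∈ S ∧ (b : ℂ) ∈ S ∧ E ∈ Set.Ioo a b ∧ ∀ x ∈ Set.Ioo a b, (x : ℂ) ∉ S

end RealPlace

/-! ### The finite places -/

namespace FinitePlaces

instance factPrimes (p : Nat.Primes) : Fact (p : ℕ).Prime := ⟨p.2⟩

section Local

variable (p : ℕ) [Fact p.Prime]

instance padicUnitsMeasurableSpace : MeasurableSpace (ℚ_[p])ˣ := borel _

instance padicUnitsBorelSpace : BorelSpace (ℚ_[p])ˣ := ⟨rfl⟩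

/-- `ℤ_p^×` as a subset of `ℚ_p^×`. -/
def integralUnits : Set (ℚ_[p])ˣ := {x | ‖(x : ℚ_[p])‖ = 1}

theorem isOpen_integralUnits : IsOpen (integralUnits p) :=
  (IsUltrametricDist.isOpen_sphere (0 : ℚ_[p]) one_ne_zero).preimage Units.continuous_val
    |> fun h => by simpa [integralUnits, Set.preimage] using h

theorem isCompact_integralUnits : IsCompact (integralUnits p) := by
  have hK : IsCompact ((Metric.closedBall (0 : ℚ_[p]) 1) ×ˢ
      (MulOpposite.op '' (Metric.closedBall (0 : ℚ_[p]) 1))) :=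
    (isCompact_closedBall _ _).prod ((isCompact_closedBall _ _).image MulOpposite.continuous_op)
  refine (Units.isClosedEmbedding_embedProduct.isCompact_preimage hK).of_isClosed_subset ?_ ?_
  · exact isClosed_eq (by fun_prop) continuous_const
  · intro x hx
    have hx' : ‖(x : ℚ_[p])‖ = 1 := hx
    exact ⟨by simp [hx'], ⟨((x⁻¹ : (ℚ_[p])ˣ) : ℚ_[p]), by simp [hx'], rfl⟩⟩

/-- `ℤ_p^×` as a compact set with nonempty interior. -/
def integralUnitsCompacts : TopologicalSpace.PositiveCompacts (ℚ_[p])ˣ where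
  carrier := integralUnits p
  isCompact' := isCompact_integralUnits p
  interior_nonempty' := by
    rw [(isOpen_integralUnits p).interior_eq]
    exact ⟨1, by simp [integralUnits]⟩

/-- The Haar measure `d^×x_p` on `ℚ_p^×` which gives `ℤ_p^×` measure one. -/
def unitsHaar : Measure (ℚ_[p])ˣ := Measure.haarMeasure (integralUnitsCompacts p)

theorem unitsHaar_integralUnits : unitsHaar p (integralUnits p) = 1 :=
  Measure.haarMeasure_self (K₀ := integralUnitsCompacts p)

/-- `L²(ℚ_p^×, d^×x_p)`. -/
abbrev L2Padic : Type := Lp ℂ 2 (unitsHaar p)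

/-- The spherical vector: the indicator function of `ℤ_p^×`. -/
def spherical : L2Padic p :=
  indicatorConstLp 2 (isOpen_integralUnits p).measurableSet
    (by rw [unitsHaar_integralUnits]; exact ENNReal.one_ne_top) (1 : ℂ)

theorem norm_spherical : ‖spherical p‖ = 1 := by
  rw [spherical, norm_indicatorConstLp two_ne_zero ENNReal.ofNat_ne_top]
  simp [Measure.real, unitsHaar_integralUnits]

end Local

/-- Families of local vectors which equal the spherical vector at all but finitely many primes;
they index the pure tensors of the restricted tensor product. -/
def RestrictedFamily : Type :=
  {ψ : ∀ p : Nat.Primes, L2Padic p // ∀ᶠ p in cofinite, ψ p = spherical p}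

/-- The inner product of two pure tensors, `∏_p ⟨ψ_p, φ_p⟩`; all but finitely many factors are
equal to `1`. -/
def pureInner (ψ φ : RestrictedFamily) : ℂ := ∏ᶠ p : Nat.Primes, ⟪ψ.1 p, φ.1 p⟫_ℂ

theorem finite_mulSupport_inner (ψ φ : RestrictedFamily) :
    (Function.mulSupport fun p : Nat.Primes => ⟪ψ.1 p, φ.1 p⟫_ℂ).Finite := by
  refine (ψ.2.and φ.2).mono (fun p hp => ?_)
  simp [hp.1, hp.2, norm_spherical]

/-- Formal finite linear combinations of pure tensors. -/
def FormalTensors : Type := RestrictedFamily →₀ ℂ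

instance : AddCommGroup FormalTensors := inferInstanceAs (AddCommGroup (RestrictedFamily →₀ ℂ))

instance : Module ℂ FormalTensors := inferInstanceAs (Module ℂ (RestrictedFamily →₀ ℂ))

theorem conj_pureInner (ψ φ : RestrictedFamily) : conj (pureInner φ ψ) = pureInner ψ φ := by
  have h := MonoidHom.map_finprod (starRingEnd ℂ : ℂ →* ℂ) (finite_mulSupport_inner φ ψ)
  simpa [pureInner] using h

open scoped ComplexOrder in
theorem posSemidef_localGram {ι : Type} [Finite ι] (v : ι → RestrictedFamily)
    (s : Finset Nat.Primes) :
    (Matrix.of fun i j : ι => ∏ p ∈ s, ⟪(v i).1 p, (v j).1 p⟫_ℂ).PosSemidef := by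
  classical
  induction s using Finset.induction_on with
  | empty =>
    have h := Matrix.posSemidef_gram ℂ (fun _ : ι => (1 : ℂ))
    have e : (Matrix.of fun i j : ι => ∏ p ∈ (∅ : Finset Nat.Primes), ⟪(v i).1 p, (v j).1 p⟫_ℂ) =
        Matrix.gram ℂ (fun _ : ι => (1 : ℂ)) := by
      ext i j
      simp [Matrix.gram]
    rw [e]
    exact h
  | insert p s hp ih =>
    have h := (Matrix.posSemidef_gram ℂ (fun i : ι => (v i).1 p)).hadamard ih
    have e : (Matrix.of fun i j : ι => ∏ p ∈ insert p s, ⟪(v i).1 p, (v j).1 p⟫_ℂ) =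
        (Matrix.gram ℂ (fun i : ι => (v i).1 p)).hadamard
          (Matrix.of fun i j : ι => ∏ p ∈ s, ⟪(v i).1 p, (v j).1 p⟫_ℂ) := by
      ext i j
      simp [Matrix.gram, Finset.prod_insert hp]
    rw [e]
    exact h

/-- The form `⟨∑ a_ψ ψ, ∑ b_φ φ⟩ = ∑ conj(a_ψ) b_φ ∏_p ⟨ψ_p, φ_p⟩` on formal combinations of pure
tensors. -/
def formalInner (f g : RestrictedFamily →₀ ℂ) : ℂ :=
  f.sum fun ψ a => g.sum fun φ b => conj a * b * pureInner ψ φ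

open scoped ComplexOrder in
theorem formalInner_self_nonneg (f : RestrictedFamily →₀ ℂ) : 0 ≤ (formalInner f f).re := by
  classical
  let s : Finset Nat.Primes := f.support.biUnion fun ψ => f.support.biUnion fun φ =>
    (finite_mulSupport_inner ψ φ).toFinset
  have h := (posSemidef_localGram (fun i : f.support => i.1) s).dotProduct_mulVec_nonneg
    fun i => f i.1
  have e : formalInner f f = star (fun i : f.support => f i.1) ⬝ᵥ
      (Matrix.of fun i j : f.support => ∏ p ∈ s, ⟪i.1.1 p, j.1.1 p⟫_ℂ).mulVec
        fun i => f i.1 := by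
    simp only [formalInner, Finsupp.sum, dotProduct, Matrix.mulVec, Finset.mul_sum]
    rw [← Finset.sum_coe_sort f.support]
    refine Finset.sum_congr rfl fun ψ _ => ?_
    rw [← Finset.sum_coe_sort f.support]
    refine Finset.sum_congr rfl fun φ _ => ?_
    have h2 : pureInner ψ φ = ∏ p ∈ s, ⟪ψ.1.1 p, φ.1.1 p⟫_ℂ := by
      refine finprod_eq_prod_of_mulSupport_subset _ fun p hp => ?_
      simp only [s, Finset.coe_biUnion, Set.mem_iUnion]
      exact ⟨ψ, ψ.2, φ, φ.2, by simpa using hp⟩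
    simp only [h2, Matrix.of_apply, Pi.star_apply, RCLike.star_def]
    ring
  rw [e]
  exact (Complex.le_def.mp h).1

theorem formalInner_conj (f g : RestrictedFamily →₀ ℂ) :
    conj (formalInner g f) = formalInner f g := by
  unfold formalInner
  rw [Finsupp.sum_comm]
  simp only [map_finsuppSum, map_mul, conj_pureInner, Complex.conj_conj]
  refine Finset.sum_congr rfl fun ψ _ => Finset.sum_congr rfl fun φ _ => ?_
  simp only [mul_comm]

theorem formalInner_add (f g h : RestrictedFamily →₀ ℂ) :
    formalInner (f + g) h = formalInner f h + formalInner g h := by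
  unfold formalInner
  refine Finsupp.sum_add_index' (by simp) fun ψ a b => ?_
  rw [← Finsupp.sum_add]
  refine Finset.sum_congr rfl fun φ _ => ?_
  simp only [map_add]
  ring

theorem formalInner_smul (f g : RestrictedFamily →₀ ℂ) (c : ℂ) :
    formalInner (c • f) g = conj c * formalInner f g := by
  unfold formalInner
  rw [Finsupp.sum_smul_index (by simp), Finsupp.mul_sum]
  refine Finset.sum_congr rfl fun ψ _ => ?_
  dsimp only
  rw [Finsupp.mul_sum]
  refine Finset.sum_congr rfl fun φ _ => ?_
  simp only [map_mul]
  ring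

/-- The tensor product (semi-)inner product on formal combinations of pure tensors. -/
instance formalCore : PreInnerProductSpace.Core ℂ FormalTensors where
  inner f g := formalInner f g
  conj_inner_symm f g := formalInner_conj f g
  re_inner_nonneg f := formalInner_self_nonneg f
  add_left f g h := formalInner_add f g h
  smul_left f g c := formalInner_smul f g c

instance : SeminormedAddCommGroup FormalTensors :=
  InnerProductSpace.Core.toSeminormedAddCommGroup (𝕜 := ℂ)

instance : InnerProductSpace ℂ FormalTensors := .ofCore _

/-- The restricted tensor product `⨂'_p L²(ℚ_p^×, d^×x_p)` with respect to the spherical vectors: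
the Hilbert space completion of the span of the pure tensors. Vectors of norm zero are identified
with `0` in the completion. -/
abbrev Hfin : Type := UniformSpace.Completion FormalTensors

end FinitePlaces

/-- The global operator `D_∞ ⊗ I_fin` on the Hilbert tensor product of `L²(ℝ) ⊕ L²(ℝ)` and
`⨂'_p L²(ℚ_p^×)`. -/
def globalDirac {L : ℝ} (U : RealPlace.EvenPeriodicPotential L) (E : ℝ) :
    UnboundedOp.HilbertTensor (WithLp 2 (RealPlace.L2R × RealPlace.L2R)) FinitePlaces.Hfin →ₗ.[ℂ]
      UnboundedOp.HilbertTensor (WithLp 2 (RealPlace.L2R × RealPlace.L2R)) FinitePlaces.Hfin :=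
  UnboundedOp.tensorId FinitePlaces.Hfin (RealPlace.dirac U E)

end

/-!
`H_∞` is self-adjoint and bounded below because it is a bounded perturbation of `-d²/dy²`, which is
diagonalised by the Fourier transform. Floquet theory describes its spectrum: the monodromy matrix
of `-ψ'' + U ψ = l ψ` over one period has determinant `1`, so the multipliers are the roots of
`ρ² - Δ(l) ρ + 1`, where the discriminant `Δ` is an entire function.

If `|Δ(l)| ≤ 2` the multipliers have modulus one, there is a bounded solution, and its cut-offs are
approximate eigenvectors. If `|Δ(l)| > 2` there are two solutions, one decaying in each direction.
Their Wronskians with a test function `u`, weighted by exponentials, are controlled in `L²` by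
`(H_∞ - l) u`, and they recover `u` because the Wronskian of the two solutions is a nonzero
constant; hence `H_∞ - l` is bounded below in norm. The spectrum is therefore the sublevel set
`{Δ² ≤ 4}` of an analytic function; being bounded below and unbounded above, it is a sequence of
bands.

In the coordinates `x ± y` the operator `D_∞` is `Q_∞ ⊕ (-Q_∞)`, which gives its spectrum. For an
orthonormal basis `e_i` of `𝓗_fin`, the operator `D_∞ ⊗ I` is the orthogonal sum of its restrictions
to the subspaces `(L² ⊕ L²) ⊗ e_i`, all of them copies of `D_∞`. And `𝓗_fin` is infinite
dimensional: replacing `1_{ℤ_q^×}` by `1_{q⁻¹ ℤ_q^×}` at a single prime `q`, for each `q`, gives an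
infinite orthonormal family.
-/

/-! ### Resolvents of unbounded operators -/

namespace UnboundedOp

section Resolvent

variable {H : Type*} [NormedAddCommGroup H] [InnerProductSpace ℂ H] {A : H →ₗ.[ℂ] H} {z : ℂ}

/-- The linear map `x ↦ A x - z x` on the domain of `A`. -/
def subScalar (A : H →ₗ.[ℂ] H) (z : ℂ) : A.domain →ₗ[ℂ] H := A.toFun - z • A.domain.subtype

theorem subScalar_apply (x : A.domain) : subScalar A z x = A x - z • (x : H) := rfl

/-- `R` is the resolvent `(A - z)⁻¹` of `A` at `z`. -/
structure IsResolvent (A : H →ₗ.[ℂ] H) (z : ℂ) (R : H →L[ℂ] H) : Prop where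
  mem_domain : ∀ x, R x ∈ A.domain
  right_inv : ∀ x, subScalar A z ⟨R x, mem_domain x⟩ = x
  left_inv : ∀ x : A.domain, R (subScalar A z x) = x

theorem IsResolvent.isResolventPoint {R : H →L[ℂ] H} (hR : IsResolvent A z R) :
    IsResolventPoint A z :=
  ⟨R, fun x => ⟨hR.mem_domain x, hR.right_inv x⟩, hR.left_inv⟩

theorem IsResolventPoint.exists_isResolvent (h : IsResolventPoint A z) :
    ∃ R, IsResolvent A z R := by
  obtain ⟨R, hleft, hright⟩ := h
  exact ⟨R, fun x => (hleft x).1, fun x => (hleft x).2, hright⟩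

theorem IsResolvent.injective {R : H →L[ℂ] H} (hR : IsResolvent A z R) :
    Function.Injective (subScalar A z) := fun x y h =>
  Subtype.ext (by rw [← hR.left_inv x, h, hR.left_inv])

theorem IsResolventPoint.injective (h : IsResolventPoint A z) :
    Function.Injective (subScalar A z) :=
  let ⟨_, hR⟩ := h.exists_isResolvent
  hR.injective

theorem IsResolventPoint.surjective (h : IsResolventPoint A z) :
    Function.Surjective (subScalar A z) := fun y =>
  let ⟨_, hR⟩ := h.exists_isResolvent
  ⟨_, hR.right_inv y⟩

theorem IsResolventPoint.exists_bound (h : IsResolventPoint A z) :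
    ∃ c > 0, ∀ x : A.domain, c * ‖(x : H)‖ ≤ ‖subScalar A z x‖ := by
  obtain ⟨R, hR⟩ := h.exists_isResolvent
  refine ⟨(‖R‖ + 1)⁻¹, by positivity, fun x => ?_⟩
  rw [inv_mul_le_iff₀ (by positivity)]
  calc ‖(x : H)‖ = ‖R (subScalar A z x)‖ := by rw [hR.left_inv]
    _ ≤ ‖R‖ * ‖subScalar A z x‖ := R.le_opNorm _
    _ ≤ (‖R‖ + 1) * ‖subScalar A z x‖ := by gcongr; linarith

theorem injective_subScalar_of_bound {c : ℝ} (hc : 0 < c)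
    (hbound : ∀ x : A.domain, c * ‖(x : H)‖ ≤ ‖subScalar A z x‖) :
    Function.Injective (subScalar A z) := by
  rw [← LinearMap.ker_eq_bot, LinearMap.ker_eq_bot']
  intro x hx
  have h : c * ‖(x : H)‖ ≤ 0 := by simpa only [hx, norm_zero] using hbound x
  exact Subtype.ext (norm_le_zero_iff.mp (nonpos_of_mul_nonpos_right h hc))

theorem isResolventPoint_of_surjective {c : ℝ} (hc : 0 < c)
    (hbound : ∀ x : A.domain, c * ‖(x : H)‖ ≤ ‖subScalar A z x‖)
    (hsurj : Function.Surjective (subScalar A z)) : IsResolventPoint A z := by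
  let e : A.domain ≃ₗ[ℂ] H :=
    LinearEquiv.ofBijective (subScalar A z) ⟨injective_subScalar_of_bound hc hbound, hsurj⟩
  have norm_symm_le (y : H) : ‖(e.symm y : H)‖ ≤ c⁻¹ * ‖y‖ := by
    rw [le_inv_mul_iff₀ hc]
    exact (hbound (e.symm y)).trans_eq (congrArg norm (e.apply_symm_apply y))
  let R : H →L[ℂ] H := (A.domain.subtype ∘ₗ e.symm.toLinearMap).mkContinuous c⁻¹ norm_symm_le
  exact ⟨R, fun x => ⟨(e.symm x).2, e.apply_symm_apply x⟩,
    fun x => congrArg Subtype.val (e.symm_apply_apply x)⟩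

theorem subScalar_shift (E : ℝ) (x : A.domain) :
    subScalar (shift A E) z x = subScalar A (z + E) x := by
  change A x - (E : ℂ) • (x : H) - z • (x : H) = A x - (z + E) • (x : H)
  module

theorem isResolventPoint_shift_iff {E : ℝ} :
    IsResolventPoint (shift A E) z ↔ IsResolventPoint A (z + E) := by
  refine exists_congr fun R => and_congr (forall_congr' fun x => exists_congr fun hx => ?_)
    (forall_congr' fun x => ?_)
  · exact Eq.congr_left (subScalar_shift (A := A) E ⟨R x, hx⟩)
  · exact Eq.congr_left (congrArg R (subScalar_shift (A := A) E x))

theorem mem_spec_shift_iff {E : ℝ} : z ∈ spec (shift A E) ↔ z + E ∈ spec A :=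
  not_congr isResolventPoint_shift_iff

end Resolvent

section ChiralDouble

variable {H : Type*} [NormedAddCommGroup H] [InnerProductSpace ℂ H] {A : H →ₗ.[ℂ] H} {z : ℂ}

/-- The vector `(x, y)` of the domain of the chiral doubling of `A` with `x + y = s` and
`x - y = d`. In the coordinates `(s, d)` the chiral doubling of `A` acts as `A ⊕ (-A)`. -/
noncomputable def chiralMk (s d : A.domain) : (chiralDouble A).domain :=
  ⟨WithLp.toLp 2 (((1 / 2 : ℂ) • (s + d) : A.domain), ((1 / 2 : ℂ) • (s - d) : A.domain)),
    ((1 / 2 : ℂ) • (s + d)).2, ((1 / 2 : ℂ) • (s - d)).2⟩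

theorem chiralMk_surjective (v : (chiralDouble A).domain) :
    ∃ s d : A.domain, v = chiralMk s d := by
  let x : A.domain := ⟨_, v.2.1⟩
  let y : A.domain := ⟨_, v.2.2⟩
  have hx : x = (1 / 2 : ℂ) • ((x + y) + (x - y)) := by module
  have hy : y = (1 / 2 : ℂ) • ((x + y) - (x - y)) := by module
  exact ⟨x + y, x - y, Subtype.ext <| WithLp.ofLp_injective 2 <|
    Prod.ext (congrArg Subtype.val hx) (congrArg Subtype.val hy)⟩

theorem fst_add_snd_subScalar_chiralMk (s d : A.domain) :
    (subScalar (chiralDouble A) z (chiralMk s d)).fst +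
      (subScalar (chiralDouble A) z (chiralMk s d)).snd = subScalar A z s := by
  change (A ((1 / 2 : ℂ) • (s - d)) - z • ((1 / 2 : ℂ) • ((s : H) + d))) +
    (A ((1 / 2 : ℂ) • (s + d)) - z • ((1 / 2 : ℂ) • ((s : H) - d))) = A s - z • (s : H)
  simp only [LinearPMap.map_smul, LinearPMap.map_add, LinearPMap.map_sub]
  module

theorem snd_sub_fst_subScalar_chiralMk (s d : A.domain) :
    (subScalar (chiralDouble A) z (chiralMk s d)).snd -
      (subScalar (chiralDouble A) z (chiralMk s d)).fst = subScalar A (-z) d := by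
  change (A ((1 / 2 : ℂ) • (s + d)) - z • ((1 / 2 : ℂ) • ((s : H) - d))) -
    (A ((1 / 2 : ℂ) • (s - d)) - z • ((1 / 2 : ℂ) • ((s : H) + d))) = A d - -z • (d : H)
  simp only [LinearPMap.map_smul, LinearPMap.map_add, LinearPMap.map_sub]
  module

theorem two_mul_norm_sq_withLp (w : WithLp 2 (H × H)) :
    2 * ‖w‖ ^ 2 = ‖w.fst + w.snd‖ ^ 2 + ‖w.snd - w.fst‖ ^ 2 := by
  have h := parallelogram_law_with_norm ℂ w.fst w.snd
  rw [WithLp.prod_norm_sq_eq_of_L2, norm_sub_rev w.snd]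
  linarith

theorem two_mul_norm_sq_subScalar_chiralMk (s d : A.domain) :
    2 * ‖subScalar (chiralDouble A) z (chiralMk s d)‖ ^ 2 =
      ‖subScalar A z s‖ ^ 2 + ‖subScalar A (-z) d‖ ^ 2 := by
  rw [two_mul_norm_sq_withLp, fst_add_snd_subScalar_chiralMk, snd_sub_fst_subScalar_chiralMk]

theorem two_mul_norm_sq_chiralMk (s d : A.domain) :
    2 * ‖(chiralMk s d : WithLp 2 (H × H))‖ ^ 2 = ‖(s : H)‖ ^ 2 + ‖(d : H)‖ ^ 2 := by
  have hadd : (1 / 2 : ℂ) • ((s : H) + d) + (1 / 2 : ℂ) • ((s : H) - d) = s := by module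
  have hsub : (1 / 2 : ℂ) • ((s : H) - d) - (1 / 2 : ℂ) • ((s : H) + d) = -d := by module
  rw [two_mul_norm_sq_withLp, ← norm_neg (d : H)]
  exact congrArg₂ (fun a b : H => ‖a‖ ^ 2 + ‖b‖ ^ 2) hadd hsub

theorem surjective_subScalar_chiralDouble_iff :
    Function.Surjective (subScalar (chiralDouble A) z) ↔
      Function.Surjective (subScalar A z) ∧ Function.Surjective (subScalar A (-z)) := by
  refine ⟨fun h => ⟨fun y => ?_, fun y => ?_⟩, fun ⟨hpos, hneg⟩ w => ?_⟩
  · obtain ⟨v, hv⟩ := h (WithLp.toLp 2 (y, 0))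
    obtain ⟨s, d, rfl⟩ := chiralMk_surjective v
    exact ⟨s, by rw [← fst_add_snd_subScalar_chiralMk s d, hv]; exact add_zero y⟩
  · obtain ⟨v, hv⟩ := h (WithLp.toLp 2 (0, y))
    obtain ⟨s, d, rfl⟩ := chiralMk_surjective v
    exact ⟨d, by rw [← snd_sub_fst_subScalar_chiralMk s d, hv]; exact sub_zero y⟩
  · obtain ⟨s, hs⟩ := hpos (w.fst + w.snd)
    obtain ⟨d, hd⟩ := hneg (w.snd - w.fst)
    refine ⟨chiralMk s d, ?_⟩
    have hadd := fst_add_snd_subScalar_chiralMk (z := z) s d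
    have hsub := snd_sub_fst_subScalar_chiralMk (z := z) s d
    rw [hs] at hadd
    rw [hd] at hsub
    generalize subScalar (chiralDouble A) z (chiralMk s d) = v at hadd hsub
    have hfst : v.fst = w.fst := by
      linear_combination (norm := module) (1 / 2 : ℂ) • hadd - (1 / 2 : ℂ) • hsub
    have hsnd : v.snd = w.snd := by
      linear_combination (norm := module) (1 / 2 : ℂ) • hadd + (1 / 2 : ℂ) • hsub
    exact WithLp.ofLp_injective 2 (Prod.ext hfst hsnd)

theorem isResolventPoint_chiralDouble_iff :
    IsResolventPoint (chiralDouble A) z ↔ IsResolventPoint A z ∧ IsResolventPoint A (-z) := by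
  constructor
  · intro h
    obtain ⟨c, hc, hbound⟩ := h.exists_bound
    have hsq (s d : A.domain) :
        c ^ 2 * (‖(s : H)‖ ^ 2 + ‖(d : H)‖ ^ 2) ≤
          ‖subScalar A z s‖ ^ 2 + ‖subScalar A (-z) d‖ ^ 2 := by
      rw [← two_mul_norm_sq_chiralMk, ← two_mul_norm_sq_subScalar_chiralMk, mul_left_comm,
        ← mul_pow]
      gcongr
      exact hbound _
    obtain ⟨hpos, hneg⟩ := surjective_subScalar_chiralDouble_iff.mp h.surjective
    constructor
    · refine isResolventPoint_of_surjective hc (fun x => ?_) hpos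
      refine le_of_sq_le_sq ?_ (norm_nonneg _)
      simpa [mul_pow] using hsq x 0
    · refine isResolventPoint_of_surjective hc (fun x => ?_) hneg
      refine le_of_sq_le_sq ?_ (norm_nonneg _)
      simpa [mul_pow] using hsq 0 x
  · rintro ⟨hpos, hneg⟩
    obtain ⟨c, hc, hbound⟩ := hpos.exists_bound
    obtain ⟨c', hc', hbound'⟩ := hneg.exists_bound
    refine isResolventPoint_of_surjective (lt_min hc hc') (fun v => ?_)
      (surjective_subScalar_chiralDouble_iff.mpr ⟨hpos.surjective, hneg.surjective⟩)
    obtain ⟨s, d, rfl⟩ := chiralMk_surjective v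
    refine le_of_sq_le_sq (le_of_mul_le_mul_left ?_ two_pos) (norm_nonneg _)
    rw [two_mul_norm_sq_subScalar_chiralMk, mul_pow, mul_left_comm, two_mul_norm_sq_chiralMk,
      mul_add, ← mul_pow, ← mul_pow]
    gcongr
    · exact (mul_le_mul_of_nonneg_right (min_le_left c c') (norm_nonneg _)).trans (hbound s)
    · exact (mul_le_mul_of_nonneg_right (min_le_right c c') (norm_nonneg _)).trans (hbound' d)

theorem spec_chiralDouble : spec (chiralDouble A) = {z : ℂ | z ∈ spec A ∨ -z ∈ spec A} := by
  ext z
  simp only [spec, Set.mem_ofPred_eq, isResolventPoint_chiralDouble_iff, not_and_or]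

end ChiralDouble

section Symmetric

variable {H : Type*} [NormedAddCommGroup H] [InnerProductSpace ℂ H] {A : H →ₗ.[ℂ] H} {z : ℂ}

theorem inner_subScalar_left (hA : A.IsFormalAdjoint A) (x y : A.domain) :
    ⟪subScalar A z x, (y : H)⟫_ℂ = ⟪(x : H), subScalar A (conj z) y⟫_ℂ := by
  simp only [subScalar_apply, inner_sub_left, inner_sub_right, inner_smul_left, inner_smul_right,
    hA x y]

theorem im_inner_apply_self (hA : A.IsFormalAdjoint A) (x : A.domain) :
    (⟪(x : H), A x⟫_ℂ).im = 0 := by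
  have h := hA x x
  rw [← inner_conj_symm] at h
  exact Complex.conj_eq_iff_im.mp h

theorem im_inner_subScalar_self (hA : A.IsFormalAdjoint A) (x : A.domain) :
    (⟪(x : H), subScalar A z x⟫_ℂ).im = -z.im * ‖(x : H)‖ ^ 2 := by
  rw [subScalar_apply, inner_sub_right, inner_smul_right, inner_self_eq_norm_sq_to_K,
    Complex.sub_im, im_inner_apply_self hA, ← RCLike.ofReal_pow]
  change 0 - (z * (↑(‖(x : H)‖ ^ 2) : ℂ)).im = _
  rw [Complex.im_mul_ofReal]
  ring

theorem abs_im_mul_norm_le (hA : A.IsFormalAdjoint A) (x : A.domain) :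
    |z.im| * ‖(x : H)‖ ≤ ‖subScalar A z x‖ := by
  rcases eq_or_ne (x : H) 0 with hx | hx
  · simp [hx]
  refine le_of_mul_le_mul_right ?_ (norm_pos_iff.mpr hx)
  calc |z.im| * ‖(x : H)‖ * ‖(x : H)‖ = |(⟪(x : H), subScalar A z x⟫_ℂ).im| := by
        rw [im_inner_subScalar_self hA, abs_mul, abs_neg, abs_of_nonneg (sq_nonneg ‖(x : H)‖)]
        ring
    _ ≤ ‖(x : H)‖ * ‖subScalar A z x‖ :=
        (Complex.abs_im_le_norm _).trans (norm_inner_le_norm _ _)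
    _ = ‖subScalar A z x‖ * ‖(x : H)‖ := mul_comm _ _

theorem norm_subScalar_conj (hA : A.IsFormalAdjoint A) (x : A.domain) :
    ‖subScalar A (conj z) x‖ = ‖subScalar A z x‖ := by
  have hre : RCLike.re ⟪A x, conj z • (x : H)⟫_ℂ = RCLike.re ⟪A x, z • (x : H)⟫_ℂ := by
    have him := im_inner_apply_self hA x
    rw [inner_smul_right, inner_smul_right, hA x x]
    simp [him]
  refine (sq_eq_sq₀ (norm_nonneg _) (norm_nonneg _)).mp ?_
  rw [subScalar_apply, subScalar_apply, norm_sub_sq (𝕜 := ℂ), norm_sub_sq (𝕜 := ℂ), hre,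
    norm_smul, norm_smul, Complex.norm_conj]

theorem IsResolvent.isSymmetric {R : H →L[ℂ] H} (hA : A.IsFormalAdjoint A) {t : ℝ}
    (hR : IsResolvent A t R) : R.toLinearMap.IsSymmetric := fun x y => by
  have h := inner_subScalar_left (z := t) hA ⟨R x, hR.mem_domain x⟩ ⟨R y, hR.mem_domain y⟩
  rw [Complex.conj_ofReal, hR.right_inv, hR.right_inv] at h
  exact h.symm

variable [CompleteSpace H]

theorem dense_domain_of_surjective (hA : A.IsFormalAdjoint A)
    (hz : Function.Surjective (subScalar A z)) (hz' : Function.Surjective (subScalar A (conj z))) :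
    Dense (A.domain : Set H) := by
  rw [Submodule.dense_iff_topologicalClosure_eq_top, Submodule.topologicalClosure_eq_top_iff,
    Submodule.eq_bot_iff]
  intro w hw
  obtain ⟨x, rfl⟩ := hz w
  obtain ⟨u, hu⟩ := hz' x
  have hx : (x : H) = 0 := by
    rw [← inner_self_eq_zero (𝕜 := ℂ)]
    nth_rw 2 [← hu]
    rw [← inner_subScalar_left hA]
    exact Submodule.inner_left_of_mem_orthogonal u.2 hw
  rw [Subtype.ext (a2 := (0 : A.domain)) hx, map_zero]

theorem isSelfAdjoint_of_surjective (hA : A.IsFormalAdjoint A)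
    (hz : Function.Surjective (subScalar A z)) (hz' : Function.Surjective (subScalar A (conj z))) :
    IsSelfAdjoint A := by
  have hdense := dense_domain_of_surjective hA hz hz'
  have hle : A ≤ A.adjoint := hA.le_adjoint hdense
  rw [LinearPMap.isSelfAdjoint_def]
  refine (LinearPMap.eq_of_le_of_domain_eq hle (le_antisymm hle.1 fun y hy => ?_)).symm
  obtain ⟨x, hx⟩ := hz (A.adjoint ⟨y, hy⟩ - z • y)
  suffices y - x = 0 by
    rw [sub_eq_zero.mp this]
    exact x.2
  obtain ⟨u, hu⟩ := hz' (y - x)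
  have hy_inner : ⟪y, subScalar A (conj z) u⟫_ℂ = ⟪A.adjoint ⟨y, hy⟩ - z • y, (u : H)⟫_ℂ := by
    rw [subScalar_apply, inner_sub_right, inner_sub_left, inner_smul_left, inner_smul_right,
      LinearPMap.adjoint_isFormalAdjoint hdense ⟨y, hy⟩ u]
  rw [← inner_self_eq_zero (𝕜 := ℂ)]
  nth_rw 2 [← hu]
  rw [inner_sub_left, hy_inner, ← inner_subScalar_left hA, hx, sub_self]

theorem isFormalAdjoint_of_isSelfAdjoint (hA : IsSelfAdjoint A) : A.IsFormalAdjoint A := by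
  have h := LinearPMap.adjoint_isFormalAdjoint hA.dense_domain
  rwa [LinearPMap.isSelfAdjoint_def.mp hA] at h

theorem isClosed_range_subScalar (hA : A.IsClosed) {c : ℝ} (hc : 0 < c)
    (hbound : ∀ x : A.domain, c * ‖(x : H)‖ ≤ ‖subScalar A z x‖) :
    IsClosed (LinearMap.range (subScalar A z) : Set H) := by
  have : CompleteSpace A.graph := hA.completeSpace_coe
  let S : A.graph →L[ℂ] H :=
    (ContinuousLinearMap.snd ℂ H H - z • ContinuousLinearMap.fst ℂ H H).comp A.graph.subtypeL
  have hS_mk (u : A.domain) : S ⟨_, A.mem_graph u⟩ = subScalar A z u := rfl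
  have exists_mk (g : A.graph) : ∃ u : A.domain, g = ⟨_, A.mem_graph u⟩ := by
    obtain ⟨u, hu, hAu⟩ := (LinearPMap.mem_graph_iff A).mp g.2
    exact ⟨u, Subtype.ext (Prod.ext hu.symm hAu.symm)⟩
  have hrange : (LinearMap.range (subScalar A z) : Set H) = Set.range S := by
    ext y
    constructor
    · rintro ⟨u, rfl⟩
      exact ⟨_, hS_mk u⟩
    · rintro ⟨g, rfl⟩
      obtain ⟨u, rfl⟩ := exists_mk g
      exact ⟨u, (hS_mk u).symm⟩
  have hS : AntilipschitzWith (Real.toNNReal (c⁻¹ + (1 + ‖z‖ * c⁻¹))) S := by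
    refine ContinuousLinearMap.antilipschitz_of_bound _ fun g => ?_
    obtain ⟨u, rfl⟩ := exists_mk g
    rw [hS_mk, Real.coe_toNNReal _ (by positivity)]
    have hu : ‖(u : H)‖ ≤ c⁻¹ * ‖subScalar A z u‖ := (le_inv_mul_iff₀ hc).mpr (hbound u)
    have hAu : ‖A u‖ ≤ (1 + ‖z‖ * c⁻¹) * ‖subScalar A z u‖ :=
      calc ‖A u‖ = ‖subScalar A z u + z • (u : H)‖ := by rw [subScalar_apply, sub_add_cancel]
        _ ≤ ‖subScalar A z u‖ + ‖z‖ * ‖(u : H)‖ := (norm_add_le _ _).trans_eq (by rw [norm_smul])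
        _ ≤ ‖subScalar A z u‖ + ‖z‖ * (c⁻¹ * ‖subScalar A z u‖) := by gcongr
        _ = (1 + ‖z‖ * c⁻¹) * ‖subScalar A z u‖ := by ring
    calc max ‖(u : H)‖ ‖A u‖ ≤ ‖(u : H)‖ + ‖A u‖ :=
          max_le_add_of_nonneg (norm_nonneg _) (norm_nonneg _)
      _ ≤ (c⁻¹ + (1 + ‖z‖ * c⁻¹)) * ‖subScalar A z u‖ := by linarith
  rw [hrange]
  exact hS.isClosed_range S.uniformContinuous

theorem exists_apply_eq_of_mem_orthogonal_range (hA : IsSelfAdjoint A) {w : H}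
    (hw : w ∈ (LinearMap.range (subScalar A z))ᗮ) :
    ∃ x : A.domain, (x : H) = w ∧ subScalar A (conj z) x = 0 := by
  have hadj (x : A.domain) : ⟪conj z • w, (x : H)⟫_ℂ = ⟪w, A x⟫_ℂ := by
    have h := Submodule.inner_left_of_mem_orthogonal (LinearMap.mem_range_self _ x) hw
    rw [subScalar_apply, inner_sub_right, sub_eq_zero] at h
    rw [h, inner_smul_left, inner_smul_right, Complex.conj_conj]
  have hmem : (w, conj z • w) ∈ A.adjoint.graph :=
    (LinearPMap.mem_graph_iff _).mpr ⟨⟨w, LinearPMap.mem_adjoint_domain_of_exists _ ⟨_, hadj⟩⟩, rfl,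
      LinearPMap.adjoint_apply_eq hA.dense_domain _ hadj⟩
  rw [LinearPMap.isSelfAdjoint_def.mp hA] at hmem
  obtain ⟨x, hx, hAx⟩ := (LinearPMap.mem_graph_iff _).mp hmem
  exact ⟨x, hx, by rw [subScalar_apply, hAx, hx, sub_self]⟩

theorem isResolventPoint_of_bound (hA : IsSelfAdjoint A) {c : ℝ} (hc : 0 < c)
    (hbound : ∀ x : A.domain, c * ‖(x : H)‖ ≤ ‖subScalar A z x‖) : IsResolventPoint A z := by
  refine isResolventPoint_of_surjective hc hbound (LinearMap.range_eq_top.mp ?_)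
  have : CompleteSpace (LinearMap.range (subScalar A z)) :=
    (isClosed_range_subScalar hA.isClosed hc hbound).completeSpace_coe
  rw [← Submodule.orthogonal_eq_bot_iff, Submodule.eq_bot_iff]
  intro w hw
  obtain ⟨x, rfl, hx⟩ := exists_apply_eq_of_mem_orthogonal_range hA hw
  have hx' : subScalar A z x = 0 := by
    rw [← norm_eq_zero, ← norm_subScalar_conj (isFormalAdjoint_of_isSelfAdjoint hA), hx, norm_zero]
  rw [(map_eq_zero_iff _ (injective_subScalar_of_bound hc hbound)).mp hx']
  rfl

theorem isResolventPoint_of_im_ne_zero (hA : IsSelfAdjoint A) (hz : z.im ≠ 0) :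
    IsResolventPoint A z :=
  isResolventPoint_of_bound hA (abs_pos.mpr hz)
    (abs_im_mul_norm_le (isFormalAdjoint_of_isSelfAdjoint hA))

theorem eq_ofReal_of_mem_spec (hA : IsSelfAdjoint A) (hz : z ∈ spec A) : z = (z.re : ℂ) := by
  have him : z.im = 0 := not_not.mp fun h => hz (isResolventPoint_of_im_ne_zero hA h)
  exact Complex.ext rfl (him.trans (Complex.ofReal_im _).symm)

theorem isSelfAdjoint_shift (hA : IsSelfAdjoint A) (E : ℝ) : IsSelfAdjoint (shift A E) := by
  have hres {w : ℂ} (hw : w.im ≠ 0) : IsResolventPoint (shift A E) w :=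
    isResolventPoint_shift_iff.mpr (isResolventPoint_of_im_ne_zero hA (by simpa using hw))
  refine isSelfAdjoint_of_surjective (fun x y => ?_)
    (hres (w := Complex.I) (by simp)).surjective (hres (by simp)).surjective
  have h := inner_subScalar_left (z := E) (isFormalAdjoint_of_isSelfAdjoint hA) x y
  rwa [Complex.conj_ofReal] at h

theorem isSelfAdjoint_chiralDouble (hA : IsSelfAdjoint A) : IsSelfAdjoint (chiralDouble A) := by
  have hres {w : ℂ} (hw : w.im ≠ 0) : IsResolventPoint (chiralDouble A) w :=
    isResolventPoint_chiralDouble_iff.mpr ⟨isResolventPoint_of_im_ne_zero hA hw,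
      isResolventPoint_of_im_ne_zero hA (by simpa using hw)⟩
  refine isSelfAdjoint_of_surjective (fun x y => ?_)
    (hres (w := Complex.I) (by simp)).surjective (hres (by simp)).surjective
  have hsnd := isFormalAdjoint_of_isSelfAdjoint hA ⟨x.1.snd, x.2.2⟩ ⟨y.1.fst, y.2.1⟩
  have hfst := isFormalAdjoint_of_isSelfAdjoint hA ⟨x.1.fst, x.2.1⟩ ⟨y.1.snd, y.2.2⟩
  rw [WithLp.prod_inner_apply, WithLp.prod_inner_apply]
  exact (congrArg₂ (· + ·) hsnd hfst).trans (add_comm _ _)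

end Symmetric

section SpectralGap

variable {H : Type*} [NormedAddCommGroup H] [InnerProductSpace ℂ H] [CompleteSpace H]
  {A : H →ₗ.[ℂ] H} {z : ℂ}

theorem IsResolvent.notMem_spectrum {R : H →L[ℂ] H} (hR : IsResolvent A z R) {w : ℂ} (hw : w ≠ 0)
    (h : IsResolventPoint A (z + w⁻¹)) : w ∉ spectrum ℂ R := by
  have hfactor (u : A.domain) :
      w • subScalar A z u - u = w • subScalar A (z + w⁻¹) u := by
    simp only [subScalar_apply, smul_sub, add_smul, smul_add, smul_inv_smul₀ hw]
    abel
  rw [spectrum.notMem_iff, ContinuousLinearMap.isUnit_iff_bijective]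
  have happly (u : A.domain) : (algebraMap ℂ (H →L[ℂ] H) w - R) (subScalar A z u) =
      w • subScalar A (z + w⁻¹) u := by
    rw [← hfactor, ← hR.left_inv u]
    rfl
  constructor
  · rw [injective_iff_map_eq_zero]
    intro y hy
    rw [← hR.right_inv y] at hy ⊢
    rw [happly, smul_eq_zero_iff_right hw, map_eq_zero_iff _ h.injective] at hy
    rw [hy, map_zero]
  · intro y
    obtain ⟨u, hu⟩ := h.surjective (w⁻¹ • y)
    exact ⟨subScalar A z u, by rw [happly, hu, smul_inv_smul₀ hw]⟩

theorem IsResolvent.norm_le {R : H →L[ℂ] H} (hA : IsSelfAdjoint A) {t r : ℝ}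
    (hR : IsResolvent A t R) (hr : 0 < r) (hgap : ∀ w ∈ spec A, r ≤ dist w t) : ‖R‖ ≤ r⁻¹ := by
  have hsymm : IsSelfAdjoint R := ContinuousLinearMap.isSelfAdjoint_iff_isSymmetric.mpr
    (hR.isSymmetric (isFormalAdjoint_of_isSelfAdjoint hA))
  have hspec (w : ℂ) (hw : w ∈ spectrum ℂ R) : ‖w‖ ≤ r⁻¹ := by
    rcases eq_or_ne w 0 with rfl | hw0
    · rw [norm_zero]; positivity
    have hmem : t + w⁻¹ ∈ spec A := fun h => hR.notMem_spectrum hw0 h hw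
    have hdist := hgap _ hmem
    rw [dist_self_add_left, norm_inv] at hdist
    exact (le_inv_comm₀ hr (norm_pos_iff.mpr hw0)).mp hdist
  have hradius : spectralRadius ℂ R ≤ (Real.toNNReal r⁻¹ : ℝ≥0∞) :=
    iSup₂_le fun w hw => ENNReal.coe_le_coe.mpr (NNReal.le_toNNReal_of_coe_le (hspec w hw))
  rw [hsymm.spectralRadius_eq_nnnorm, ENNReal.coe_le_coe] at hradius
  exact (Real.le_toNNReal_iff_coe_le (by positivity)).mp hradius

theorem mul_norm_le_of_gap (hA : IsSelfAdjoint A) {t r : ℝ} (hr : 0 < r)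
    (hgap : ∀ w ∈ spec A, r ≤ dist w t) (x : A.domain) : r * ‖(x : H)‖ ≤ ‖subScalar A t x‖ := by
  have hres : IsResolventPoint A t := not_not.mp fun h =>
    hr.not_ge ((hgap t h).trans_eq (dist_self _))
  obtain ⟨R, hR⟩ := hres.exists_isResolvent
  rw [← le_inv_mul_iff₀ hr]
  calc ‖(x : H)‖ = ‖R (subScalar A t x)‖ := by rw [hR.left_inv]
    _ ≤ r⁻¹ * ‖subScalar A t x‖ := R.le_of_opNorm_le (hR.norm_le hA hr hgap) _

end SpectralGap

/-! ### Tensoring with the identity -/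

section TensorOperator

variable {H : Type*} [NormedAddCommGroup H] [InnerProductSpace ℂ H] {A : H →ₗ.[ℂ] H} {z : ℂ}
  {K : Type*} [NormedAddCommGroup K] [InnerProductSpace ℂ K]

/-- The inclusion of the algebraic tensor product into the Hilbert tensor product. -/
noncomputable def tensorCoe (H K : Type*) [NormedAddCommGroup H] [InnerProductSpace ℂ H]
    [NormedAddCommGroup K] [InnerProductSpace ℂ K] : H ⊗[ℂ] K →L[ℂ] HilbertTensor H K :=
  UniformSpace.Completion.toComplL

theorem inner_tensorCoe (x y : H ⊗[ℂ] K) :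
    ⟪tensorCoe H K x, tensorCoe H K y⟫_ℂ = ⟪x, y⟫_ℂ :=
  UniformSpace.Completion.inner_coe x y

theorem hilbertTensor_induction {P : HilbertTensor H K → Prop} (hP : IsClosed {x | P x})
    (h : ∀ t, P (tensorCoe H K t)) (x : HilbertTensor H K) : P x :=
  UniformSpace.Completion.induction_on x hP h

theorem eq_top_of_tmul_mem {V : Submodule ℂ (HilbertTensor H K)}
    (hV : IsClosed (V : Set (HilbertTensor H K)))
    (h : ∀ x k, tensorCoe H K (x ⊗ₜ[ℂ] k) ∈ V) : V = ⊤ := by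
  rw [Submodule.eq_top_iff']
  refine hilbertTensor_induction hV fun t => ?_
  induction t with
  | zero => exact V.zero_mem
  | add s t hs ht => rw [map_add]; exact V.add_mem hs ht
  | tmul x k => exact h x k

theorem algTensorId_apply (t : A.domain ⊗[ℂ] K) :
    algTensorId K A ⟨tensorIncl K A.domain t, ⟨t, rfl⟩⟩ =
      tensorCoe H K (LinearMap.rTensor K A.toFun t) :=
  congrArg (fun s => tensorCoe H K (LinearMap.rTensor K A.toFun s))
    ((LinearEquiv.ofInjective _ (tensorIncl_injective K A.domain)).symm_apply_apply t)

theorem mem_graph_algTensorId_iff {p : HilbertTensor H K × HilbertTensor H K} :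
    p ∈ (algTensorId K A).graph ↔ ∃ t : A.domain ⊗[ℂ] K,
      tensorCoe H K (LinearMap.rTensor K A.domain.subtype t) = p.1 ∧
        tensorCoe H K (LinearMap.rTensor K A.toFun t) = p.2 := by
  rw [LinearPMap.mem_graph_iff]
  constructor
  · rintro ⟨⟨_, t, rfl⟩, hfst, hsnd⟩
    exact ⟨t, hfst, (algTensorId_apply t).symm.trans hsnd⟩
  · rintro ⟨t, hfst, hsnd⟩
    exact ⟨⟨tensorIncl K A.domain t, ⟨t, rfl⟩⟩, hfst, (algTensorId_apply t).trans hsnd⟩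

theorem inner_rTensor (hA : A.IsFormalAdjoint A) (s t : A.domain ⊗[ℂ] K) :
    ⟪LinearMap.rTensor K A.toFun s, LinearMap.rTensor K A.domain.subtype t⟫_ℂ =
      ⟪LinearMap.rTensor K A.domain.subtype s, LinearMap.rTensor K A.toFun t⟫_ℂ := by
  induction s with
  | zero => simp
  | add s s' hs hs' => simp only [map_add, inner_add_left, hs, hs']
  | tmul x k =>
    induction t with
    | zero => simp
    | add t t' ht ht' => simp only [map_add, inner_add_right, ht, ht']
    | tmul y l =>
      simp only [LinearMap.rTensor_tmul, TensorProduct.inner_tmul]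
      exact congrArg (· * ⟪k, l⟫_ℂ) (hA x y)

theorem isFormalAdjoint_algTensorId (hA : A.IsFormalAdjoint A) :
    (algTensorId K A).IsFormalAdjoint (algTensorId K A) := by
  rintro ⟨_, s, rfl⟩ ⟨_, t, rfl⟩
  rw [algTensorId_apply, algTensorId_apply]
  exact (inner_tensorCoe _ _).trans ((inner_rTensor hA s t).trans (inner_tensorCoe _ _).symm)

theorem dense_domain_algTensorId (hA : Dense (A.domain : Set H)) :
    Dense ((algTensorId K A).domain : Set (HilbertTensor H K)) := by
  have hclosed := (algTensorId K A).domain.isClosed_topologicalClosure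
  refine Submodule.dense_iff_topologicalClosure_eq_top.mpr
    (eq_top_of_tmul_mem hclosed fun x k => ?_)
  have hcont : Continuous fun x : H => tensorCoe H K (x ⊗ₜ[ℂ] k) :=
    (tensorCoe H K).continuous.comp
      (TensorProduct.continuous_tmul.comp (by fun_prop : Continuous fun x : H => (x, k)))
  refine hA.induction (P := fun x => tensorCoe H K (x ⊗ₜ[ℂ] k) ∈
    (algTensorId K A).domain.topologicalClosure) (fun x hx => ?_) (hclosed.preimage hcont) x
  exact Submodule.le_topologicalClosure _ ⟨(⟨x, hx⟩ : A.domain) ⊗ₜ[ℂ] k, rfl⟩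

theorem graph_tensorId (hd : Dense (A.domain : Set H)) (hA : A.IsFormalAdjoint A) :
    (tensorId K A).graph = (algTensorId K A).graph.topologicalClosure := by
  have hdense := dense_domain_algTensorId (K := K) hd
  exact ((LinearPMap.adjoint_isClosed hdense).isClosable.leIsClosable
    ((isFormalAdjoint_algTensorId hA).le_adjoint hdense)).graph_closure_eq_closure_graph.symm

theorem graph_tensorId_induction (hd : Dense (A.domain : Set H)) (hA : A.IsFormalAdjoint A)
    {P : HilbertTensor H K → HilbertTensor H K → Prop} (hP : IsClosed {p : _ × _ | P p.1 p.2})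
    (h : ∀ t : A.domain ⊗[ℂ] K, P (tensorCoe H K (LinearMap.rTensor K A.domain.subtype t))
      (tensorCoe H K (LinearMap.rTensor K A.toFun t))) (x : (tensorId K A).domain) :
    P x (tensorId K A x) := by
  have hx := (tensorId K A).mem_graph x
  rw [graph_tensorId hd hA] at hx
  refine closure_minimal (t := {p : _ × _ | P p.1 p.2}) (fun p hp => ?_) hP hx
  obtain ⟨t, hfst, hsnd⟩ := mem_graph_algTensorId_iff.mp hp
  have ht := h t
  rwa [hfst, hsnd] at ht

theorem isFormalAdjoint_tensorId (hd : Dense (A.domain : Set H)) (hA : A.IsFormalAdjoint A) :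
    (tensorId K A).IsFormalAdjoint (tensorId K A) := by
  intro x y
  refine graph_tensorId_induction hd hA
    (P := fun u v => ⟪v, (y : HilbertTensor H K)⟫_ℂ = ⟪u, tensorId K A y⟫_ℂ)
    (isClosed_eq (by fun_prop) (by fun_prop)) (fun s => ?_) x
  refine graph_tensorId_induction hd hA
    (P := fun u v => ⟪tensorCoe H K (LinearMap.rTensor K A.toFun s), u⟫_ℂ =
      ⟪tensorCoe H K (LinearMap.rTensor K A.domain.subtype s), v⟫_ℂ)
    (isClosed_eq (by fun_prop) (by fun_prop)) (fun t => ?_) y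
  rw [inner_tensorCoe, inner_tensorCoe, inner_rTensor hA]

theorem rTensor_mem_graph_tensorId (t : A.domain ⊗[ℂ] K) :
    (tensorCoe H K (LinearMap.rTensor K A.domain.subtype t),
      tensorCoe H K (LinearMap.rTensor K A.toFun t)) ∈ (tensorId K A).graph :=
  LinearPMap.le_graph_of_le (LinearPMap.le_closure _) (mem_graph_algTensorId_iff.mpr ⟨t, rfl, rfl⟩)

theorem isResolvent_of_graph {R : H →L[ℂ] H} (hgraph : ∀ x, (R x, x + z • R x) ∈ A.graph)
    (hleft : ∀ x : A.domain, R (subScalar A z x) = x) : IsResolvent A z R where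
  mem_domain x := A.mem_domain_of_mem_graph (hgraph x)
  right_inv x := by
    rw [subScalar_apply, ← (LinearPMap.image_iff _).mpr (hgraph x), add_sub_cancel_right]
  left_inv := hleft

theorem IsResolvent.exists_comp_eq {R : H →L[ℂ] H} (hR : IsResolvent A z R) :
    ∃ S : H →ₗ[ℂ] A.domain, A.domain.subtype ∘ₗ S = R ∧
      A.toFun ∘ₗ S = LinearMap.id + z • (R : H →ₗ[ℂ] H) :=
  ⟨(R : H →ₗ[ℂ] H).codRestrict A.domain hR.mem_domain, LinearMap.subtype_comp_codRestrict _ _ _,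
    LinearMap.ext fun x => sub_eq_iff_eq_add.mp (hR.right_inv x)⟩

theorem IsResolvent.rTensor_completion (hd : Dense (A.domain : Set H)) (hA : A.IsFormalAdjoint A)
    {R : H →L[ℂ] H} (hR : IsResolvent A z R) :
    IsResolvent (tensorId K A) z (R.rTensor K).completion := by
  have hcoe (t : H ⊗[ℂ] K) : (R.rTensor K).completion (tensorCoe H K t) =
      tensorCoe H K (LinearMap.rTensor K (R : H →ₗ[ℂ] H) t) :=
    ContinuousLinearMap.completion_apply_coe (R.rTensor K) t
  generalize (R.rTensor K).completion = T at hcoe ⊢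
  refine isResolvent_of_graph ?_ fun x => ?_
  · have hclosed : IsClosed ((tensorId K A).graph :
        Set (HilbertTensor H K × HilbertTensor H K)) := by
      rw [graph_tensorId hd hA]
      exact Submodule.isClosed_topologicalClosure _
    refine hilbertTensor_induction (P := fun x => (T x, x + z • T x) ∈ (tensorId K A).graph)
      (hclosed.preimage (T.continuous.prodMk (continuous_id.add (T.continuous.const_smul z))))
      fun t => ?_
    obtain ⟨S, hincl, happly⟩ := hR.exists_comp_eq
    have h := rTensor_mem_graph_tensorId (A := A) (LinearMap.rTensor K S t)
    rwa [← LinearMap.rTensor_comp_apply, ← LinearMap.rTensor_comp_apply, hincl, happly,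
      LinearMap.rTensor_add, LinearMap.rTensor_smul, LinearMap.rTensor_id, LinearMap.add_apply,
      LinearMap.smul_apply, LinearMap.id_apply, map_add, map_smul, ← hcoe] at h
  · refine graph_tensorId_induction hd hA (P := fun u v => T (v - z • u) = u)
      (isClosed_eq (T.continuous.comp (continuous_snd.sub (continuous_fst.const_smul z)))
        continuous_fst) (fun t => ?_) x
    have hcomp : (R : H →ₗ[ℂ] H) ∘ₗ (A.toFun - z • A.domain.subtype) = A.domain.subtype :=
      LinearMap.ext hR.left_inv
    rw [← map_smul, ← map_sub, ← LinearMap.smul_apply, ← LinearMap.rTensor_smul,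
      ← LinearMap.sub_apply, ← LinearMap.rTensor_sub, hcoe, ← LinearMap.rTensor_comp_apply, hcomp]

theorem isResolventPoint_tensorId (hd : Dense (A.domain : Set H)) (hA : A.IsFormalAdjoint A)
    (h : IsResolventPoint A z) : IsResolventPoint (tensorId K A) z :=
  let ⟨_, hR⟩ := h.exists_isResolvent
  (hR.rTensor_completion hd hA).isResolventPoint

/-- The isometry `x ↦ x ⊗ k` for a unit vector `k`; it embeds a copy of `A` into `A ⊗ I`. -/
noncomputable def tmulIsometry (H : Type*) [NormedAddCommGroup H] [InnerProductSpace ℂ H] {k : K}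
    (hk : ‖k‖ = 1) : H →ₗᵢ[ℂ] HilbertTensor H K where
  toLinearMap := (tensorCoe H K).toLinearMap ∘ₗ (TensorProduct.mk ℂ H K).flip k
  norm_map' x :=
    calc ‖tensorCoe H K (x ⊗ₜ[ℂ] k)‖ = ‖x ⊗ₜ[ℂ] k‖ := UniformSpace.Completion.norm_coe _
      _ = ‖x‖ := by rw [TensorProduct.norm_tmul, hk, mul_one]

theorem tmulIsometry_apply {k : K} (hk : ‖k‖ = 1) (x : H) :
    tmulIsometry H hk x = tensorCoe H K (x ⊗ₜ[ℂ] k) := rfl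

theorem tmulIsometry_intertwines {k : K} (hk : ‖k‖ = 1) (x : A.domain) :
    ∃ h : tmulIsometry H hk x ∈ (tensorId K A).domain,
      tensorId K A ⟨tmulIsometry H hk x, h⟩ = tmulIsometry H hk (A x) := by
  have h := rTensor_mem_graph_tensorId (K := K) (x ⊗ₜ[ℂ] k)
  exact ⟨_, ((LinearPMap.image_iff (LinearPMap.mem_domain_of_mem_graph h)).mpr h).symm⟩

variable [CompleteSpace H]

theorem isSelfAdjoint_tensorId (hA : IsSelfAdjoint A) : IsSelfAdjoint (tensorId K A) := by
  have hsymm := isFormalAdjoint_of_isSelfAdjoint hA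
  have hres {w : ℂ} (hw : w.im ≠ 0) : IsResolventPoint (tensorId K A) w :=
    isResolventPoint_tensorId hA.dense_domain hsymm (isResolventPoint_of_im_ne_zero hA hw)
  exact isSelfAdjoint_of_surjective (isFormalAdjoint_tensorId hA.dense_domain hsymm)
    (hres (w := Complex.I) (by simp)).surjective (hres (by simp)).surjective

theorem spec_tensorId [Nontrivial K] (hA : IsSelfAdjoint A) : spec (tensorId K A) = spec A := by
  obtain ⟨k, hk⟩ := exists_norm_eq K zero_le_one
  ext z
  refine not_congr ⟨fun h => ?_, isResolventPoint_tensorId hA.dense_domain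
    (isFormalAdjoint_of_isSelfAdjoint hA)⟩
  obtain ⟨c, hc, hbound⟩ := h.exists_bound
  refine isResolventPoint_of_bound hA hc fun x => ?_
  obtain ⟨hx, happly⟩ := tmulIsometry_intertwines hk x
  have hx_bound := hbound ⟨_, hx⟩
  rwa [subScalar_apply, happly, ← map_smul, ← map_sub, LinearIsometry.norm_map,
    LinearIsometry.norm_map] at hx_bound

end TensorOperator

section Multiplicity

variable {H : Type*} [NormedAddCommGroup H] [InnerProductSpace ℂ H] {A : H →ₗ.[ℂ] H}
  {K : Type} [NormedAddCommGroup K] [InnerProductSpace ℂ K]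

theorem isOrthogonalCopies_tmulIsometry {ι : Type} {b : ι → K} (hb : Orthonormal ℂ b) :
    IsOrthogonalCopies (tensorId K A) A fun i => tmulIsometry H (hb.1 i) where
  orthogonal i j hij x y := by
    rw [tmulIsometry_apply, tmulIsometry_apply, inner_tensorCoe, TensorProduct.inner_tmul,
      hb.2 hij, mul_zero]
  intertwines i x := tmulIsometry_intertwines (hb.1 i) x

theorem iSup_range_tmulIsometry_eq_top {ι : Type*} (b : HilbertBasis ι ℂ K) :
    (⨆ i, LinearMap.range (tmulIsometry H (b.orthonormal.1 i)).toLinearMap).topologicalClosure =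
      ⊤ := by
  set V := (⨆ i, LinearMap.range
    (tmulIsometry H (b.orthonormal.1 i)).toLinearMap).topologicalClosure
  have hV : IsClosed (V : Set (HilbertTensor H K)) := Submodule.isClosed_topologicalClosure _
  refine eq_top_of_tmul_mem hV fun x k => ?_
  let T : K →L[ℂ] HilbertTensor H K := (tensorCoe H K).comp (TensorProduct.mkL ℂ H K x)
  have hbasis : Set.range b ⊆ V.comap T.toLinearMap := by
    rintro _ ⟨i, rfl⟩
    exact Submodule.le_topologicalClosure _ (Submodule.mem_iSup_of_mem i ⟨x, rfl⟩)
  have hk : k ∈ (Submodule.span ℂ (Set.range b)).topologicalClosure := by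
    rw [b.dense_span]
    trivial
  exact Submodule.topologicalClosure_minimal _ (Submodule.span_le.mpr hbasis)
    (hV.preimage T.continuous) hk

variable [CompleteSpace K]

theorem exists_infinite_hilbertBasis (hK : ¬ FiniteDimensional ℂ K) :
    ∃ (w : Set K) (_ : HilbertBasis w ℂ K), Infinite w := by
  obtain ⟨w, b, -⟩ := exists_hilbertBasis ℂ K
  refine ⟨w, b, not_finite_iff_infinite.mp fun _ => hK ?_⟩
  have := Fintype.ofFinite w
  exact Module.Basis.finiteDimensional_of_finite b.toOrthonormalBasis.toBasis

variable [CompleteSpace H]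

theorem hasUniformInfiniteMultiplicity_tensorId (hA : IsSelfAdjoint A)
    (hK : ¬ FiniteDimensional ℂ K) : HasUniformInfiniteMultiplicity (tensorId K A) := by
  obtain ⟨w, b, hw⟩ := exists_infinite_hilbertBasis hK
  exact ⟨w, hw, H, _, _, ‹_›, A, fun i => tmulIsometry H (b.orthonormal.1 i), hA,
    isOrthogonalCopies_tmulIsometry b.orthonormal, iSup_range_tmulIsometry_eq_top b⟩

theorem hasInfiniteMultiplicityAt_tensorId (hA : IsSelfAdjoint A)
    (hK : ¬ FiniteDimensional ℂ K) {z : ℂ} (hz : z ∈ spec A) :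
    HasInfiniteMultiplicityAt (tensorId K A) z := by
  obtain ⟨w, b, hw⟩ := exists_infinite_hilbertBasis hK
  exact ⟨w, hw, H, _, _, ‹_›, A, fun i => tmulIsometry H (b.orthonormal.1 i), hA, hz,
    isOrthogonalCopies_tmulIsometry b.orthonormal⟩

end Multiplicity

end UnboundedOp

/-! ### The finite places -/

namespace FinitePlaces

section Local

variable (p : ℕ) [Fact p.Prime]

/-- The uniformizer `p` as an element of `ℚ_p^×`. -/
noncomputable def uniformizer : (ℚ_[p])ˣ :=
  Units.mk0 (p : ℚ_[p]) (Nat.cast_ne_zero.mpr (Fact.out : p.Prime).ne_zero)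

/-- The translate `p⁻¹ ℤ_p^×`, a set of measure `1` disjoint from `ℤ_p^×`. -/
def shiftedUnits : Set (ℚ_[p])ˣ := (fun x => uniformizer p * x) ⁻¹' integralUnits p

theorem isOpen_shiftedUnits : IsOpen (shiftedUnits p) :=
  (isOpen_integralUnits p).preimage (continuous_const_mul _)

theorem unitsHaar_shiftedUnits : unitsHaar p (shiftedUnits p) = 1 :=
  (measure_preimage_mul (Measure.haarMeasure (integralUnitsCompacts p)) (uniformizer p)
    (integralUnits p)).trans (unitsHaar_integralUnits p)

theorem disjoint_shiftedUnits : Disjoint (shiftedUnits p) (integralUnits p) := by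
  rw [Set.disjoint_left]
  intro x hshifted hunit
  have hshifted_norm : ‖(p : ℚ_[p]) * (x : ℚ_[p])‖ = 1 := hshifted
  have hunit_norm : ‖(x : ℚ_[p])‖ = 1 := hunit
  rw [norm_mul, hunit_norm, mul_one, Padic.norm_p, inv_eq_one] at hshifted_norm
  exact (Fact.out : p.Prime).one_lt.ne' (by exact_mod_cast hshifted_norm)

/-- The indicator function of `p⁻¹ ℤ_p^×`, a unit vector orthogonal to the spherical one. -/
noncomputable def shiftedSpherical : L2Padic p :=
  indicatorConstLp 2 (isOpen_shiftedUnits p).measurableSet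
    (by rw [unitsHaar_shiftedUnits]; exact ENNReal.one_ne_top) (1 : ℂ)

theorem inner_shiftedSpherical_self : ⟪shiftedSpherical p, shiftedSpherical p⟫_ℂ = 1 := by
  have hfinite : unitsHaar p (shiftedUnits p) ≠ ⊤ := by simp [unitsHaar_shiftedUnits]
  rw [shiftedSpherical, L2.inner_indicatorConstLp_indicatorConstLp _ _ hfinite hfinite]
  simp [Measure.real, unitsHaar_shiftedUnits]

theorem inner_shiftedSpherical_spherical : ⟪shiftedSpherical p, spherical p⟫_ℂ = 0 := by
  rw [shiftedSpherical, spherical, L2.inner_indicatorConstLp_indicatorConstLp _ _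
    (by simp [unitsHaar_shiftedUnits]) (by simp [unitsHaar_integralUnits])]
  simp [Measure.real, (disjoint_shiftedUnits p).inter_eq]

end Local

open scoped Classical in
/-- The pure tensor which is spherical outside `q` and the indicator of `q⁻¹ ℤ_q^×` at `q`. -/
noncomputable def ramifiedAt (q : Nat.Primes) : RestrictedFamily :=
  ⟨Function.update (fun p : Nat.Primes => spherical p) q (shiftedSpherical q), by
    refine (Set.finite_singleton q).subset fun p hp => ?_
    by_contra h
    exact hp (Function.update_of_ne h _ _)⟩

theorem ramifiedAt_self (q : Nat.Primes) : (ramifiedAt q).1 q = shiftedSpherical q := by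
  simp [ramifiedAt]

theorem ramifiedAt_of_ne {q p : Nat.Primes} (h : p ≠ q) : (ramifiedAt q).1 p = spherical p := by
  simp [ramifiedAt, h]

theorem pureInner_ramifiedAt_self (q : Nat.Primes) :
    pureInner (ramifiedAt q) (ramifiedAt q) = 1 := by
  refine finprod_eq_one_of_forall_eq_one fun p => ?_
  rcases eq_or_ne p q with rfl | h
  · rw [ramifiedAt_self, inner_shiftedSpherical_self]
  · rw [ramifiedAt_of_ne h, inner_self_eq_norm_sq_to_K, norm_spherical]
    simp

theorem pureInner_ramifiedAt_of_ne {q r : Nat.Primes} (h : q ≠ r) :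
    pureInner (ramifiedAt q) (ramifiedAt r) = 0 := by
  refine finprod_eq_zero _ q ?_ (finite_mulSupport_inner _ _)
  rw [ramifiedAt_self, ramifiedAt_of_ne h, inner_shiftedSpherical_spherical]

/-- A pure tensor as a formal combination of pure tensors. -/
noncomputable def formalTensor (ψ : RestrictedFamily) : FormalTensors :=
  (Finsupp.single ψ 1 : RestrictedFamily →₀ ℂ)

/-- A pure tensor as a vector of the restricted tensor product. -/
noncomputable def pureTensor (ψ : RestrictedFamily) : Hfin := (formalTensor ψ : Hfin)

theorem inner_pureTensor (ψ φ : RestrictedFamily) :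
    ⟪pureTensor ψ, pureTensor φ⟫_ℂ = pureInner ψ φ := by
  refine (UniformSpace.Completion.inner_coe _ _).trans ?_
  change formalInner _ _ = _
  simp [formalInner, formalTensor]

theorem orthonormal_ramifiedAt : Orthonormal ℂ fun q => pureTensor (ramifiedAt q) := by
  classical
  rw [orthonormal_iff_ite]
  intro q r
  rw [inner_pureTensor]
  split_ifs with h
  · rw [h, pureInner_ramifiedAt_self]
  · exact pureInner_ramifiedAt_of_ne h

theorem not_finiteDimensional_Hfin : ¬ FiniteDimensional ℂ Hfin := fun _ =>
  not_finite_iff_infinite.mpr (inferInstanceAs (Infinite Nat.Primes))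
    orthonormal_ramifiedAt.linearIndependent.finite

instance nontrivial_Hfin : Nontrivial Hfin :=
  not_subsingleton_iff_nontrivial.mp fun _ => not_finiteDimensional_Hfin inferInstance

end FinitePlaces

/-! ### Bounded perturbations and semiboundedness -/

namespace UnboundedOp

variable {H : Type*} [NormedAddCommGroup H] [InnerProductSpace ℂ H] {A : H →ₗ.[ℂ] H}

section BoundedPerturbation

variable [CompleteSpace H] {B : H →L[ℂ] H}

theorem mem_adjoint_domain_of_mem_vadd (hA : Dense (A.domain : Set H))
    (hB : (B : H →ₗ[ℂ] H).IsSymmetric) {y : H}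
    (hy : y ∈ ((B : H →ₗ[ℂ] H) +ᵥ A).adjoint.domain) : y ∈ A.adjoint.domain := by
  refine LinearPMap.mem_adjoint_domain_of_exists _
    ⟨((B : H →ₗ[ℂ] H) +ᵥ A).adjoint ⟨y, hy⟩ - B y, fun x => ?_⟩
  have hadjoint : ⟪((B : H →ₗ[ℂ] H) +ᵥ A).adjoint ⟨y, hy⟩, (x : H)⟫_ℂ = ⟪y, B x + A x⟫_ℂ :=
    LinearPMap.adjoint_isFormalAdjoint (T := (B : H →ₗ[ℂ] H) +ᵥ A) hA ⟨y, hy⟩ x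
  have hsymm : ⟪B y, (x : H)⟫_ℂ = ⟪y, B x⟫_ℂ := hB y x
  rw [inner_sub_left, hadjoint, inner_add_right, hsymm, add_sub_cancel_left]

theorem isSelfAdjoint_vadd (hA : IsSelfAdjoint A) (hB : (B : H →ₗ[ℂ] H).IsSymmetric) :
    IsSelfAdjoint ((B : H →ₗ[ℂ] H) +ᵥ A) := by
  have hdense : Dense (A.domain : Set H) := hA.dense_domain
  have hformal : ((B : H →ₗ[ℂ] H) +ᵥ A).IsFormalAdjoint ((B : H →ₗ[ℂ] H) +ᵥ A) := fun x y => by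
    simp only [LinearPMap.vadd_apply, inner_add_left, inner_add_right]
    exact congrArg₂ _ (hB x y) (isFormalAdjoint_of_isSelfAdjoint hA x y)
  have hle : (B : H →ₗ[ℂ] H) +ᵥ A ≤ ((B : H →ₗ[ℂ] H) +ᵥ A).adjoint := hformal.le_adjoint hdense
  rw [LinearPMap.isSelfAdjoint_def]
  refine (LinearPMap.eq_of_le_of_domain_eq hle (hle.1.antisymm fun y hy => ?_)).symm
  have hmem := mem_adjoint_domain_of_mem_vadd hdense hB hy
  rwa [LinearPMap.isSelfAdjoint_def.mp hA] at hmem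

end BoundedPerturbation

section QuadraticForm

theorem re_inner_subScalar (t : ℝ) (x : A.domain) :
    (⟪(x : H), subScalar A t x⟫_ℂ).re = (⟪(x : H), A x⟫_ℂ).re - t * ‖(x : H)‖ ^ 2 := by
  rw [subScalar_apply, inner_sub_right, inner_smul_right, inner_self_eq_norm_sq_to_K,
    Complex.sub_re, Complex.re_ofReal_mul]
  simp [← Complex.ofReal_pow]

theorem norm_subScalar_sq (t : ℝ) (x : A.domain) :
    ‖subScalar A t x‖ ^ 2 =
      ‖A x‖ ^ 2 - 2 * t * (⟪(x : H), A x⟫_ℂ).re + t ^ 2 * ‖(x : H)‖ ^ 2 := by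
  have hinner : RCLike.re ⟪A x, (t : ℂ) • (x : H)⟫_ℂ = t * (⟪(x : H), A x⟫_ℂ).re := by
    rw [inner_smul_right, RCLike.re_eq_complex_re, Complex.re_ofReal_mul]
    exact congrArg (t * ·) (inner_re_symm (𝕜 := ℂ) _ _)
  rw [subScalar_apply, norm_sub_sq (𝕜 := ℂ), hinner, norm_smul, Complex.norm_real, mul_pow,
    Real.norm_eq_abs, sq_abs]
  ring

variable [CompleteSpace H]

theorem re_inner_le_of_spec_le (hA : IsSelfAdjoint A) {M : ℝ}
    (hM : ∀ t : ℝ, (t : ℂ) ∈ spec A → t ≤ M) (x : A.domain) :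
    (⟪(x : H), A x⟫_ℂ).re ≤ M * ‖(x : H)‖ ^ 2 := by
  set d := (⟪(x : H), A x⟫_ℂ).re - M * ‖(x : H)‖ ^ 2
  have two_mul_le {t : ℝ} (ht : M < t) : t * (2 * d) ≤ ‖A x‖ ^ 2 := by
    have hgap : (t - M) * ‖(x : H)‖ ≤ ‖subScalar A t x‖ := by
      refine mul_norm_le_of_gap hA (sub_pos.mpr ht) (fun w hw => ?_) x
      obtain ⟨s, rfl⟩ : ∃ s : ℝ, w = s := ⟨_, eq_ofReal_of_mem_spec hA hw⟩
      rw [dist_comm, Complex.dist_of_im_eq (by simp), Complex.ofReal_re, Complex.ofReal_re]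
      exact (sub_le_sub_left (hM s hw) t).trans (le_abs_self _)
    have hsq := pow_le_pow_left₀ (mul_nonneg (sub_pos.mpr ht).le (norm_nonneg _)) hgap 2
    rw [norm_subScalar_sq] at hsq
    nlinarith [sq_nonneg (M * ‖(x : H)‖)]
  by_contra! hlt
  have hd0 : 0 < 2 * d := by linarith
  obtain ⟨t, hlarge, ht⟩ := (((tendsto_id.atTop_mul_const hd0).eventually_gt_atTop
    (‖A x‖ ^ 2)).and (eventually_gt_atTop M)).exists
  exact (two_mul_le ht).not_gt hlarge

theorem isResolventPoint_of_form_bound (hA : IsSelfAdjoint A) {M t : ℝ}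
    (hM : ∀ x : A.domain, M * ‖(x : H)‖ ^ 2 ≤ (⟪(x : H), A x⟫_ℂ).re) (ht : t < M) :
    IsResolventPoint A t := by
  refine isResolventPoint_of_bound hA (sub_pos.mpr ht) fun x => ?_
  rcases (norm_nonneg (x : H)).eq_or_lt with hzero | hpos
  · rw [← hzero, mul_zero]
    exact norm_nonneg _
  refine le_of_mul_le_mul_left ?_ hpos
  calc ‖(x : H)‖ * ((M - t) * ‖(x : H)‖) = M * ‖(x : H)‖ ^ 2 - t * ‖(x : H)‖ ^ 2 := by ring
    _ ≤ (⟪(x : H), subScalar A t x⟫_ℂ).re := by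
      rw [re_inner_subScalar]
      exact sub_le_sub_right (hM x) _
    _ ≤ ‖(x : H)‖ * ‖subScalar A t x‖ := (Complex.re_le_norm _).trans (norm_inner_le_norm _ _)

end QuadraticForm

end UnboundedOp

/-! ### Self-adjointness of the Hill operator -/

namespace RealPlace

open TemperedDistribution UnboundedOp

section BesselPotential

open Laplacian

variable {E F : Type*} [NormedAddCommGroup E] [NormedAddCommGroup F] [InnerProductSpace ℝ E]
  [NormedSpace ℂ F] [FiniteDimensional ℝ E] [MeasurableSpace E] [BorelSpace E]

theorem fourierMultiplierCLM_add {g₁ g₂ : E → ℂ} (hg₁ : g₁.HasTemperateGrowth)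
    (hg₂ : g₂.HasTemperateGrowth) :
    fourierMultiplierCLM F (g₁ + g₂) = fourierMultiplierCLM F g₁ + fourierMultiplierCLM F g₂ := by
  ext f u
  simp [SchwartzMap.smulLeftCLM_add hg₁ hg₂]

theorem besselPotential_two_apply (f : 𝓢'(E, F)) :
    besselPotential E F 2 f = f - ((2 * Real.pi) ^ 2)⁻¹ • Δ f := by
  have hsymbol : (fun x : E => (((1 + ‖x‖ ^ 2) ^ ((2 : ℝ) / 2) : ℝ) : ℂ)) =
      (fun _ => 1) + fun x => Complex.ofReal (‖x‖ ^ 2) := by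
    ext x
    simp
  have hconst : ((2 * Real.pi) ^ 2)⁻¹ * -(2 * Real.pi) ^ 2 = -1 := by
    rw [mul_neg, inv_mul_cancel₀ (by positivity)]
  rw [laplacian_eq_fourierMultiplierCLM, smul_smul, hconst, besselPotential, hsymbol,
    fourierMultiplierCLM_add (.const 1) (by fun_prop), fourierMultiplierCLM_const]
  simp

end BesselPotential

theorem derivCLM_derivCLM_eq_laplacian (f : 𝓢'(ℝ, ℂ)) :
    TemperedDistribution.derivCLM ℂ (TemperedDistribution.derivCLM ℂ f) =
      Laplacian.laplacian f := by
  rw [derivCLM_eq_lineDerivOp, derivCLM_eq_lineDerivOp,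
    TemperedDistribution.laplacian_eq_sum (OrthonormalBasis.singleton (Fin 1) ℝ)]
  simp

/-- The constant `(2π)⁻²`, for which `1 - (2π)⁻² d²/dx²` has the Fourier multiplier `1 + |ξ|²`. -/
noncomputable def besselConst : ℝ := ((2 * Real.pi) ^ 2)⁻¹

theorem besselConst_pos : 0 < besselConst := by
  unfold besselConst
  positivity

theorem IsSecondDeriv.besselPotential_eq {f g : L2R} (h : IsSecondDeriv f g) :
    besselPotential ℝ ℂ 2 (f : 𝓢'(ℝ, ℂ)) = ((f - (besselConst : ℂ) • g : L2R) : 𝓢'(ℝ, ℂ)) := by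
  rw [besselPotential_two_apply, ← derivCLM_derivCLM_eq_laplacian, h, ← Complex.coe_smul]
  simp only [← Lp.toTemperedDistributionCLM_apply, map_sub, map_smul]
  rfl

theorem IsSecondDeriv.eq_of_sub_smul_eq {f g f' g' : L2R} (h : IsSecondDeriv f g)
    (h' : IsSecondDeriv f' g')
    (heq : f - (besselConst : ℂ) • g = f' - (besselConst : ℂ) • g') : f = f' := by
  have hbessel : besselPotential ℝ ℂ 2 (f : 𝓢'(ℝ, ℂ)) = besselPotential ℝ ℂ 2 (f' : 𝓢'(ℝ, ℂ)) := by
    rw [h.besselPotential_eq, h'.besselPotential_eq, heq]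
  exact toTemperedDistribution_injective <| by
    simpa using congrArg (besselPotential ℝ ℂ (-2)) hbessel

theorem isSecondDeriv_secondDeriv (u : sobolevH2) : IsSecondDeriv u (secondDeriv u) :=
  (exists_isSecondDeriv u).choose_spec

theorem isClosed_setOf_isSecondDeriv : IsClosed {p : L2R × L2R | IsSecondDeriv p.1 p.2} := by
  have hcoe : Continuous fun f : L2R => (f : 𝓢'(ℝ, ℂ)) :=
    (Lp.toTemperedDistributionCLM ℂ (volume : Measure ℝ) 2).continuous
  exact isClosed_eq (((TemperedDistribution.derivCLM ℂ ∘L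
    TemperedDistribution.derivCLM ℂ).continuous.comp hcoe).comp continuous_fst)
    (hcoe.comp continuous_snd)

theorem exists_sub_smul_secondDeriv_eq (g : L2R) :
    ∃ u : sobolevH2, (u : L2R) - (besselConst : ℂ) • secondDeriv u = g := by
  have hmem : MemSobolev 2 2 (besselPotential ℝ ℂ (-2) (g : 𝓢'(ℝ, ℂ))) := by
    rw [memSobolev_besselPotential_iff, neg_add_cancel, memSobolev_zero_iff]
    exact ⟨g, rfl⟩
  obtain ⟨u, hu⟩ := memSobolev_zero_iff.mp (hmem.mono (show (0 : ℝ) ≤ 2 by norm_num))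
  rw [hu] at hmem
  refine ⟨⟨u, hmem⟩, toTemperedDistribution_injective ?_⟩
  rw [← (isSecondDeriv_secondDeriv _).besselPotential_eq, ← hu]
  simp

section Schwartz

/-- The embedding of the Schwartz space into `L²(ℝ)`. -/
noncomputable def toL2 : 𝓢(ℝ, ℂ) →L[ℂ] L2R := SchwartzMap.toLpCLM ℂ ℂ 2 volume

theorem coeFn_toL2 (φ : 𝓢(ℝ, ℂ)) : toL2 φ =ᵐ[volume] φ := φ.coeFn_toLp 2

theorem toL2_injective : Function.Injective toL2 := SchwartzMap.injective_toLp 2 volume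

theorem denseRange_toL2 : DenseRange toL2 :=
  SchwartzMap.denseRange_toLpCLM (F := ℂ) (μ := (volume : Measure ℝ)) (p := 2) (by norm_num)

theorem coe_toL2 (φ : 𝓢(ℝ, ℂ)) : ((toL2 φ : L2R) : 𝓢'(ℝ, ℂ)) = (φ : 𝓢'(ℝ, ℂ)) :=
  Lp.toTemperedDistribution_toLp_eq φ

theorem toL2_mem (φ : 𝓢(ℝ, ℂ)) : toL2 φ ∈ sobolevH2 := by
  change MemSobolev 2 2 ((toL2 φ : L2R) : 𝓢'(ℝ, ℂ))
  rw [coe_toL2]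
  exact φ.memSobolev

/-- The derivative as an operator on the Schwartz space. -/
noncomputable abbrev schwartzDeriv : 𝓢(ℝ, ℂ) →L[ℂ] 𝓢(ℝ, ℂ) := SchwartzMap.derivCLM ℂ ℂ

/-- The second derivative as an operator on the Schwartz space. -/
noncomputable def schwartzDeriv2 : 𝓢(ℝ, ℂ) →L[ℂ] 𝓢(ℝ, ℂ) := schwartzDeriv ∘L schwartzDeriv

theorem schwartzDeriv2_apply (φ : 𝓢(ℝ, ℂ)) :
    schwartzDeriv2 φ = schwartzDeriv (schwartzDeriv φ) := rfl

theorem isSecondDeriv_toL2 (φ : 𝓢(ℝ, ℂ)) : IsSecondDeriv (toL2 φ) (toL2 (schwartzDeriv2 φ)) := by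
  rw [IsSecondDeriv, coe_toL2, coe_toL2, schwartzDeriv2_apply,
    derivCLM_toTemperedDistributionCLM_eq (𝕜 := ℂ), derivCLM_toTemperedDistributionCLM_eq (𝕜 := ℂ)]

theorem secondDeriv_toL2 (φ : 𝓢(ℝ, ℂ)) :
    secondDeriv ⟨toL2 φ, toL2_mem φ⟩ = toL2 (schwartzDeriv2 φ) :=
  (isSecondDeriv_secondDeriv _).unique (isSecondDeriv_toL2 φ)

theorem exists_toL2_sub_smul_eq (ψ : 𝓢(ℝ, ℂ)) :
    ∃ φ : 𝓢(ℝ, ℂ), toL2 φ - (besselConst : ℂ) • toL2 (schwartzDeriv2 φ) = toL2 ψ := by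
  let g : ℝ → ℂ := fun x => ((1 + ‖x‖ ^ 2) ^ ((-2 : ℝ) / 2) : ℝ)
  have hg : g.HasTemperateGrowth := by
    unfold g
    fun_prop
  refine ⟨SchwartzMap.fourierMultiplierCLM ℂ g ψ, toTemperedDistribution_injective ?_⟩
  rw [← (isSecondDeriv_toL2 _).besselPotential_eq, coe_toL2, coe_toL2,
    ← fourierMultiplierCLM_toTemperedDistributionCLM_eq hg]
  change besselPotential ℝ ℂ 2 (besselPotential ℝ ℂ (-2) (ψ : 𝓢'(ℝ, ℂ))) = ψ
  simp

/-- The real bilinear pairing `(a, b) ↦ conj a * b`, which turns the inner product of `L²(ℝ)` into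
the integral of a bilinear expression. -/
noncomputable def conjMul : ℂ →L[ℝ] ℂ →L[ℝ] ℂ :=
  (ContinuousLinearMap.mul ℝ ℂ) ∘L (Complex.conjCLE : ℂ →L[ℝ] ℂ)

theorem inner_toL2 (φ ψ : 𝓢(ℝ, ℂ)) : ⟪toL2 φ, toL2 ψ⟫_ℂ = ∫ x, conjMul (φ x) (ψ x) := by
  refine (SchwartzMap.inner_toL2_toL2_eq φ ψ volume).trans ?_
  refine integral_congr_ae (Eventually.of_forall fun x => ?_)
  simp [conjMul, mul_comm]

theorem inner_toL2_schwartzDeriv (φ ψ : 𝓢(ℝ, ℂ)) :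
    ⟪toL2 φ, toL2 (schwartzDeriv ψ)⟫_ℂ = -⟪toL2 (schwartzDeriv φ), toL2 ψ⟫_ℂ := by
  rw [inner_toL2, inner_toL2]
  exact SchwartzMap.integral_bilinear_deriv_right_eq_neg_left φ ψ conjMul

theorem inner_toL2_schwartzDeriv2 (φ ψ : 𝓢(ℝ, ℂ)) :
    ⟪toL2 φ, toL2 (schwartzDeriv2 ψ)⟫_ℂ = -⟪toL2 (schwartzDeriv φ), toL2 (schwartzDeriv ψ)⟫_ℂ :=
  inner_toL2_schwartzDeriv _ _

theorem re_inner_toL2_schwartzDeriv2 (φ : 𝓢(ℝ, ℂ)) :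
    (⟪toL2 φ, toL2 (schwartzDeriv2 φ)⟫_ℂ).re = -‖toL2 (schwartzDeriv φ)‖ ^ 2 := by
  rw [inner_toL2_schwartzDeriv2, Complex.neg_re, inner_self_eq_norm_sq_to_K]
  simp [← Complex.ofReal_pow]

theorem norm_le_norm_sub_smul {E : Type*} [NormedAddCommGroup E] [InnerProductSpace ℂ E] {x y : E}
    (hxy : (⟪x, y⟫_ℂ).re ≤ 0) {c : ℝ} (hc : 0 ≤ c) : ‖x‖ ≤ ‖x - (c : ℂ) • y‖ := by
  refine (sq_le_sq₀ (norm_nonneg _) (norm_nonneg _)).mp ?_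
  rw [norm_sub_sq (𝕜 := ℂ), inner_smul_right, RCLike.re_eq_complex_re, Complex.re_ofReal_mul]
  nlinarith [mul_nonneg hc (neg_nonneg.mpr hxy), sq_nonneg ‖(c : ℂ) • y‖]

/-- The closure in `L²(ℝ) × L²(ℝ)` of the graph of the second derivative on Schwartz functions. -/
noncomputable def schwartzGraph : Submodule ℂ (L2R × L2R) :=
  (LinearMap.range (toL2.prod (toL2 ∘L schwartzDeriv2)).toLinearMap).topologicalClosure

theorem schwartzGraph_induction {P : L2R → L2R → Prop}
    (hclosed : IsClosed {p : L2R × L2R | P p.1 p.2})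
    (hschwartz : ∀ φ : 𝓢(ℝ, ℂ), P (toL2 φ) (toL2 (schwartzDeriv2 φ)))
    {p : L2R × L2R} (hp : p ∈ schwartzGraph) : P p.1 p.2 :=
  closure_minimal (by rintro _ ⟨φ, rfl⟩; exact hschwartz φ) hclosed hp

theorem isClosed_setOf_re_inner_nonpos : IsClosed {p : L2R × L2R | (⟪p.1, p.2⟫_ℂ).re ≤ 0} :=
  isClosed_le (Complex.continuous_re.comp (continuous_fst.inner continuous_snd)) continuous_const

theorem re_inner_nonpos_of_mem_schwartzGraph {p : L2R × L2R} (hp : p ∈ schwartzGraph) :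
    (⟪p.1, p.2⟫_ℂ).re ≤ 0 :=
  schwartzGraph_induction (P := fun f g => (⟪f, g⟫_ℂ).re ≤ 0) isClosed_setOf_re_inner_nonpos
    (fun φ => (re_inner_toL2_schwartzDeriv2 φ).trans_le (neg_nonpos.mpr (sq_nonneg _))) hp

/-- The restriction of `(f, g) ↦ f - (2π)⁻² g` to the closed graph `schwartzGraph`, where it
represents `u ↦ u - (2π)⁻² u''`. -/
noncomputable def schwartzGraphBessel : schwartzGraph →L[ℂ] L2R :=
  (ContinuousLinearMap.fst ℂ L2R L2R - (besselConst : ℂ) • ContinuousLinearMap.snd ℂ L2R L2R) ∘L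
    schwartzGraph.subtypeL

theorem schwartzGraphBessel_apply (p : schwartzGraph) :
    schwartzGraphBessel p = p.1.1 - (besselConst : ℂ) • p.1.2 := rfl

theorem exists_antilipschitzWith_schwartzGraphBessel :
    ∃ K, AntilipschitzWith K schwartzGraphBessel := by
  refine ⟨⟨1 + 2 * besselConst⁻¹, by have := besselConst_pos; positivity⟩,
    schwartzGraphBessel.antilipschitz_of_bound fun p => ?_⟩
  have hfst : ‖p.1.1‖ ≤ ‖schwartzGraphBessel p‖ :=
    norm_le_norm_sub_smul (re_inner_nonpos_of_mem_schwartzGraph p.2) besselConst_pos.le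
  have hsnd : besselConst * ‖p.1.2‖ ≤ 2 * ‖schwartzGraphBessel p‖ :=
    calc besselConst * ‖p.1.2‖ = ‖p.1.1 - schwartzGraphBessel p‖ := by
          rw [schwartzGraphBessel_apply, sub_sub_cancel, norm_smul, Complex.norm_real,
            Real.norm_of_nonneg besselConst_pos.le]
      _ ≤ 2 * ‖schwartzGraphBessel p‖ := by
          linarith [norm_sub_le p.1.1 (schwartzGraphBessel p)]
  rw [← le_inv_mul_iff₀ besselConst_pos] at hsnd
  have hnonneg : 0 ≤ besselConst⁻¹ * ‖schwartzGraphBessel p‖ :=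
    mul_nonneg (inv_nonneg.mpr besselConst_pos.le) (norm_nonneg _)
  have hmax : max ‖p.1.1‖ ‖p.1.2‖ ≤ (1 + 2 * besselConst⁻¹) * ‖schwartzGraphBessel p‖ :=
    max_le (by linarith) (by linarith [norm_nonneg (schwartzGraphBessel p)])
  exact hmax

theorem surjective_schwartzGraphBessel : Function.Surjective schwartzGraphBessel := by
  obtain ⟨K, hK⟩ := exists_antilipschitzWith_schwartzGraphBessel
  have hcomplete : CompleteSpace schwartzGraph :=
    (Submodule.isClosed_topologicalClosure _).completeSpace_coe
  have hclosed := hK.isClosed_range schwartzGraphBessel.uniformContinuous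
  have hdense : DenseRange schwartzGraphBessel := by
    refine denseRange_toL2.mono ?_
    rintro _ ⟨ψ, rfl⟩
    obtain ⟨φ, hφ⟩ := exists_toL2_sub_smul_eq ψ
    exact ⟨⟨_, subset_closure ⟨φ, rfl⟩⟩, hφ⟩
  rw [← Set.range_eq_univ, ← hclosed.closure_eq, hdense.closure_eq]

theorem mem_schwartzGraph (u : sobolevH2) : ((u : L2R), secondDeriv u) ∈ schwartzGraph := by
  have hu := isSecondDeriv_secondDeriv u
  obtain ⟨p, hp⟩ := surjective_schwartzGraphBessel ((u : L2R) - (besselConst : ℂ) • secondDeriv u)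
  have hderiv : IsSecondDeriv p.1.1 p.1.2 :=
    schwartzGraph_induction isClosed_setOf_isSecondDeriv isSecondDeriv_toL2 p.2
  have hfst : p.1.1 = u := hderiv.eq_of_sub_smul_eq hu hp
  have hsnd : p.1.2 = secondDeriv u := (hfst ▸ hderiv).unique hu
  rw [← hfst, ← hsnd]
  exact p.2

theorem secondDeriv_induction {P : L2R → L2R → Prop}
    (hclosed : IsClosed {p : L2R × L2R | P p.1 p.2})
    (hschwartz : ∀ φ : 𝓢(ℝ, ℂ), P (toL2 φ) (toL2 (schwartzDeriv2 φ))) (u : sobolevH2) :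
    P u (secondDeriv u) :=
  schwartzGraph_induction hclosed hschwartz (mem_schwartzGraph u)

theorem re_inner_secondDeriv_nonpos (u : sobolevH2) : (⟪(u : L2R), secondDeriv u⟫_ℂ).re ≤ 0 :=
  re_inner_nonpos_of_mem_schwartzGraph (mem_schwartzGraph u)

theorem inner_secondDeriv_left (u v : sobolevH2) :
    ⟪secondDeriv u, (v : L2R)⟫_ℂ = ⟪(u : L2R), secondDeriv v⟫_ℂ := by
  refine secondDeriv_induction (P := fun f g => ⟪g, (v : L2R)⟫_ℂ = ⟪f, secondDeriv v⟫_ℂ)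
    (isClosed_eq (continuous_snd.inner continuous_const)
      (continuous_fst.inner continuous_const)) (fun φ => ?_) u
  refine secondDeriv_induction (P := fun f g => ⟪toL2 (schwartzDeriv2 φ), f⟫_ℂ = ⟪toL2 φ, g⟫_ℂ)
    (isClosed_eq (continuous_const.inner continuous_fst)
      (continuous_const.inner continuous_snd)) (fun ψ => ?_) v
  rw [← inner_conj_symm, inner_toL2_schwartzDeriv2, inner_toL2_schwartzDeriv2, map_neg,
    inner_conj_symm]

end Schwartz

section Hill

/-- The free operator `-d²/dy²` on `L²(ℝ)` with domain `H²(ℝ)`. -/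
noncomputable def freeHill : L2R →ₗ.[ℂ] L2R := ⟨sobolevH2, -secondDeriv⟩

theorem freeHill_apply (u : freeHill.domain) : freeHill u = -secondDeriv u := rfl

theorem isFormalAdjoint_freeHill : freeHill.IsFormalAdjoint freeHill := fun u v => by
  rw [freeHill_apply, freeHill_apply, inner_neg_left, inner_neg_right, neg_inj]
  exact inner_secondDeriv_left u v

theorem surjective_subScalar_freeHill :
    Function.Surjective (subScalar freeHill ((-besselConst⁻¹ : ℝ) : ℂ)) := fun g => by
  have hne : (besselConst : ℂ) ≠ 0 := Complex.ofReal_ne_zero.mpr besselConst_pos.ne'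
  obtain ⟨u, hu⟩ := exists_sub_smul_secondDeriv_eq ((besselConst : ℂ) • g)
  refine ⟨u, smul_right_injective L2R hne ?_⟩
  change (besselConst : ℂ) • (-secondDeriv u - ((-besselConst⁻¹ : ℝ) : ℂ) • (u : L2R)) =
    (besselConst : ℂ) • g
  rw [← hu, smul_sub, smul_smul]
  push_cast
  rw [mul_neg, mul_inv_cancel₀ hne]
  module

theorem isSelfAdjoint_freeHill : IsSelfAdjoint freeHill :=
  isSelfAdjoint_of_surjective isFormalAdjoint_freeHill surjective_subScalar_freeHill
    (by rw [Complex.conj_ofReal]; exact surjective_subScalar_freeHill)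

variable {L : ℝ} (U : EvenPeriodicPotential L)

theorem EvenPeriodicPotential.isSymmetric_mul : (U.mul : L2R →ₗ[ℂ] L2R).IsSymmetric := fun f g => by
  rw [L2.inner_def, L2.inner_def]
  refine integral_congr_ae ?_
  filter_upwards [U.coeFn_mul f, U.coeFn_mul g] with x hf hg
  rw [ContinuousLinearMap.coe_coe, hf, hg]
  simp only [RCLike.inner_apply, map_mul, Complex.conj_ofReal]
  ring

theorem hill_apply (u : sobolevH2) : hill U u = -secondDeriv u + U.mul u := rfl

theorem hill_toL2 (φ : 𝓢(ℝ, ℂ)) :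
    hill U ⟨toL2 φ, toL2_mem φ⟩ = -toL2 (schwartzDeriv2 φ) + U.mul (toL2 φ) :=
  (hill_apply U ⟨toL2 φ, toL2_mem φ⟩).trans (by rw [secondDeriv_toL2])

theorem hill_eq_vadd : hill U = (U.mul : L2R →ₗ[ℂ] L2R) +ᵥ freeHill :=
  LinearPMap.ext rfl fun _ _ _ => add_comm _ _

theorem isSelfAdjoint_hill : IsSelfAdjoint (hill U) := by
  rw [hill_eq_vadd]
  exact isSelfAdjoint_vadd isSelfAdjoint_freeHill U.isSymmetric_mul

theorem abs_re_inner_mul_le (f : L2R) : |(⟪f, U.mul f⟫_ℂ).re| ≤ ‖U.mul‖ * ‖f‖ ^ 2 :=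
  calc |(⟪f, U.mul f⟫_ℂ).re| ≤ ‖f‖ * ‖U.mul f‖ :=
        (Complex.abs_re_le_norm _).trans (norm_inner_le_norm _ _)
    _ ≤ ‖f‖ * (‖U.mul‖ * ‖f‖) := by gcongr; exact U.mul.le_opNorm f
    _ = ‖U.mul‖ * ‖f‖ ^ 2 := by ring

theorem neg_norm_mul_le_of_mem_spec_hill {t : ℝ} (ht : (t : ℂ) ∈ spec (hill U)) :
    -‖U.mul‖ ≤ t := by
  by_contra! hlt
  refine ht (isResolventPoint_of_form_bound (isSelfAdjoint_hill U) (fun u => ?_) hlt)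
  have hkinetic := re_inner_secondDeriv_nonpos u
  have hpotential := neg_le_of_abs_le (abs_re_inner_mul_le U (u : L2R))
  rw [hill_apply U u, inner_add_right, inner_neg_right, Complex.add_re, Complex.neg_re]
  linarith

end Hill

section HighFrequency

theorem norm_toL2_le {φ ψ : 𝓢(ℝ, ℂ)} {c : ℝ} (h : ∀ x, ‖φ x‖ ≤ c * ‖ψ x‖) :
    ‖toL2 φ‖ ≤ c * ‖toL2 ψ‖ := by
  refine Lp.norm_le_mul_norm_of_ae_le_mul ?_
  filter_upwards [coeFn_toL2 φ, coeFn_toL2 ψ] with x hφ hψ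
  rw [hφ, hψ]
  exact h x

theorem abs_mul_abs_le_norm_deriv_exp_mul {b : ℝ → ℝ} (hb : Differentiable ℝ b) (k x : ℝ) :
    |k| * |b x| ≤ ‖deriv (fun y : ℝ => Complex.exp ((k * y : ℝ) * Complex.I) * (b y : ℂ)) x‖ := by
  have hexp : HasDerivAt (fun y : ℝ => Complex.exp ((k * y : ℝ) * Complex.I))
      (Complex.exp ((k * x : ℝ) * Complex.I) * (k * Complex.I)) x := by
    simpa using (((hasDerivAt_id x).const_mul k).ofReal_comp.mul_const Complex.I).cexp
  have hreal : HasDerivAt (fun y : ℝ => (b y : ℂ)) (deriv b x : ℝ) x :=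
    (hb x).hasDerivAt.ofReal_comp
  have hderiv := (hexp.mul hreal).deriv
  have hfactor : Complex.exp ((k * x : ℝ) * Complex.I) * (k * Complex.I) * (b x : ℂ) +
      Complex.exp ((k * x : ℝ) * Complex.I) * ((deriv b x : ℝ) : ℂ) =
      Complex.exp ((k * x : ℝ) * Complex.I) * ((deriv b x : ℝ) + (k * b x : ℝ) * Complex.I) := by
    push_cast
    ring
  calc |k| * |b x| = |((deriv b x : ℝ) + (k * b x : ℝ) * Complex.I).im| := by simp [abs_mul]
    _ ≤ ‖((deriv b x : ℝ) + (k * b x : ℝ) * Complex.I)‖ := Complex.abs_im_le_norm _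
    _ = _ := by
      refine Eq.trans ?_ (congrArg norm (hderiv.trans hfactor)).symm
      rw [norm_mul, Complex.norm_exp_ofReal_mul_I, one_mul]

theorem exists_schwartz_deriv_large {k : ℝ} (hk : 0 < k) :
    ∃ φ : 𝓢(ℝ, ℂ), toL2 φ ≠ 0 ∧ k * ‖toL2 φ‖ ≤ ‖toL2 (schwartzDeriv φ)‖ := by
  let b : ContDiffBump (0 : ℝ) := ⟨1, 2, one_pos, one_lt_two⟩
  let f : ℝ → ℂ := fun x => Complex.exp ((k * x : ℝ) * Complex.I) * (b x : ℂ)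
  have hsmooth : ContDiff ℝ ∞ f := by
    have hexp : ContDiff ℝ ∞ fun x : ℝ => Complex.exp ((k * x : ℝ) * Complex.I) :=
      ((Complex.ofRealCLM.contDiff.comp (contDiff_const.mul contDiff_id)).mul contDiff_const).cexp
    exact hexp.mul (Complex.ofRealCLM.contDiff.comp b.contDiff)
  have hcompact : HasCompactSupport f :=
    (b.hasCompactSupport.comp_left (g := ((↑) : ℝ → ℂ)) Complex.ofReal_zero).mul_left
  let φ : 𝓢(ℝ, ℂ) := hcompact.toSchwartzMap hsmooth
  have hφ (x : ℝ) : ‖φ x‖ = |b x| := by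
    change ‖f x‖ = _
    rw [norm_mul, Complex.norm_exp_ofReal_mul_I, one_mul, Complex.norm_real, Real.norm_eq_abs]
  refine ⟨φ, fun hzero => ?_, ?_⟩
  · have hb : b 0 = 1 := b.one_of_mem_closedBall (by simp [b])
    have hone : ‖φ 0‖ = 1 := by rw [hφ, hb, abs_one]
    rw [toL2_injective (hzero.trans (map_zero toL2).symm)] at hone
    simp at hone
  · rw [← le_inv_mul_iff₀ hk]
    refine norm_toL2_le fun x => ?_
    rw [le_inv_mul_iff₀ hk, hφ]
    have hderiv := abs_mul_abs_le_norm_deriv_exp_mul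
      ((b.contDiff (n := 1)).differentiable one_ne_zero) k x
    rwa [abs_of_pos hk] at hderiv

theorem exists_mem_spec_hill_gt {L : ℝ} (U : EvenPeriodicPotential L) (M : ℝ) :
    ∃ t : ℝ, M < t ∧ (t : ℂ) ∈ spec (hill U) := by
  by_contra! hM
  have hspec (t : ℝ) (ht : (t : ℂ) ∈ spec (hill U)) : t ≤ |M| :=
    (not_lt.mp fun hlt => hM t hlt ht).trans (le_abs_self M)
  have hsum : 0 ≤ |M| + ‖U.mul‖ := add_nonneg (abs_nonneg M) (norm_nonneg _)
  obtain ⟨φ, hφ, hlarge⟩ := exists_schwartz_deriv_large (by linarith : 0 < |M| + ‖U.mul‖ + 1)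
  have hform : ‖toL2 (schwartzDeriv φ)‖ ^ 2 + (⟪toL2 φ, U.mul (toL2 φ)⟫_ℂ).re ≤
      |M| * ‖toL2 φ‖ ^ 2 := by
    have hle := re_inner_le_of_spec_le (isSelfAdjoint_hill U) hspec ⟨toL2 φ, toL2_mem φ⟩
    rwa [hill_toL2, inner_add_right, inner_neg_right, Complex.add_re, Complex.neg_re,
      re_inner_toL2_schwartzDeriv2, neg_neg] at hle
  have hpotential := neg_le_of_abs_le (abs_re_inner_mul_le U (toL2 φ))
  have hsq := pow_le_pow_left₀ (by positivity) hlarge 2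
  have hpos : 0 < ‖toL2 φ‖ ^ 2 := pow_pos (norm_pos_iff.mpr hφ) 2
  have hlt : (|M| + ‖U.mul‖) * ‖toL2 φ‖ ^ 2 < (|M| + ‖U.mul‖ + 1) ^ 2 * ‖toL2 φ‖ ^ 2 :=
    mul_lt_mul_of_pos_right (by nlinarith) hpos
  rw [mul_pow] at hsq
  linarith

end HighFrequency

end RealPlace

/-! ### Linear differential equations with a parameter -/

namespace LinearODE

open BoundedContinuousFunction

variable {E : Type*} [NormedAddCommGroup E] [NormedSpace ℝ E]

section Volterra

variable {κ : ℝ}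

theorem abs_integral_cosh_le (hκ : 0 < κ) (x : ℝ) :
    |∫ t in (0 : ℝ)..x, Real.cosh (κ * t)| ≤ κ⁻¹ * Real.cosh (κ * x) := by
  have hsinh : |Real.sinh (κ * x)| ≤ Real.cosh (κ * x) := by
    rw [← Real.cosh_abs, Real.abs_sinh]
    exact (Real.sinh_lt_cosh _).le
  have hintegral : ∫ t in (0 : ℝ)..x, Real.cosh (κ * t) = κ⁻¹ * Real.sinh (κ * x) := by
    rw [intervalIntegral.integral_eq_sub_of_hasDerivAt (f := fun t => κ⁻¹ * Real.sinh (κ * t))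
      (fun t _ => ?_) (Continuous.intervalIntegrable (by fun_prop) _ _), mul_zero,
      Real.sinh_zero, mul_zero, sub_zero]
    refine (((hasDerivAt_const_mul κ).sinh).const_mul κ⁻¹).congr_deriv ?_
    field_simp
  rw [hintegral, abs_mul, abs_of_pos (inv_pos.mpr hκ)]
  gcongr

theorem norm_inv_cosh_smul_integral_le (hκ : 0 < κ) (F : ℝ →ᵇ E) (x : ℝ) :
    ‖(Real.cosh (κ * x))⁻¹ • ∫ t in (0 : ℝ)..x, Real.cosh (κ * t) • F t‖ ≤ κ⁻¹ * ‖F‖ := by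
  have hbound : ‖∫ t in (0 : ℝ)..x, Real.cosh (κ * t) • F t‖ ≤
      |∫ t in (0 : ℝ)..x, Real.cosh (κ * t) * ‖F‖| := by
    refine intervalIntegral.norm_integral_le_abs_of_norm_le (Eventually.of_forall fun t => ?_)
      (Continuous.intervalIntegrable (by fun_prop) _ _)
    rw [norm_smul, Real.norm_of_nonneg (Real.cosh_pos _).le]
    exact mul_le_mul_of_nonneg_left (F.norm_coe_le_norm t) (Real.cosh_pos _).le
  rw [norm_smul, norm_inv, Real.norm_of_nonneg (Real.cosh_pos _).le,
    inv_mul_le_iff₀ (Real.cosh_pos _)]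
  calc _ ≤ |∫ t in (0 : ℝ)..x, Real.cosh (κ * t)| * ‖F‖ := by
        rwa [intervalIntegral.integral_mul_const, abs_mul, abs_norm] at hbound
    _ ≤ κ⁻¹ * Real.cosh (κ * x) * ‖F‖ := by gcongr; exact abs_integral_cosh_le hκ x
    _ = Real.cosh (κ * x) * (κ⁻¹ * ‖F‖) := by ring

theorem continuous_inv_cosh_mul (κ : ℝ) : Continuous fun x => (Real.cosh (κ * x))⁻¹ :=
  Continuous.inv₀ (by fun_prop) fun _ => (Real.cosh_pos _).ne'

/-- The primitive `F ↦ ∫₀ˣ F` conjugated by the weight `cosh (κ x)`; the weight makes it bounded on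
the bounded functions, with norm at most `κ⁻¹`. -/
noncomputable def weightedPrimitive (E : Type*) [NormedAddCommGroup E] [NormedSpace ℝ E]
    (hκ : 0 < κ) : (ℝ →ᵇ E) →L[ℝ] (ℝ →ᵇ E) :=
  LinearMap.mkContinuous
    { toFun := fun F => BoundedContinuousFunction.ofNormedAddCommGroup
        (fun x => (Real.cosh (κ * x))⁻¹ • ∫ t in (0 : ℝ)..x, Real.cosh (κ * t) • F t)
        ((continuous_inv_cosh_mul κ).smul (intervalIntegral.continuous_primitive
          (fun _ _ => Continuous.intervalIntegrable (by fun_prop) _ _) 0))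
        _ (norm_inv_cosh_smul_integral_le hκ F)
      map_add' := fun F G => by
        ext x
        simp only [BoundedContinuousFunction.coe_ofNormedAddCommGroup,
          BoundedContinuousFunction.add_apply, smul_add]
        rw [← smul_add, ← intervalIntegral.integral_add] <;>
          exact Continuous.intervalIntegrable (by fun_prop) _ _
      map_smul' := fun c F => by
        ext x
        simp only [BoundedContinuousFunction.coe_ofNormedAddCommGroup,
          BoundedContinuousFunction.coe_smul, RingHom.id_apply, smul_comm _ c,
          intervalIntegral.integral_smul] }
    κ⁻¹ fun F => BoundedContinuousFunction.norm_ofNormedAddCommGroup_le _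
      (mul_nonneg (inv_pos.mpr hκ).le (norm_nonneg F)) (norm_inv_cosh_smul_integral_le hκ F)

theorem weightedPrimitive_apply (hκ : 0 < κ) (F : ℝ →ᵇ E) (x : ℝ) : weightedPrimitive E hκ F x =
    (Real.cosh (κ * x))⁻¹ • ∫ t in (0 : ℝ)..x, Real.cosh (κ * t) • F t := rfl

theorem norm_weightedPrimitive_le (hκ : 0 < κ) : ‖weightedPrimitive E hκ‖ ≤ κ⁻¹ :=
  LinearMap.mkContinuous_norm_le _ (inv_pos.mpr hκ).le _

/-- The pointwise application `(A, F) ↦ (t ↦ A t (F t))` of bounded continuous functions. -/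
noncomputable def pointwiseApply (E : Type*) [NormedAddCommGroup E] [NormedSpace ℝ E] :
    (ℝ →ᵇ (E →L[ℝ] E)) →L[ℝ] (ℝ →ᵇ E) →L[ℝ] (ℝ →ᵇ E) :=
  LinearMap.mkContinuous₂
    (LinearMap.mk₂ ℝ
      (fun (A : ℝ →ᵇ (E →L[ℝ] E)) (F : ℝ →ᵇ E) =>
        BoundedContinuousFunction.ofNormedAddCommGroup (fun t => A t (F t))
          (A.continuous.clm_apply F.continuous) (‖A‖ * ‖F‖)
          fun t => (A t).le_of_opNorm_le_of_le (A.norm_coe_le_norm t) (F.norm_coe_le_norm t))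
      (fun _ _ _ => rfl) (fun _ _ _ => rfl)
      (fun A F G => by ext t; exact map_add (A t) (F t) (G t))
      fun c A F => by ext t; exact map_smul (A t) c (F t))
    1 fun A F => by
      rw [one_mul]
      exact BoundedContinuousFunction.norm_ofNormedAddCommGroup_le _ (by positivity) fun t =>
        (A t).le_of_opNorm_le_of_le (A.norm_coe_le_norm t) (F.norm_coe_le_norm t)

theorem pointwiseApply_apply (A : ℝ →ᵇ (E →L[ℝ] E)) (F : ℝ →ᵇ E) (t : ℝ) :
    pointwiseApply E A F t = A t (F t) := rfl

theorem norm_pointwiseApply_le (A : ℝ →ᵇ (E →L[ℝ] E)) : ‖pointwiseApply E A‖ ≤ ‖A‖ := by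
  refine ContinuousLinearMap.opNorm_le_bound _ (norm_nonneg A) fun F => ?_
  exact BoundedContinuousFunction.norm_ofNormedAddCommGroup_le _ (by positivity) fun t =>
    (A t).le_of_opNorm_le_of_le (A.norm_coe_le_norm t) (F.norm_coe_le_norm t)

/-- The Volterra operator `F ↦ ∫₀ˣ A F` conjugated by the weight `cosh (κ x)`, as a function of the
coefficient `A`. -/
noncomputable def volterra (E : Type*) [NormedAddCommGroup E] [NormedSpace ℝ E] (hκ : 0 < κ) :
    (ℝ →ᵇ (E →L[ℝ] E)) →L[ℝ] (ℝ →ᵇ E) →L[ℝ] (ℝ →ᵇ E) :=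
  ContinuousLinearMap.compL ℝ _ _ _ (weightedPrimitive E hκ) ∘L pointwiseApply E

theorem volterra_apply (hκ : 0 < κ) (A : ℝ →ᵇ (E →L[ℝ] E)) (F : ℝ →ᵇ E) :
    volterra E hκ A F = weightedPrimitive E hκ (pointwiseApply E A F) := rfl

theorem norm_volterra_lt_one (hκ : 0 < κ) {A : ℝ →ᵇ (E →L[ℝ] E)} (hA : ‖A‖ < κ) :
    ‖volterra E hκ A‖ < 1 :=
  calc ‖volterra E hκ A‖ ≤ ‖weightedPrimitive E hκ‖ * ‖pointwiseApply E A‖ :=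
        ContinuousLinearMap.opNorm_comp_le _ _
    _ ≤ κ⁻¹ * ‖A‖ := by
        gcongr
        exacts [norm_weightedPrimitive_le hκ, norm_pointwiseApply_le A]
    _ < 1 := by rwa [inv_mul_lt_one₀ hκ]

/-- The constant initial value `y₀` conjugated by the weight `cosh (κ x)`. -/
noncomputable def weightedConst (κ : ℝ) (y₀ : E) : ℝ →ᵇ E :=
  BoundedContinuousFunction.ofNormedAddCommGroup (fun x => (Real.cosh (κ * x))⁻¹ • y₀)
    ((continuous_inv_cosh_mul κ).smul continuous_const) ‖y₀‖ fun x => by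
      rw [norm_smul, norm_inv, Real.norm_eq_abs, abs_of_pos (Real.cosh_pos _)]
      exact mul_le_of_le_one_left (norm_nonneg _) (inv_le_one_of_one_le₀ (Real.one_le_cosh _))

end Volterra

theorem solution_unique (A : ℝ →ᵇ (E →L[ℝ] E)) {f g : ℝ → E}
    (hf : ∀ x, HasDerivAt f (A x (f x)) x) (hg : ∀ x, HasDerivAt g (A x (g x)) x)
    (hfg : f 0 = g 0) : f = g :=
  ODE_solution_unique_univ (v := fun t y => A t y) (s := fun _ => Set.univ) (K := ‖A‖₊)
    (fun t => ((A t).lipschitz.weaken (A.norm_coe_le_norm t)).lipschitzOnWith)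
    (fun t => ⟨hf t, trivial⟩) (fun t => ⟨hg t, trivial⟩) hfg

section Solution

variable [CompleteSpace E] {κ : ℝ} {A : ℝ →ᵇ (E →L[ℝ] E)}

/-- The solution of `Y' = A Y`, `Y 0 = y₀`, obtained by inverting `1 - T` for the weighted Volterra
operator `T` of `A`. The value is meaningful for `‖A‖ < κ` only. -/
noncomputable def neumannSolution (hκ : 0 < κ) (y₀ : E) (A : ℝ →ᵇ (E →L[ℝ] E)) (x : ℝ) : E :=
  Real.cosh (κ * x) • Ring.inverse (1 - volterra E hκ A) (weightedConst κ y₀) x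

theorem neumannSolution_eq_integral (hκ : 0 < κ) (y₀ : E) (hA : ‖A‖ < κ) (x : ℝ) :
    neumannSolution hκ y₀ A x = y₀ + ∫ t in (0 : ℝ)..x, A t (neumannSolution hκ y₀ A t) := by
  set W := Ring.inverse (1 - volterra E hκ A) (weightedConst κ y₀)
  have hfixed : W = weightedConst κ y₀ + volterra E hκ A W := by
    have hinv := Ring.mul_inverse_cancel _
      (isUnit_one_sub_of_norm_lt_one (norm_volterra_lt_one hκ hA))
    exact eq_add_of_sub_eq (DFunLike.congr_fun hinv (weightedConst κ y₀))
  have hvalue := DFunLike.congr_fun hfixed x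
  rw [BoundedContinuousFunction.add_apply, volterra_apply, weightedPrimitive_apply] at hvalue
  change Real.cosh (κ * x) • W x = y₀ + ∫ t in (0 : ℝ)..x, A t (Real.cosh (κ * t) • W t)
  rw [hvalue, smul_add, smul_inv_smul₀ (Real.cosh_pos _).ne']
  simp only [pointwiseApply_apply, map_smul]
  exact congrArg (· + _) (smul_inv_smul₀ (Real.cosh_pos _).ne' y₀)

theorem neumannSolution_zero (hκ : 0 < κ) (y₀ : E) (hA : ‖A‖ < κ) :
    neumannSolution hκ y₀ A 0 = y₀ := by
  rw [neumannSolution_eq_integral hκ y₀ hA, intervalIntegral.integral_same, add_zero]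

theorem hasDerivAt_neumannSolution (hκ : 0 < κ) (y₀ : E) (hA : ‖A‖ < κ) (x : ℝ) :
    HasDerivAt (neumannSolution hκ y₀ A) (A x (neumannSolution hκ y₀ A x)) x := by
  have hcont : Continuous fun t => A t (neumannSolution hκ y₀ A t) :=
    A.continuous.clm_apply (Continuous.smul (by fun_prop) (by fun_prop))
  refine HasDerivAt.congr_of_eventuallyEq ?_
    (Eventually.of_forall (neumannSolution_eq_integral hκ y₀ hA))
  exact (intervalIntegral.integral_hasDerivAt_right (hcont.intervalIntegrable 0 x)
    hcont.aestronglyMeasurable.stronglyMeasurableAtFilter hcont.continuousAt).const_add y₀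

theorem analyticAt_neumannSolution (hκ : 0 < κ) (y₀ : E) (hA : ‖A‖ < κ) (x : ℝ) :
    AnalyticAt ℝ (fun A => neumannSolution hκ y₀ A x) A := by
  obtain ⟨u, hu⟩ := isUnit_one_sub_of_norm_lt_one (norm_volterra_lt_one hκ hA)
  have hinverse : AnalyticAt ℝ (fun A => Ring.inverse (1 - volterra E hκ A)) A := by
    refine AnalyticAt.comp (g := Ring.inverse) ?_
      (analyticAt_const.sub (ContinuousLinearMap.analyticAt (𝕜 := ℝ) (volterra E hκ) A))
    rw [← hu]
    exact analyticAt_inverse u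
  let eval : ((ℝ →ᵇ E) →L[ℝ] (ℝ →ᵇ E)) →L[ℝ] E :=
    (BoundedContinuousFunction.evalCLM ℝ x).comp
      (ContinuousLinearMap.apply ℝ (ℝ →ᵇ E) (weightedConst κ y₀))
  have heval : AnalyticAt ℝ (fun A => eval (Ring.inverse (1 - volterra E hκ A))) A :=
    (eval.analyticAt _).comp hinverse
  exact heval.const_smul

theorem exists_analytic_solution (y₀ : E) : ∃ Y : (ℝ →ᵇ (E →L[ℝ] E)) → ℝ → E,
    (∀ A, Y A 0 = y₀ ∧ ∀ x, HasDerivAt (Y A) (A x (Y A x)) x) ∧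
      ∀ x A, AnalyticAt ℝ (fun A => Y A x) A := by
  have hpos (A : ℝ →ᵇ (E →L[ℝ] E)) : 0 < ‖A‖ + 1 := by positivity
  have hlt (A : ℝ →ᵇ (E →L[ℝ] E)) : ‖A‖ < ‖A‖ + 1 := lt_add_one _
  refine ⟨fun A => neumannSolution (hpos A) y₀ A, fun A =>
    ⟨neumannSolution_zero _ _ (hlt A), hasDerivAt_neumannSolution _ _ (hlt A)⟩, fun x A => ?_⟩
  refine (analyticAt_neumannSolution (hpos A) y₀ (hlt A) x).congr ?_
  filter_upwards [(continuous_norm.tendsto A).eventually_lt_const (hlt A)] with B hB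
  refine congrFun (solution_unique B (hasDerivAt_neumannSolution _ _ hB)
    (hasDerivAt_neumannSolution _ _ (hlt B)) ?_) x
  rw [neumannSolution_zero _ _ hB, neumannSolution_zero _ _ (hlt B)]

end Solution

/-- The coefficient of the first order system satisfied by `(y, y')` when `y'' = q y` and `y` takes
values in `F`. -/
noncomputable def companion (F : Type*) [NormedAddCommGroup F] [NormedSpace ℝ F] (q : ℝ →ᵇ ℝ) :
    ℝ →ᵇ (F × F →L[ℝ] F × F) :=
  BoundedContinuousFunction.const ℝ
      ((ContinuousLinearMap.inl ℝ F F).comp (ContinuousLinearMap.snd ℝ F F)) +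
    (ContinuousLinearMap.toSpanSingleton ℝ ((ContinuousLinearMap.inr ℝ F F).comp
      (ContinuousLinearMap.fst ℝ F F))).compLeftContinuousBounded ℝ q

theorem companion_apply {F : Type*} [NormedAddCommGroup F] [NormedSpace ℝ F] (q : ℝ →ᵇ ℝ) (x : ℝ)
    (p : F × F) : companion F q x p = (p.2, q x • p.1) := by
  ext <;> simp [companion]

theorem analyticAt_companion (F : Type*) [NormedAddCommGroup F] [NormedSpace ℝ F] (q : ℝ →ᵇ ℝ) :
    AnalyticAt ℝ (companion F) q :=
  analyticAt_const.add (ContinuousLinearMap.analyticAt _ q)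

theorem exists_hillSolution (V : ℝ →ᵇ ℝ) (y₀ v₀ : ℝ) : ∃ y v : ℝ → ℝ → ℝ,
    (∀ l, y l 0 = y₀ ∧ v l 0 = v₀ ∧
      ∀ x, HasDerivAt (y l) (v l x) x ∧ HasDerivAt (v l) ((V x - l) * y l x) x) ∧
      ∀ x l, AnalyticAt ℝ (fun l => y l x) l ∧ AnalyticAt ℝ (fun l => v l x) l := by
  obtain ⟨Y, hsol, hanalytic⟩ := exists_analytic_solution (y₀, v₀)
  let A : ℝ → ℝ →ᵇ (ℝ × ℝ →L[ℝ] ℝ × ℝ) := fun l =>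
    companion ℝ (V - l • BoundedContinuousFunction.const ℝ 1)
  have hA (l : ℝ) : AnalyticAt ℝ A l :=
    (analyticAt_companion ℝ _).comp (analyticAt_const.sub (analyticAt_id.smul analyticAt_const))
  have hderiv (l x : ℝ) :
      HasDerivAt (Y (A l)) ((Y (A l) x).2, (V x - l) * (Y (A l) x).1) x := by
    simpa [A, companion_apply] using (hsol (A l)).2 x
  have hY (x l : ℝ) : AnalyticAt ℝ (fun l => Y (A l) x) l := (hanalytic x (A l)).comp (hA l)
  refine ⟨fun l x => (Y (A l) x).1, fun l x => (Y (A l) x).2, fun l =>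
    ⟨by simp [(hsol (A l)).1], by simp [(hsol (A l)).1], fun x => ⟨?_, ?_⟩⟩, fun x l => ⟨?_, ?_⟩⟩
  · exact (ContinuousLinearMap.fst ℝ ℝ ℝ).hasFDerivAt.comp_hasDerivAt x (hderiv l x)
  · exact (ContinuousLinearMap.snd ℝ ℝ ℝ).hasFDerivAt.comp_hasDerivAt x (hderiv l x)
  · exact ((ContinuousLinearMap.fst ℝ ℝ ℝ).analyticAt _).comp (hY x l)
  · exact ((ContinuousLinearMap.snd ℝ ℝ ℝ).analyticAt _).comp (hY x l)

end LinearODE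

/-! ### Floquet solutions -/

namespace RealPlace

open UnboundedOp BoundedContinuousFunction

section Floquet

variable {L : ℝ} (U : EvenPeriodicPotential L)

/-- The potential as a bounded continuous function. -/
noncomputable def EvenPeriodicPotential.toBCF : ℝ →ᵇ ℝ :=
  BoundedContinuousFunction.mkOfBound ⟨U.toFun, U.smooth.continuous⟩
    (Metric.diam (Set.range U.toFun)) fun x y =>
      Metric.dist_le_diam_of_mem
        (U.periodic.isBounded_of_continuous U.period_pos.ne' U.smooth.continuous)
        (Set.mem_range_self x) (Set.mem_range_self y)

/-- `ψ` solves `-ψ'' + U ψ = l ψ`. The derivative `ψ'` is part of the data, so that the equation is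
a first order system for the pair `(ψ, ψ')`. -/
structure IsSolution (l : ℝ) (ψ ψ' : ℝ → ℂ) : Prop where
  hasDerivAt : ∀ x, HasDerivAt ψ (ψ' x) x
  hasDerivAt' : ∀ x, HasDerivAt ψ' (((U.toFun x - l : ℝ) : ℂ) * ψ x) x

/-- A Floquet solution with multiplier `ρ`: a nonzero solution with `ψ (x + L) = ρ ψ x`. -/
structure IsFloquet (l : ℝ) (ρ : ℂ) (ψ ψ' : ℝ → ℂ) : Prop extends IsSolution U l ψ ψ' where
  shift : ∀ x, ψ (x + L) = ρ * ψ x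
  shift' : ∀ x, ψ' (x + L) = ρ * ψ' x
  ne_zero : ψ 0 ≠ 0 ∨ ψ' 0 ≠ 0

/-- The Wronskian of two functions `f`, `g` with derivatives `f'`, `g'`. -/
def wronskian (f f' g g' : ℝ → ℂ) (x : ℝ) : ℂ := f x * g' x - f' x * g x

theorem hasDerivAt_wronskian {f f' g g' : ℝ → ℂ} {a b : ℂ} {x : ℝ} (hf : HasDerivAt f (f' x) x)
    (hf' : HasDerivAt f' a x) (hg : HasDerivAt g (g' x) x) (hg' : HasDerivAt g' b x) :
    HasDerivAt (wronskian f f' g g') (f x * b - a * g x) x :=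
  ((hf.mul hg').sub (hf'.mul hg)).congr_deriv (by ring)

variable {U} {l : ℝ} {ψ ψ' φ φ' : ℝ → ℂ}

namespace IsSolution

theorem continuous (h : IsSolution U l ψ ψ') : Continuous ψ :=
  continuous_iff_continuousAt.mpr fun x => (h.hasDerivAt x).continuousAt

theorem continuous' (h : IsSolution U l ψ ψ') : Continuous ψ' :=
  continuous_iff_continuousAt.mpr fun x => (h.hasDerivAt' x).continuousAt

theorem const_mul (h : IsSolution U l ψ ψ') (c : ℂ) :
    IsSolution U l (fun x => c * ψ x) fun x => c * ψ' x where
  hasDerivAt x := (h.hasDerivAt x).const_mul c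
  hasDerivAt' x := ((h.hasDerivAt' x).const_mul c).congr_deriv (by ring)

theorem add (h : IsSolution U l ψ ψ') (h' : IsSolution U l φ φ') :
    IsSolution U l (fun x => ψ x + φ x) fun x => ψ' x + φ' x where
  hasDerivAt x := (h.hasDerivAt x).add (h'.hasDerivAt x)
  hasDerivAt' x := ((h.hasDerivAt' x).add (h'.hasDerivAt' x)).congr_deriv (by ring)

theorem comp_add_period (h : IsSolution U l ψ ψ') :
    IsSolution U l (fun x => ψ (x + L)) fun x => ψ' (x + L) where
  hasDerivAt x := (h.hasDerivAt (x + L)).comp_add_const x L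
  hasDerivAt' x := by
    have hshift := (h.hasDerivAt' (x + L)).comp_add_const x L
    rwa [U.periodic x] at hshift

theorem ofReal {y v : ℝ → ℝ} (hy : ∀ x, HasDerivAt y (v x) x)
    (hv : ∀ x, HasDerivAt v ((U.toFun x - l) * y x) x) :
    IsSolution U l (fun x => (y x : ℂ)) fun x => (v x : ℂ) where
  hasDerivAt x := (hy x).ofReal_comp
  hasDerivAt' x := (hv x).ofReal_comp.congr_deriv (Complex.ofReal_mul _ _)

theorem hasDerivAt_prodMk (h : IsSolution U l ψ ψ') (x : ℝ) : HasDerivAt (fun x => (ψ x, ψ' x))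
    (LinearODE.companion ℂ (U.toBCF - BoundedContinuousFunction.const ℝ l) x (ψ x, ψ' x)) x := by
  rw [LinearODE.companion_apply]
  exact (h.hasDerivAt x).prodMk (h.hasDerivAt' x)

theorem unique (h : IsSolution U l ψ ψ') (h' : IsSolution U l φ φ') (hzero : ψ 0 = φ 0)
    (hzero' : ψ' 0 = φ' 0) (x : ℝ) : ψ x = φ x ∧ ψ' x = φ' x := by
  have hpair := LinearODE.solution_unique _ h.hasDerivAt_prodMk h'.hasDerivAt_prodMk
    (by rw [hzero, hzero'])
  exact Prod.ext_iff.mp (congrFun hpair x)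

theorem wronskian_const (h : IsSolution U l ψ ψ') (h' : IsSolution U l φ φ') (x : ℝ) :
    wronskian ψ ψ' φ φ' x = wronskian ψ ψ' φ φ' 0 := by
  have hderiv (x : ℝ) : HasDerivAt (wronskian ψ ψ' φ φ') 0 x :=
    (hasDerivAt_wronskian (h.hasDerivAt x) (h.hasDerivAt' x) (h'.hasDerivAt x)
      (h'.hasDerivAt' x)).congr_deriv (by ring)
  exact is_const_of_deriv_eq_zero (fun x => (hderiv x).differentiableAt)
    (fun x => (hderiv x).deriv) x 0

theorem contDiff (h : IsSolution U l ψ ψ') : ContDiff ℝ ∞ ψ := by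
  have hderiv : deriv ψ = ψ' := funext fun x => (h.hasDerivAt x).deriv
  have hderiv' : deriv ψ' = fun x => ((U.toFun x - l : ℝ) : ℂ) * ψ x :=
    funext fun x => (h.hasDerivAt' x).deriv
  have hcoeff : ContDiff ℝ ∞ fun x => ((U.toFun x - l : ℝ) : ℂ) :=
    Complex.ofRealCLM.contDiff.comp (U.smooth.sub contDiff_const)
  have hbootstrap (n : ℕ) : ContDiff ℝ n ψ ∧ ContDiff ℝ n ψ' := by
    induction n with
    | zero => exact ⟨contDiff_zero.mpr h.continuous, contDiff_zero.mpr h.continuous'⟩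
    | succ n ih =>
      push_cast
      rw [contDiff_succ_iff_deriv, contDiff_succ_iff_deriv, hderiv, hderiv']
      exact ⟨⟨fun x => (h.hasDerivAt x).differentiableAt, by simp, ih.2⟩,
        fun x => (h.hasDerivAt' x).differentiableAt, by simp,
        (hcoeff.of_le (mod_cast le_top)).mul ih.1⟩
  exact contDiff_infty.mpr fun n => (hbootstrap n).1

/-- Liouville's formula gives the monodromy matrix determinant one, so the hypothesis on `ρ` is its
characteristic equation. -/
theorem exists_isFloquet {c c' s s' : ℝ → ℂ} (hc : IsSolution U l c c') (hs : IsSolution U l s s')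
    (hc₀ : c 0 = 1) (hc₀' : c' 0 = 0) (hs₀ : s 0 = 0) (hs₀' : s' 0 = 1) {ρ : ℂ}
    (hρ : ρ ^ 2 - (c L + s' L) * ρ + 1 = 0) : ∃ ψ ψ', IsFloquet U l ρ ψ ψ' := by
  have hdet : c L * s' L - c' L * s L = 1 := by
    simpa [wronskian, hc₀, hc₀', hs₀, hs₀'] using hc.wronskian_const hs L
  obtain ⟨v, hv_ne, hv⟩ := Matrix.exists_mulVec_eq_zero_iff.mpr
    (show Matrix.det !![c L - ρ, s L; c' L, s' L - ρ] = 0 by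
      rw [Matrix.det_fin_two_of]
      linear_combination hρ + hdet)
  have hv₀ : (c L - ρ) * v 0 + s L * v 1 = 0 := by
    simpa [Matrix.mulVec, dotProduct, Fin.sum_univ_two] using congrFun hv 0
  have hv₁ : c' L * v 0 + (s' L - ρ) * v 1 = 0 := by
    simpa [Matrix.mulVec, dotProduct, Fin.sum_univ_two] using congrFun hv 1
  have hψ := (hc.const_mul (v 0)).add (hs.const_mul (v 1))
  have hshift := hψ.comp_add_period.unique (hψ.const_mul ρ)
    (by rw [zero_add, hc₀, hs₀]; linear_combination hv₀)
    (by rw [zero_add, hc₀', hs₀']; linear_combination hv₁)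
  refine ⟨_, _, hψ, fun x => (hshift x).1, fun x => (hshift x).2, ?_⟩
  simp only [hc₀, hc₀', hs₀, hs₀', mul_one, mul_zero, add_zero, zero_add]
  by_contra! hzero
  exact hv_ne (by ext i; fin_cases i <;> simp [hzero.1, hzero.2])

end IsSolution

variable (U) in
theorem exists_discriminant : ∃ Δ : ℝ → ℝ, AnalyticOnNhd ℝ Δ Set.univ ∧
    ∀ (l : ℝ) (ρ : ℂ), ρ ^ 2 - Δ l * ρ + 1 = 0 → ∃ ψ ψ', IsFloquet U l ρ ψ ψ' := by
  obtain ⟨c, c', hc, hc_analytic⟩ := LinearODE.exists_hillSolution U.toBCF 1 0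
  obtain ⟨s, s', hs, hs_analytic⟩ := LinearODE.exists_hillSolution U.toBCF 0 1
  refine ⟨fun l => c l L + s' l L, fun l _ => (hc_analytic L l).1.add (hs_analytic L l).2,
    fun l ρ hρ => ?_⟩
  obtain ⟨hc₀, hc₀', hc⟩ := hc l
  obtain ⟨hs₀, hs₀', hs⟩ := hs l
  refine IsSolution.exists_isFloquet (.ofReal (fun x => (hc x).1) fun x => (hc x).2)
    (.ofReal (fun x => (hs x).1) fun x => (hs x).2) ?_ ?_ ?_ ?_ (by exact_mod_cast hρ)
  all_goals simp only [hc₀, hc₀', hs₀, hs₀', Complex.ofReal_zero, Complex.ofReal_one]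

theorem exists_bound_exp_mul_norm {E : Type*} [SeminormedAddCommGroup E] {f : ℝ → E}
    (hf : Continuous f) (hL : L ≠ 0) {r m : ℝ} (hshift : ∀ x, ‖f (x + L)‖ = r * ‖f x‖)
    (hm : Real.exp (m * L) * r = 1) : ∃ B, ∀ x, Real.exp (m * x) * ‖f x‖ ≤ B := by
  have hperiodic : Function.Periodic (fun x => Real.exp (m * x) * ‖f x‖) L := fun x => by
    simp only [hshift, mul_add, Real.exp_add]
    linear_combination (Real.exp (m * x) * ‖f x‖) * hm
  obtain ⟨B, hB⟩ := (hperiodic.isBounded_of_continuous hL (by fun_prop)).exists_norm_le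
  exact ⟨B, fun x => (le_abs_self _).trans (hB _ ⟨x, rfl⟩)⟩

theorem IsFloquet.exists_bound {ρ : ℂ} (h : IsFloquet U l ρ ψ ψ') {m : ℝ}
    (hm : Real.exp (m * L) * ‖ρ‖ = 1) :
    ∃ B, ∀ x, Real.exp (m * x) * ‖ψ x‖ ≤ B ∧ Real.exp (m * x) * ‖ψ' x‖ ≤ B := by
  obtain ⟨B, hB⟩ := exists_bound_exp_mul_norm h.continuous U.period_pos.ne'
    (fun x => by rw [h.shift, norm_mul]) hm
  obtain ⟨B', hB'⟩ := exists_bound_exp_mul_norm h.continuous' U.period_pos.ne'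
    (fun x => by rw [h.shift', norm_mul]) hm
  exact ⟨max B B', fun x => ⟨(hB x).trans (le_max_left B B'), (hB' x).trans (le_max_right B B')⟩⟩

theorem IsFloquet.wronskian_ne_zero {ρ σ : ℂ} (h : IsFloquet U l ρ ψ ψ') (h' : IsFloquet U l σ φ φ')
    (hne : ρ ≠ σ) : wronskian ψ ψ' φ φ' 0 ≠ 0 := by
  intro hW
  rw [wronskian] at hW
  obtain ⟨c, hc, hc'⟩ : ∃ c, ψ 0 = c * φ 0 ∧ ψ' 0 = c * φ' 0 := by
    rcases h'.ne_zero with hφ | hφ'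
    · refine ⟨ψ 0 / φ 0, by field_simp, ?_⟩
      field_simp
      linear_combination -hW
    · refine ⟨ψ' 0 / φ' 0, ?_, by field_simp⟩
      field_simp
      linear_combination hW
  have hmultiple := h.toIsSolution.unique (h'.toIsSolution.const_mul c) hc hc'
  have hψ : ρ * ψ 0 = σ * ψ 0 := by
    rw [← h.shift, (hmultiple _).1, h'.shift, hc]
    ring
  have hψ' : ρ * ψ' 0 = σ * ψ' 0 := by
    rw [← h.shift', (hmultiple _).2, h'.shift', hc']
    ring
  rcases h.ne_zero with hne₀ | hne₀
  exacts [hne (mul_right_cancel₀ hne₀ hψ), hne (mul_right_cancel₀ hne₀ hψ')]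

end Floquet

/-! ### The resolvent set of the Hill operator -/

section ResolventPoint

theorem energy_estimate {F : Type*} [NormedAddCommGroup F] [InnerProductSpace ℝ F] {w h : ℝ → F}
    {m : ℝ} (hw : ∀ x, HasDerivAt w (m • w x + h x) x) (hh : Continuous h)
    (hw_int : Integrable fun x => ‖w x‖ ^ 2) (hh_int : Integrable fun x => ‖h x‖ ^ 2) :
    m ^ 2 * ∫ x, ‖w x‖ ^ 2 ≤ ∫ x, ‖h x‖ ^ 2 := by
  have hw_cont : Continuous w := continuous_iff_continuousAt.mpr fun x => (hw x).continuousAt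
  have hderiv (x : ℝ) : HasDerivAt (fun x => ‖w x‖ ^ 2) (2 * (m * ‖w x‖ ^ 2 + ⟪w x, h x⟫_ℝ)) x := by
    refine (hw x).norm_sq.congr_deriv ?_
    rw [inner_add_right, real_inner_smul_right, real_inner_self_eq_norm_sq]
  have hinner : Integrable fun x => ⟪w x, h x⟫_ℝ := by
    refine (hw_int.add hh_int).mono' (hw_cont.inner hh).aestronglyMeasurable
      (Eventually.of_forall fun x => (norm_inner_le_norm _ _).trans ?_)
    simp only [Pi.add_apply]
    nlinarith [sq_nonneg (‖w x‖ - ‖h x‖), sq_nonneg (‖w x‖ + ‖h x‖)]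
  have hderiv_int : Integrable fun x => 2 * (m * ‖w x‖ ^ 2 + ⟪w x, h x⟫_ℝ) :=
    ((hw_int.const_mul m).add hinner).const_mul 2
  -- `2 m (m |w|² + ⟨w, h⟩) = m² |w|² - |h|² + |m w + h|²`
  have hpointwise (x : ℝ) :
      m ^ 2 * ‖w x‖ ^ 2 - ‖h x‖ ^ 2 ≤ m * (2 * (m * ‖w x‖ ^ 2 + ⟪w x, h x⟫_ℝ)) := by
    have hsquare := norm_add_sq_real (m • w x) (h x)
    rw [norm_smul, mul_pow, Real.norm_eq_abs, sq_abs, real_inner_smul_left] at hsquare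
    linarith [sq_nonneg ‖m • w x + h x‖]
  have hintegral : ∫ x, (m ^ 2 * ‖w x‖ ^ 2 - ‖h x‖ ^ 2) ≤
      ∫ x, m * (2 * (m * ‖w x‖ ^ 2 + ⟪w x, h x⟫_ℝ)) :=
    integral_mono ((hw_int.const_mul _).sub hh_int) (hderiv_int.const_mul m) hpointwise
  rw [integral_const_mul m, integral_eq_zero_of_hasDerivAt_of_integrable hderiv hderiv_int hw_int,
    mul_zero, integral_sub (hw_int.const_mul _) hh_int, integral_const_mul] at hintegral
  linarith

theorem norm_sq_eq_integral {α : Type*} [MeasurableSpace α] {μ : Measure α} {u : Lp ℂ 2 μ}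
    {f : α → ℂ} (h : u =ᵐ[μ] f) : ‖u‖ ^ 2 = ∫ x, ‖f x‖ ^ 2 ∂μ := by
  have hinner : ⟪u, u⟫_ℝ = ∫ x, ⟪u x, u x⟫_ℝ ∂μ := L2.inner_def u u
  rw [← real_inner_self_eq_norm_sq, hinner]
  refine integral_congr_ae ?_
  filter_upwards [h] with x hx
  rw [hx, real_inner_self_eq_norm_sq]

theorem integrable_norm_sq (φ : 𝓢(ℝ, ℂ)) : Integrable fun x => ‖φ x‖ ^ 2 :=
  (memLp_two_iff_integrable_sq_norm φ.continuous.aestronglyMeasurable).mp (φ.memLp 2)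

theorem hasDerivAt_schwartzDeriv (φ : 𝓢(ℝ, ℂ)) (x : ℝ) : HasDerivAt φ (schwartzDeriv φ x) x := by
  rw [SchwartzMap.derivCLM_apply]
  exact φ.differentiableAt.hasDerivAt

variable {L : ℝ} {U : EvenPeriodicPotential L} {l : ℝ} {ψ ψ' φ φ' : ℝ → ℂ}

variable (U l) in
theorem subScalar_hill_toL2 (f : 𝓢(ℝ, ℂ)) :
    subScalar (hill U) l ⟨toL2 f, toL2_mem f⟩ =ᵐ[volume]
      fun x => -schwartzDeriv2 f x + ((U.toFun x - l : ℝ) : ℂ) * f x := by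
  rw [subScalar_apply, hill_toL2]
  filter_upwards [Lp.coeFn_sub (-toL2 (schwartzDeriv2 f) + U.mul (toL2 f)) ((l : ℂ) • toL2 f),
    Lp.coeFn_add (-toL2 (schwartzDeriv2 f)) (U.mul (toL2 f)),
    Lp.coeFn_neg (toL2 (schwartzDeriv2 f)), Lp.coeFn_smul (l : ℂ) (toL2 f),
    U.coeFn_mul (toL2 f), coeFn_toL2 f, coeFn_toL2 (schwartzDeriv2 f)]
    with x hsub hadd hneg hsmul hmul hf hf''
  simp only [hsub, Pi.sub_apply, hadd, Pi.add_apply, hneg, Pi.neg_apply, hsmul, Pi.smul_apply,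
    hmul, hf, hf'', smul_eq_mul]
  push_cast
  ring

/-- The Wronskian of a Schwartz function with a solution, weighted by `exp (m x)` so as to make it
square integrable when the solution grows at most like `exp (-m x)`. -/
noncomputable def weightedWronskian (m : ℝ) (f : 𝓢(ℝ, ℂ)) (ψ ψ' : ℝ → ℂ) (x : ℝ) : ℂ :=
  Real.exp (m * x) • wronskian f (schwartzDeriv f) ψ ψ' x

theorem IsSolution.hasDerivAt_weightedWronskian (h : IsSolution U l ψ ψ') (m : ℝ) (f : 𝓢(ℝ, ℂ))
    (x : ℝ) : HasDerivAt (weightedWronskian m f ψ ψ') (m • weightedWronskian m f ψ ψ' x +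
      Real.exp (m * x) • (ψ x * (-schwartzDeriv2 f x + ((U.toFun x - l : ℝ) : ℂ) * f x))) x := by
  have hexp : HasDerivAt (fun x => Real.exp (m * x)) (Real.exp (m * x) * m) x :=
    (hasDerivAt_const_mul m).exp
  refine (hexp.smul (hasDerivAt_wronskian (hasDerivAt_schwartzDeriv f x)
    (hasDerivAt_schwartzDeriv _ x) (h.hasDerivAt x) (h.hasDerivAt' x))).congr_deriv ?_
  simp only [weightedWronskian, schwartzDeriv2_apply, Complex.real_smul]
  push_cast
  ring

theorem IsSolution.integrable_norm_sq_weightedWronskian (h : IsSolution U l ψ ψ') {m B : ℝ}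
    (hB : ∀ x, Real.exp (m * x) * ‖ψ x‖ ≤ B ∧ Real.exp (m * x) * ‖ψ' x‖ ≤ B) (f : 𝓢(ℝ, ℂ)) :
    Integrable fun x => ‖weightedWronskian m f ψ ψ' x‖ ^ 2 := by
  have hcont : Continuous (weightedWronskian m f ψ ψ') := continuous_iff_continuousAt.mpr fun x =>
    (h.hasDerivAt_weightedWronskian m f x).continuousAt
  refine (((integrable_norm_sq f).add (integrable_norm_sq (schwartzDeriv f))).const_mul
    (2 * B ^ 2)).mono' (hcont.norm.pow 2).aestronglyMeasurable (Eventually.of_forall fun x => ?_)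
  have hnorm : ‖weightedWronskian m f ψ ψ' x‖ ≤ B * (‖f x‖ + ‖schwartzDeriv f x‖) := by
    rw [weightedWronskian, norm_smul, Real.norm_of_nonneg (Real.exp_pos _).le]
    calc _ ≤ Real.exp (m * x) * (‖f x‖ * ‖ψ' x‖ + ‖schwartzDeriv f x‖ * ‖ψ x‖) := by
          gcongr
          exact (norm_sub_le _ _).trans (by rw [norm_mul, norm_mul])
      _ = (Real.exp (m * x) * ‖ψ' x‖) * ‖f x‖ +
          (Real.exp (m * x) * ‖ψ x‖) * ‖schwartzDeriv f x‖ := by ring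
      _ ≤ B * ‖f x‖ + B * ‖schwartzDeriv f x‖ := by
          gcongr
          exacts [(hB x).2, (hB x).1]
      _ = _ := by ring
  rw [Real.norm_of_nonneg (by positivity)]
  calc _ ≤ (B * (‖f x‖ + ‖schwartzDeriv f x‖)) ^ 2 := by gcongr
    _ = B ^ 2 * (‖f x‖ + ‖schwartzDeriv f x‖) ^ 2 := mul_pow _ _ _
    _ ≤ B ^ 2 * (2 * (‖f x‖ ^ 2 + ‖schwartzDeriv f x‖ ^ 2)) := by gcongr; exact add_sq_le
    _ = _ := by simp only [Pi.add_apply]; ring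

theorem IsSolution.integral_weightedWronskian_le (h : IsSolution U l ψ ψ') {m B : ℝ}
    (hB : ∀ x, Real.exp (m * x) * ‖ψ x‖ ≤ B ∧ Real.exp (m * x) * ‖ψ' x‖ ≤ B) (f : 𝓢(ℝ, ℂ)) :
    m ^ 2 * ∫ x, ‖weightedWronskian m f ψ ψ' x‖ ^ 2 ≤
      B ^ 2 * ‖subScalar (hill U) l ⟨toL2 f, toL2_mem f⟩‖ ^ 2 := by
  have hae := subScalar_hill_toL2 U l f
  set g : ℝ → ℂ := fun x => -schwartzDeriv2 f x + ((U.toFun x - l : ℝ) : ℂ) * f x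
  have hg_cont : Continuous g := by
    have := U.smooth.continuous
    fun_prop
  have hg_int : Integrable fun x => ‖g x‖ ^ 2 :=
    (memLp_two_iff_integrable_sq_norm hg_cont.aestronglyMeasurable).mp
      ((memLp_congr_ae hae).mp (Lp.memLp _))
  have hforcing_cont : Continuous fun x => Real.exp (m * x) • (ψ x * g x) := by
    have := h.continuous
    fun_prop
  have hforcing (x : ℝ) : ‖Real.exp (m * x) • (ψ x * g x)‖ ^ 2 ≤ B ^ 2 * ‖g x‖ ^ 2 := by
    rw [norm_smul, Real.norm_of_nonneg (Real.exp_pos _).le, norm_mul, ← mul_assoc, mul_pow]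
    gcongr
    exact (hB x).1
  have hforcing_int : Integrable fun x => ‖Real.exp (m * x) • (ψ x * g x)‖ ^ 2 := by
    refine (hg_int.const_mul (B ^ 2)).mono' (hforcing_cont.norm.pow 2).aestronglyMeasurable
      (Eventually.of_forall fun x => ?_)
    rw [Real.norm_of_nonneg (by positivity)]
    exact hforcing x
  refine (energy_estimate (h.hasDerivAt_weightedWronskian m f) hforcing_cont
    (h.integrable_norm_sq_weightedWronskian hB f) hforcing_int).trans ?_
  rw [norm_sq_eq_integral hae, ← integral_const_mul]
  exact integral_mono hforcing_int (hg_int.const_mul _) hforcing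

theorem norm_wronskian_mul_norm_le {m B : ℝ} (hψ : ∀ x, Real.exp (m * x) * ‖ψ x‖ ≤ B)
    (hφ : ∀ x, Real.exp (-m * x) * ‖φ x‖ ≤ B) (f : 𝓢(ℝ, ℂ)) (x : ℝ) :
    ‖wronskian ψ ψ' φ φ' x‖ * ‖f x‖ ≤
      B * (‖weightedWronskian m f ψ ψ' x‖ + ‖weightedWronskian (-m) f φ φ' x‖) := by
  have hexp : Real.exp (m * x) * Real.exp (-m * x) = 1 := by
    rw [← Real.exp_add, neg_mul, add_neg_cancel, Real.exp_zero]
  have hcombination : wronskian ψ ψ' φ φ' x * f x =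
      (Real.exp (m * x) • ψ x) * weightedWronskian (-m) f φ φ' x -
        (Real.exp (-m * x) • φ x) * weightedWronskian m f ψ ψ' x := by
    simp only [weightedWronskian, wronskian, Complex.real_smul]
    have hexp' := congrArg Complex.ofReal hexp
    rw [Complex.ofReal_mul, Complex.ofReal_one] at hexp'
    linear_combination -(f x * (ψ x * φ' x - ψ' x * φ x)) * hexp'
  have hnorm (t : ℝ) (z : ℂ) : ‖Real.exp t • z‖ = Real.exp t * ‖z‖ := by
    rw [norm_smul, Real.norm_of_nonneg (Real.exp_pos t).le]
  rw [← norm_mul, hcombination]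
  calc _ ≤ (Real.exp (m * x) * ‖ψ x‖) * ‖weightedWronskian (-m) f φ φ' x‖ +
        (Real.exp (-m * x) * ‖φ x‖) * ‖weightedWronskian m f ψ ψ' x‖ := by
        refine (norm_sub_le _ _).trans_eq ?_
        rw [norm_mul, norm_mul, hnorm, hnorm]
    _ ≤ B * ‖weightedWronskian (-m) f φ φ' x‖ + B * ‖weightedWronskian m f ψ ψ' x‖ := by
        gcongr
        exacts [hψ x, hφ x]
    _ = _ := by ring

theorem IsSolution.norm_wronskian_mul_norm_toL2_sq_le (h : IsSolution U l ψ ψ')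
    (h' : IsSolution U l φ φ') {m B : ℝ}
    (hψ : ∀ x, Real.exp (m * x) * ‖ψ x‖ ≤ B ∧ Real.exp (m * x) * ‖ψ' x‖ ≤ B)
    (hφ : ∀ x, Real.exp (-m * x) * ‖φ x‖ ≤ B ∧ Real.exp (-m * x) * ‖φ' x‖ ≤ B) (f : 𝓢(ℝ, ℂ)) :
    (‖wronskian ψ ψ' φ φ' 0‖ * ‖toL2 f‖) ^ 2 ≤ 2 * B ^ 2 *
      ((∫ x, ‖weightedWronskian m f ψ ψ' x‖ ^ 2) +
        ∫ x, ‖weightedWronskian (-m) f φ φ' x‖ ^ 2) := by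
  have hψ_int := h.integrable_norm_sq_weightedWronskian hψ f
  have hφ_int := h'.integrable_norm_sq_weightedWronskian hφ f
  have hpointwise (x : ℝ) : ‖wronskian ψ ψ' φ φ' 0‖ ^ 2 * ‖f x‖ ^ 2 ≤ 2 * B ^ 2 *
      (‖weightedWronskian m f ψ ψ' x‖ ^ 2 + ‖weightedWronskian (-m) f φ φ' x‖ ^ 2) := by
    rw [← h.wronskian_const h' x, ← mul_pow]
    calc _ ≤ (B * (‖weightedWronskian m f ψ ψ' x‖ + ‖weightedWronskian (-m) f φ φ' x‖)) ^ 2 :=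
          pow_le_pow_left₀ (by positivity)
            (norm_wronskian_mul_norm_le (fun x => (hψ x).1) (fun x => (hφ x).1) f x) 2
      _ ≤ B ^ 2 * (2 * (‖weightedWronskian m f ψ ψ' x‖ ^ 2 +
          ‖weightedWronskian (-m) f φ φ' x‖ ^ 2)) := by
          rw [mul_pow]
          gcongr
          exact add_sq_le
      _ = _ := by ring
  rw [mul_pow, norm_sq_eq_integral (coeFn_toL2 f), ← integral_add hψ_int hφ_int,
    ← integral_const_mul, ← integral_const_mul]
  exact integral_mono ((integrable_norm_sq f).const_mul _)
    ((hψ_int.add hφ_int).const_mul (2 * B ^ 2)) hpointwise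

theorem IsSolution.norm_wronskian_mul_norm_toL2_le (h : IsSolution U l ψ ψ')
    (h' : IsSolution U l φ φ') {m B : ℝ}
    (hψ : ∀ x, Real.exp (m * x) * ‖ψ x‖ ≤ B ∧ Real.exp (m * x) * ‖ψ' x‖ ≤ B)
    (hφ : ∀ x, Real.exp (-m * x) * ‖φ x‖ ≤ B ∧ Real.exp (-m * x) * ‖φ' x‖ ≤ B) (f : 𝓢(ℝ, ℂ)) :
    |m| * ‖wronskian ψ ψ' φ φ' 0‖ * ‖toL2 f‖ ≤
      2 * B ^ 2 * ‖subScalar (hill U) l ⟨toL2 f, toL2_mem f⟩‖ := by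
  have hwronskian := mul_le_mul_of_nonneg_left (h.norm_wronskian_mul_norm_toL2_sq_le h' hψ hφ f)
    (sq_nonneg m)
  have hψ_energy := h.integral_weightedWronskian_le hψ f
  have hφ_energy := h'.integral_weightedWronskian_le hφ f
  rw [neg_sq] at hφ_energy
  have henergy := mul_le_mul_of_nonneg_left (add_le_add hψ_energy hφ_energy)
    (by positivity : 0 ≤ 2 * B ^ 2)
  refine (sq_le_sq₀ (by positivity) (by positivity)).mp ?_
  rw [mul_assoc, mul_pow, sq_abs, mul_pow _ ‖subScalar _ _ _‖]
  linarith

theorem exists_exp_mul_abs_eq_one {r s : ℝ} (hL : L ≠ 0) (hrs : r * s = 1) (hne : r ≠ s) :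
    ∃ m ≠ 0, Real.exp (m * L) * |r| = 1 ∧ Real.exp (-m * L) * |s| = 1 := by
  have hr : 0 < |r| := abs_pos.mpr (left_ne_zero_of_mul_eq_one hrs)
  have hr_one : |r| ≠ 1 := fun habs => by
    have hs : |s| = 1 := by simpa [abs_mul, habs] using congrArg abs hrs
    rcases eq_or_eq_neg_of_abs_eq habs with rfl | rfl <;>
      rcases eq_or_eq_neg_of_abs_eq hs with rfl | rfl <;> simp_all
  have hmL : -Real.log |r| / L * L = -Real.log |r| := div_mul_cancel₀ _ hL
  refine ⟨-Real.log |r| / L, div_ne_zero (neg_ne_zero.mpr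
    (Real.log_ne_zero_of_pos_of_ne_one hr hr_one)) hL, ?_, ?_⟩
  · rw [hmL, Real.exp_neg, Real.exp_log hr, inv_mul_cancel₀ hr.ne']
  · rw [neg_mul, hmL, neg_neg, Real.exp_log hr, ← abs_mul, hrs, abs_one]

theorem isResolventPoint_hill_of_isFloquet {r s : ℝ} (hrs : r * s = 1) (hne : r ≠ s)
    (h : IsFloquet U l r ψ ψ') (h' : IsFloquet U l s φ φ') : IsResolventPoint (hill U) l := by
  obtain ⟨m, hm, hr, hs⟩ := exists_exp_mul_abs_eq_one U.period_pos.ne' hrs hne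
  rw [← Real.norm_eq_abs, ← Complex.norm_real] at hr hs
  obtain ⟨B₁, hB₁⟩ := h.exists_bound hr
  obtain ⟨B₂, hB₂⟩ := h'.exists_bound hs
  set B := max (max B₁ B₂) 1
  have : 0 < B := lt_max_of_lt_right one_pos
  have hB₁B : B₁ ≤ B := (le_max_left _ _).trans (le_max_left _ _)
  have hB₂B : B₂ ≤ B := (le_max_right _ _).trans (le_max_left _ _)
  have hW := norm_pos_iff.mpr (h.wronskian_ne_zero h' (mod_cast hne))
  have hc : 0 < |m| * ‖wronskian ψ ψ' φ φ' 0‖ / (2 * B ^ 2) := by positivity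
  refine isResolventPoint_of_bound (isSelfAdjoint_hill U) hc fun u => ?_
  refine secondDeriv_induction (P := fun f g => |m| * ‖wronskian ψ ψ' φ φ' 0‖ / (2 * B ^ 2) * ‖f‖ ≤
    ‖-g + U.mul f - (l : ℂ) • f‖) (isClosed_le (by fun_prop) (by fun_prop)) (fun f => ?_) u
  rw [← hill_toL2 U f, div_mul_eq_mul_div, div_le_iff₀' (by positivity)]
  exact h.norm_wronskian_mul_norm_toL2_le h'.toIsSolution
    (fun x => ⟨(hB₁ x).1.trans hB₁B, (hB₁ x).2.trans hB₁B⟩)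
    (fun x => ⟨(hB₂ x).1.trans hB₂B, (hB₂ x).2.trans hB₂B⟩) f

end ResolventPoint

/-! ### Approximate eigenvectors -/

section WeylSequence

theorem exists_cutoff : ∃ K, ∀ N : ℝ, 1 ≤ N → ∃ b : ℝ → ℝ, ContDiff ℝ ∞ b ∧
    (∀ x, |x| ≤ N → b x = 1) ∧ tsupport b ⊆ Set.Icc (-(2 * N)) (2 * N) ∧
    ∀ x, |deriv b x| ≤ K / N ∧ |deriv (deriv b) x| ≤ K / N := by
  let bump : ContDiffBump (0 : ℝ) := ⟨1, 2, one_pos, one_lt_two⟩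
  have hbump' : ContDiff ℝ 1 (deriv bump) :=
    (contDiff_succ_iff_deriv.mp (bump.contDiff : ContDiff ℝ (1 + 1) bump)).2.2
  have hcompact : HasCompactSupport (deriv bump) := bump.hasCompactSupport.deriv
  obtain ⟨K₁, hK₁⟩ := hbump'.continuous.bounded_above_of_compact_support hcompact
  obtain ⟨K₂, hK₂⟩ :=
    (hbump'.continuous_deriv le_rfl).bounded_above_of_compact_support hcompact.deriv
  refine ⟨max K₁ K₂, fun N hN => ?_⟩
  have hN₀ : 0 < N := one_pos.trans_le hN
  have hderiv : deriv (fun x => bump (N⁻¹ * x)) = fun x => N⁻¹ * deriv bump (N⁻¹ * x) :=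
    funext fun x => deriv_comp_mul_left N⁻¹ bump x
  refine ⟨fun x => bump (N⁻¹ * x), bump.contDiff.comp (contDiff_const.mul contDiff_id),
    fun x hx => bump.one_of_mem_closedBall ?_, closure_minimal (fun x hx => ?_) isClosed_Icc,
    fun x => ?_⟩
  · rw [mem_closedBall_zero_iff, Real.norm_eq_abs, abs_mul, abs_inv, abs_of_pos hN₀]
    exact (inv_mul_le_one₀ hN₀).mpr hx
  · have hball : N⁻¹ * x ∈ Function.support bump := hx
    rw [bump.support_eq, mem_ball_zero_iff, Real.norm_eq_abs, abs_mul, abs_inv, abs_of_pos hN₀,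
      inv_mul_lt_iff₀ hN₀, mul_comm] at hball
    exact abs_le.mp hball.le
  · have hderiv₂ : deriv (fun x => N⁻¹ * deriv bump (N⁻¹ * x)) x =
        N⁻¹ * (N⁻¹ * deriv (deriv bump) (N⁻¹ * x)) := by
      rw [deriv_const_mul_field, deriv_comp_mul_left, smul_eq_mul]
    rw [hderiv, hderiv₂, abs_mul, abs_mul, abs_mul, abs_inv, abs_of_pos hN₀, div_eq_inv_mul]
    refine ⟨by gcongr; exact (hK₁ _).trans (le_max_left _ _), ?_⟩
    gcongr
    exact (mul_le_of_le_one_left (abs_nonneg _) (inv_le_one_of_one_le₀ hN)).trans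
      ((hK₂ _).trans (le_max_right _ _))

theorem integral_norm_sq_le_of_norm_le {E : Type*} [SeminormedAddCommGroup E] {g : ℝ → E}
    {a C : ℝ} (ha : 0 ≤ a) (hsupport : ∀ x ∉ Set.Icc (-a) a, g x = 0) (hg : ∀ x, ‖g x‖ ≤ C) :
    ∫ x, ‖g x‖ ^ 2 ≤ C ^ 2 * (2 * a) := by
  rw [← setIntegral_eq_integral_of_forall_compl_eq_zero (s := Set.Icc (-a) a)
    fun x hx => by rw [hsupport x hx, norm_zero, zero_pow two_ne_zero]]
  have hbound := norm_setIntegral_le_of_norm_le_const (μ := volume) (f := fun x => ‖g x‖ ^ 2)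
    (s := Set.Icc (-a) a) (C := C ^ 2) measure_Icc_lt_top fun x _ => by
      rw [norm_pow, norm_norm]
      gcongr
      exact hg x
  rw [Real.volume_real_Icc_of_le (by linarith), sub_neg_eq_add, ← two_mul] at hbound
  exact (Real.le_norm_self _).trans hbound

theorem natCast_mul_integral_le_norm_toL2_sq {u : ℝ → ℂ} {T : ℝ} {n : ℕ} (hu : Continuous u)
    (hT : 0 ≤ T) (hperiodic : Function.Periodic (fun x => ‖u x‖ ^ 2) T) {f : 𝓢(ℝ, ℂ)}
    (hf : ∀ x ∈ Set.Ioc 0 (n * T), f x = u x) :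
    n * (∫ x in (0 : ℝ)..T, ‖u x‖ ^ 2) ≤ ‖toL2 f‖ ^ 2 := by
  have hperiods := hperiodic.intervalIntegral_add_zsmul_eq n 0 fun _ _ =>
    (hu.norm.pow 2).intervalIntegrable _ _
  simp only [natCast_zsmul, nsmul_eq_mul, zero_add] at hperiods
  rw [← hperiods, norm_sq_eq_integral (coeFn_toL2 f),
    intervalIntegral.integral_of_le (by positivity),
    setIntegral_congr_fun measurableSet_Ioc fun x hx => by rw [← hf x hx]]
  exact setIntegral_le_integral (integrable_norm_sq f) (Eventually.of_forall fun x => sq_nonneg _)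

variable {L : ℝ} {U : EvenPeriodicPotential L} {l : ℝ} {ψ ψ' : ℝ → ℂ}

theorem IsSolution.exists_schwartz_eq_mul (h : IsSolution U l ψ ψ') {b : ℝ → ℝ}
    (hb : ContDiff ℝ ∞ b) (hcompact : HasCompactSupport b) :
    ∃ f : 𝓢(ℝ, ℂ), (∀ x, f x = b x * ψ x) ∧
      ∀ x, -schwartzDeriv2 f x + ((U.toFun x - l : ℝ) : ℂ) * f x =
        -((deriv (deriv b) x : ℝ) * ψ x + 2 * (deriv b x : ℝ) * ψ' x) := by
  have hsmooth : ContDiff ℝ ∞ fun x => (b x : ℂ) * ψ x :=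
    (Complex.ofRealCLM.contDiff.comp hb).mul h.contDiff
  have hcompact' : HasCompactSupport fun x => (b x : ℂ) * ψ x :=
    (hcompact.comp_left (g := ((↑) : ℝ → ℂ)) Complex.ofReal_zero).mul_right
  have hderiv (x : ℝ) : HasDerivAt (fun x => (b x : ℂ)) (deriv b x : ℝ) x :=
    (hb.differentiable (by simp) x).hasDerivAt.ofReal_comp
  have hderiv₂ (x : ℝ) : HasDerivAt (fun x => ((deriv b x : ℝ) : ℂ)) (deriv (deriv b) x : ℝ) x :=
    (((contDiff_infty_iff_deriv.mp hb).2.differentiable (by simp)) x).hasDerivAt.ofReal_comp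
  let f : 𝓢(ℝ, ℂ) := hcompact'.toSchwartzMap hsmooth
  have hf' : ⇑(schwartzDeriv f) = fun x => (deriv b x : ℝ) * ψ x + b x * ψ' x :=
    funext fun x => (hasDerivAt_schwartzDeriv f x).unique ((hderiv x).mul (h.hasDerivAt x))
  refine ⟨f, fun x => rfl, fun x => ?_⟩
  have hf'' := hasDerivAt_schwartzDeriv (schwartzDeriv f) x
  rw [hf'] at hf''
  rw [schwartzDeriv2_apply, hf''.unique (((hderiv₂ x).mul (h.hasDerivAt x)).add
    ((hderiv x).mul (h.hasDerivAt' x))), show f x = b x * ψ x from rfl]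
  ring

namespace IsFloquet

variable {ρ : ℂ}

theorem integral_norm_sq_pos (h : IsFloquet U l ρ ψ ψ') :
    0 < ∫ x in (0 : ℝ)..L, ‖ψ x‖ ^ 2 := by
  have hL := U.period_pos
  refine intervalIntegral.integral_pos hL (h.continuous.norm.pow 2).continuousOn
    (fun x _ => sq_nonneg _) ?_
  by_contra! hnonpos
  have hzero (x : ℝ) (hx : x ∈ Set.Icc 0 L) : ψ x = 0 := by
    simpa using (hnonpos x hx).antisymm (sq_nonneg _)
  have hmem : (0 : ℝ) ∈ Set.Icc 0 L := Set.left_mem_Icc.mpr hL.le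
  have hzero' : ψ' 0 = 0 := (uniqueDiffOn_Icc hL 0 hmem).eq_deriv _
    (h.hasDerivAt 0).hasDerivWithinAt
    ((hasDerivWithinAt_const 0 (Set.Icc 0 L) 0).congr hzero (hzero 0 hmem))
  exact h.ne_zero.elim (· (hzero 0 hmem)) (· hzero')

theorem exists_weyl_sequence (h : IsFloquet U l ρ ψ ψ') (hρ : ‖ρ‖ = 1) :
    ∃ C, ∀ n : ℕ, 1 ≤ n * L → ∃ f : 𝓢(ℝ, ℂ),
      n * (∫ x in (0 : ℝ)..L, ‖ψ x‖ ^ 2) ≤ ‖toL2 f‖ ^ 2 ∧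
      ‖subScalar (hill U) l ⟨toL2 f, toL2_mem f⟩‖ ^ 2 ≤ C := by
  obtain ⟨B, hB⟩ := h.exists_bound (m := 0) (by simp [hρ])
  simp only [zero_mul, Real.exp_zero, one_mul] at hB
  obtain ⟨K, hcutoff⟩ := exists_cutoff
  refine ⟨4 * (3 * K * B) ^ 2, fun n hn => ?_⟩
  set N : ℝ := n * L
  have : 0 < N := one_pos.trans_le hn
  obtain ⟨b, hb, hone, hsupport, hbound⟩ := hcutoff N hn
  obtain ⟨f, hf, heq⟩ := h.exists_schwartz_eq_mul hb (isCompact_Icc.of_isClosed_subset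
    (isClosed_tsupport b) hsupport)
  have hsupport' : tsupport (deriv b) ⊆ Set.Icc (-(2 * N)) (2 * N) :=
    tsupport_deriv_subset.trans hsupport
  have hnorm (x : ℝ) : ‖(deriv (deriv b) x : ℝ) * ψ x + 2 * (deriv b x : ℝ) * ψ' x‖ ≤
      3 * K * B / N := by
    obtain ⟨hb', hb''⟩ := hbound x
    have hKN : 0 ≤ K / N := (abs_nonneg _).trans hb'
    calc _ ≤ |deriv (deriv b) x| * ‖ψ x‖ + 2 * |deriv b x| * ‖ψ' x‖ := by
          refine (norm_add_le _ _).trans_eq ?_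
          simp only [norm_mul, Complex.norm_real, Real.norm_eq_abs, Complex.norm_ofNat]
      _ ≤ K / N * B + 2 * (K / N) * B := by
          gcongr
          exacts [(hB x).1, (hB x).2]
      _ = _ := by ring
  refine ⟨f, natCast_mul_integral_le_norm_toL2_sq h.continuous U.period_pos.le
    (fun x => by simp only [h.shift, norm_mul, hρ, one_mul]) fun x hx => ?_, ?_⟩
  · rw [hf, hone x (by rw [abs_of_pos hx.1]; exact hx.2), Complex.ofReal_one, one_mul]
  · rw [norm_sq_eq_integral (subScalar_hill_toL2 U l f)]
    simp only [heq, norm_neg]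
    refine (integral_norm_sq_le_of_norm_le (a := 2 * N) (by positivity) (fun x hx => ?_)
      hnorm).trans ?_
    · rw [image_eq_zero_of_notMem_tsupport fun hmem => hx (hsupport' hmem),
        image_eq_zero_of_notMem_tsupport fun hmem => hx (hsupport' (tsupport_deriv_subset hmem))]
      simp
    · calc (3 * K * B / N) ^ 2 * (2 * (2 * N)) = 4 * (3 * K * B) ^ 2 / N := by field_simp; ring
        _ ≤ _ := div_le_self (by positivity) hn

theorem mem_spec_hill (h : IsFloquet U l ρ ψ ψ') (hρ : ‖ρ‖ = 1) : (l : ℂ) ∈ spec (hill U) := by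
  intro hresolvent
  obtain ⟨c, hc, hbound⟩ := hresolvent.exists_bound
  obtain ⟨C, hweyl⟩ := h.exists_weyl_sequence hρ
  have hI := h.integral_norm_sq_pos
  set I := ∫ x in (0 : ℝ)..L, ‖ψ x‖ ^ 2
  obtain ⟨n, hn⟩ := exists_nat_gt (max (1 / L) (C / (c ^ 2 * I)))
  obtain ⟨f, hlarge, hsmall⟩ :=
    hweyl n ((div_le_iff₀ U.period_pos).mp ((le_max_left _ _).trans hn.le))
  have hn' : C < n * (c ^ 2 * I) :=
    (div_lt_iff₀ (by positivity)).mp ((le_max_right _ _).trans_lt hn)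
  refine hn'.not_ge ?_
  calc n * (c ^ 2 * I) = c ^ 2 * (n * I) := by ring
    _ ≤ c ^ 2 * ‖toL2 f‖ ^ 2 := by gcongr
    _ = (c * ‖toL2 f‖) ^ 2 := (mul_pow _ _ _).symm
    _ ≤ ‖subScalar (hill U) l ⟨toL2 f, toL2_mem f⟩‖ ^ 2 :=
        pow_le_pow_left₀ (by positivity) (hbound ⟨toL2 f, toL2_mem f⟩) 2
    _ ≤ C := hsmall

end IsFloquet

theorem exists_real_roots_of_four_lt_sq {d : ℝ} (hd : 4 < d ^ 2) :
    ∃ r s : ℝ, r * s = 1 ∧ r ≠ s ∧ r ^ 2 - d * r + 1 = 0 ∧ s ^ 2 - d * s + 1 = 0 := by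
  have hsqrt : Real.sqrt (d ^ 2 - 4) ^ 2 = d ^ 2 - 4 := Real.sq_sqrt (by linarith)
  have hpos : 0 < Real.sqrt (d ^ 2 - 4) := Real.sqrt_pos.mpr (by linarith)
  refine ⟨(d + Real.sqrt (d ^ 2 - 4)) / 2, (d - Real.sqrt (d ^ 2 - 4)) / 2, ?_, by linarith, ?_, ?_⟩
  · linear_combination -hsqrt / 4
  all_goals linear_combination hsqrt / 4

theorem exists_unimodular_root_of_sq_le_four {d : ℝ} (hd : d ^ 2 ≤ 4) :
    ∃ ρ : ℂ, ‖ρ‖ = 1 ∧ ρ ^ 2 - d * ρ + 1 = 0 := by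
  have hsqrt : Real.sqrt (4 - d ^ 2) ^ 2 = 4 - d ^ 2 := Real.sq_sqrt (by linarith)
  refine ⟨(d + Real.sqrt (4 - d ^ 2) * Complex.I) / 2, ?_, ?_⟩
  · rw [← pow_eq_one_iff_of_nonneg (norm_nonneg _) two_ne_zero, norm_div, div_pow, Complex.sq_norm,
      Complex.normSq_add_mul_I, hsqrt, Complex.norm_ofNat]
    ring
  · have hsqrtC : (Real.sqrt (4 - d ^ 2) : ℂ) ^ 2 = 4 - (d : ℂ) ^ 2 := mod_cast hsqrt
    linear_combination (Complex.I ^ 2 / 4) * hsqrtC + (1 - (d : ℂ) ^ 2 / 4) * Complex.I_sq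

variable (U) in
theorem exists_analytic_mem_spec_hill_iff :
    ∃ F : ℝ → ℝ, AnalyticOnNhd ℝ F Set.univ ∧ ∀ l : ℝ, (l : ℂ) ∈ spec (hill U) ↔ F l ≤ 0 := by
  obtain ⟨Δ, hΔ, hfloquet⟩ := exists_discriminant U
  refine ⟨fun l => Δ l ^ 2 - 4, (hΔ.pow 2).sub analyticOnNhd_const, fun l => ⟨fun hl => ?_,
    fun hl => ?_⟩⟩
  · by_contra! hΔl
    obtain ⟨r, s, hrs, hne, hr, hs⟩ := exists_real_roots_of_four_lt_sq (sub_pos.mp hΔl)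
    obtain ⟨ψ, ψ', hψ⟩ := hfloquet l r (mod_cast hr)
    obtain ⟨φ, φ', hφ⟩ := hfloquet l s (mod_cast hs)
    exact hl (isResolventPoint_hill_of_isFloquet hrs hne hψ hφ)
  · obtain ⟨ρ, hρ, hroot⟩ := exists_unimodular_root_of_sq_le_four (sub_nonpos.mp hl)
    obtain ⟨ψ, ψ', hψ⟩ := hfloquet l ρ hroot
    exact hψ.mem_spec_hill hρ

end WeylSequence

end RealPlace

/-! ### Bands of a sublevel set -/

namespace BandStructure

theorem exists_strictMono_range_eq {G : Set ℝ} (hfinite : ∀ M, (G ∩ Set.Iic M).Finite)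
    (hG : ¬BddAbove G) : ∃ g : ℕ → ℝ, StrictMono g ∧ Tendsto g atTop atTop ∧ Set.range g = G := by
  have hunbounded (M : ℝ) : ∃ x ∈ G, M < x := not_bddAbove_iff.mp hG M
  obtain ⟨x, hx, -⟩ := hunbounded 0
  obtain ⟨b, ⟨hb, hbx⟩, hb_min⟩ :=
    Set.exists_min_image (G ∩ Set.Iic x) id (hfinite x) ⟨x, hx, le_refl x⟩
  let : OrderBot G :=
    { bot := ⟨b, hb⟩
      bot_le := fun y => (le_total y.1 x).elim (fun hyx => hb_min y ⟨y.2, hyx⟩) hbx.trans }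
  have : NoMaxOrder G := ⟨fun y => let ⟨z, hz, hyz⟩ := hunbounded y; ⟨⟨z, hz⟩, hyz⟩⟩
  let : LocallyFiniteOrder G := LocallyFiniteOrder.ofFiniteIcc fun y z =>
    ((hfinite z).preimage Subtype.val_injective.injOn).subset fun w hw => ⟨w.2, hw.2⟩
  let := LinearLocallyFiniteOrder.succOrder G
  let := LinearLocallyFiniteOrder.predOrder G
  let e : ℕ ≃o G := (orderIsoNatOfLinearSuccPredArch (ι := G)).symm
  have hmono : StrictMono fun n => (e n : ℝ) := e.strictMono
  refine ⟨fun n => e n, hmono, tendsto_atTop_atTop_of_monotone hmono.monotone fun M => ?_, ?_⟩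
  · obtain ⟨y, hy, hMy⟩ := hunbounded M
    exact ⟨e.symm ⟨y, hy⟩, by simpa using hMy.le⟩
  · exact (e.surjective.range_comp Subtype.val).trans Subtype.range_coe

theorem exists_bands_of_strictMono {S : Set ℝ} {g : ℕ → ℝ} (hmono : StrictMono g)
    (hlim : Tendsto g atTop atTop) (hmem : ∀ n, g n ∈ S) (hle : ∀ x ∈ S, g 0 ≤ x)
    (hdichotomy : ∀ n, Set.Ioo (g n) (g (n + 1)) ⊆ S ∨ Disjoint (Set.Ioo (g n) (g (n + 1))) S) :
    ∃ β : ℕ → ℝ, (∀ n, g n ≤ β n ∧ β n ≤ g (n + 1)) ∧ S = ⋃ n, Set.Icc (g n) (β n) := by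
  have hband (n : ℕ) : ∃ b, (g n ≤ b ∧ b ≤ g (n + 1)) ∧ Set.Icc (g n) b ⊆ S ∧
      Set.Ico (g n) (g (n + 1)) ∩ S ⊆ Set.Icc (g n) b := by
    have hlt := hmono n.lt_succ_self
    rcases hdichotomy n with hsubset | hdisjoint
    · refine ⟨g (n + 1), ⟨hlt.le, le_rfl⟩, ?_, fun x hx => Set.Ico_subset_Icc_self hx.1⟩
      rw [← Set.Ioo_union_both hlt.le]
      exact Set.union_subset hsubset (Set.pair_subset (hmem n) (hmem (n + 1)))
    · refine ⟨g n, ⟨le_rfl, hlt.le⟩, by simpa using hmem n, fun x ⟨hx, hxS⟩ => ⟨hx.1, ?_⟩⟩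
      by_contra! hgx
      exact Set.disjoint_left.mp hdisjoint ⟨hgx, hx.2⟩ hxS
  choose β hβ hβ_subset hsubset_β using hband
  refine ⟨β, hβ, Set.Subset.antisymm (fun x hx => ?_) (Set.iUnion_subset hβ_subset)⟩
  have hx_mem : x ∈ ⋃ n, Set.Ico (g n) (g (Order.succ n)) := by
    rw [iUnion_Ico_map_succ_eq_Ici (fun n => hmono.monotone bot_le)
      (not_bddAbove_of_tendsto_atTop hlim)]
    exact hle x hx
  obtain ⟨n, hn⟩ := Set.mem_iUnion.mp hx_mem
  exact Set.mem_iUnion.mpr ⟨n, hsubset_β n ⟨hn, hx⟩⟩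

theorem exists_mem_Ioo_of_notMem_iUnion {α β : ℕ → ℝ} (hlim : Tendsto α atTop atTop) {E : ℝ}
    {n : ℕ} (hn : α n ≤ E) (hE : E ∉ ⋃ n, Set.Icc (α n) (β n)) :
    ∃ m, β m < E ∧ E < α (m + 1) := by
  simp only [Set.mem_iUnion, Set.mem_Icc, not_exists, not_and, not_le] at hE
  by_contra! hstep
  have hle (k : ℕ) (hk : n ≤ k) : α k ≤ E := by
    induction k, hk using Nat.le_induction with
    | base => exact hn
    | succ k _ ih => exact hstep k (hE k ih)
  obtain ⟨k, hkE, hk⟩ := ((hlim.eventually_gt_atTop E).and (eventually_ge_atTop n)).exists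
  exact (hle k hk).not_gt hkE

variable {F : ℝ → ℝ}

/-- The zeros of `F` together with the integers where `F` is nonpositive. They cut the sublevel set
`{x | F x ≤ 0}` into bands; the integers keep the bands bounded. -/
def nodes (F : ℝ → ℝ) : Set ℝ := {x | F x = 0 ∨ F x ≤ 0 ∧ ∃ k : ℤ, (k : ℝ) = x}

theorem nonpos_of_mem_nodes {x : ℝ} (hx : x ∈ nodes F) : F x ≤ 0 := hx.elim le_of_eq And.left

theorem exists_zero_of_nonpos_of_pos (hF : Continuous F) {x y : ℝ} (hx : F x ≤ 0) (hy : 0 < F y) :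
    ∃ z ∈ Set.uIcc x y, F z = 0 :=
  intermediate_value_uIcc hF.continuousOn (Set.mem_uIcc_of_le hx hy.le)

theorem exists_mem_nodes_uIcc_intCast (hF : Continuous F) {x : ℝ} (hx : F x ≤ 0) (k : ℤ) :
    ∃ y ∈ nodes F, y ∈ Set.uIcc x k := by
  by_cases hk : F k ≤ 0
  · exact ⟨k, Or.inr ⟨hk, k, rfl⟩, Set.right_mem_uIcc⟩
  · obtain ⟨z, hz, hz₀⟩ := exists_zero_of_nonpos_of_pos hF hx (not_le.mp hk)
    exact ⟨z, Or.inl hz₀, hz⟩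

theorem exists_mem_nodes_le (hF : Continuous F) {x : ℝ} (hx : F x ≤ 0) : ∃ y ∈ nodes F, y ≤ x := by
  obtain ⟨y, hy, hyx⟩ := exists_mem_nodes_uIcc_intCast hF hx ⌊x⌋
  rw [Set.uIcc_of_ge (Int.floor_le x)] at hyx
  exact ⟨y, hy, hyx.2⟩

theorem exists_mem_nodes_ge (hF : Continuous F) {x : ℝ} (hx : F x ≤ 0) : ∃ y ∈ nodes F, x ≤ y := by
  obtain ⟨y, hy, hyx⟩ := exists_mem_nodes_uIcc_intCast hF hx ⌈x⌉
  rw [Set.uIcc_of_le (Int.le_ceil x)] at hyx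
  exact ⟨y, hy, hyx.1⟩

theorem subset_or_disjoint_sublevel (hF : Continuous F) {s : Set ℝ} (hs : s.OrdConnected)
    (hnodes : Disjoint s (nodes F)) : s ⊆ {x | F x ≤ 0} ∨ Disjoint s {x | F x ≤ 0} := by
  by_contra! h
  obtain ⟨y, hy, hFy⟩ := Set.not_subset.mp h.1
  obtain ⟨x, hx, hFx⟩ := Set.not_disjoint_iff.mp h.2
  obtain ⟨z, hz, hz₀⟩ := exists_zero_of_nonpos_of_pos hF hFx (not_le.mp hFy)
  exact Set.disjoint_left.mp hnodes (hs.uIcc_subset hx hy hz) (Or.inl hz₀)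

theorem finite_zeros_inter_Icc (hF : AnalyticOnNhd ℝ F Set.univ) (hne : F ≠ 0) (c M : ℝ) :
    ({x | F x = 0} ∩ Set.Icc c M).Finite := by
  by_contra hinfinite
  obtain ⟨z, -, hz⟩ := Set.Infinite.exists_accPt_of_subset_isCompact hinfinite isCompact_Icc
    Set.inter_subset_right
  exact hne (hF.eq_of_frequently_eq analyticOnNhd_const
    ((accPt_iff_frequently_nhdsNE.mp hz).mono fun x hx => hx.1))

theorem finite_nodes_inter_Iic (hF : AnalyticOnNhd ℝ F Set.univ) (hb : BddBelow {x | F x ≤ 0})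
    (M : ℝ) : (nodes F ∩ Set.Iic M).Finite := by
  obtain ⟨c, hc⟩ := hb
  have hne : F ≠ 0 := by
    rintro rfl
    exact not_bddBelow_univ ⟨c, fun x _ => hc (le_refl (0 : ℝ))⟩
  refine ((finite_zeros_inter_Icc hF hne c M).union
    ((Set.finite_Icc ⌈c⌉ ⌊M⌋).image ((↑) : ℤ → ℝ))).subset ?_
  rintro x ⟨hx, hxM⟩
  have hcx : c ≤ x := hc (nonpos_of_mem_nodes hx)
  rcases hx with hx₀ | ⟨-, k, rfl⟩
  · exact Or.inl ⟨hx₀, hcx, hxM⟩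
  · exact Or.inr ⟨k, ⟨Int.ceil_le.mpr hcx, Int.le_floor.mpr hxM⟩, rfl⟩

theorem exists_bands (hF : AnalyticOnNhd ℝ F Set.univ) (hb : BddBelow {x | F x ≤ 0})
    (hu : ¬BddAbove {x | F x ≤ 0}) :
    ∃ α β : ℕ → ℝ, (∀ n, α n ≤ β n ∧ β n ≤ α (n + 1)) ∧ Tendsto α atTop atTop ∧
      {x | F x ≤ 0} = ⋃ n, Set.Icc (α n) (β n) := by
  have hcont : Continuous F := continuousOn_univ.mp hF.continuousOn
  have hnodes : ¬BddAbove (nodes F) := fun ⟨M, hM⟩ => hu ⟨M, fun x hx => by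
    obtain ⟨y, hy, hxy⟩ := exists_mem_nodes_ge hcont hx
    exact hxy.trans (hM hy)⟩
  obtain ⟨g, hmono, hlim, hrange⟩ :=
    exists_strictMono_range_eq (finite_nodes_inter_Iic hF hb) hnodes
  have hmem (n : ℕ) : F (g n) ≤ 0 := nonpos_of_mem_nodes (hrange ▸ Set.mem_range_self n)
  have hle (x : ℝ) (hx : F x ≤ 0) : g 0 ≤ x := by
    obtain ⟨y, hy, hyx⟩ := exists_mem_nodes_le hcont hx
    obtain ⟨k, rfl⟩ := hrange ▸ hy
    exact (hmono.monotone k.zero_le).trans hyx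
  have hgap (n : ℕ) : Disjoint (Set.Ioo (g n) (g (n + 1))) (nodes F) := by
    rw [← hrange, Set.disjoint_right]
    rintro _ ⟨k, rfl⟩ hk
    have := hmono.lt_iff_lt.mp hk.1
    have := hmono.lt_iff_lt.mp hk.2
    omega
  obtain ⟨β, hβ, hunion⟩ := exists_bands_of_strictMono hmono hlim hmem hle fun n =>
    subset_or_disjoint_sublevel hcont Set.ordConnected_Ioo (hgap n)
  exact ⟨g, β, hβ, hlim, hunion⟩

end BandStructure

/-! ### The Dirac operators -/

namespace RealPlace

open UnboundedOp

section Dirac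

variable {L : ℝ} (U : EvenPeriodicPotential L) {E : ℝ}

theorem exists_bands_hill (hE : InOpenGap (spec (hill U)) E) :
    ∃ α β : ℕ → ℝ, (∀ n, α n ≤ β n ∧ β n ≤ α (n + 1)) ∧ Tendsto α atTop atTop ∧
      spec (hill U) = ⋃ n, ((↑) : ℝ → ℂ) '' Set.Icc (α n) (β n) ∧
      ∃ m, β m < E ∧ E < α (m + 1) := by
  obtain ⟨a, b, ha, -, hEab, hgap⟩ := hE
  obtain ⟨F, hF, hspec⟩ := exists_analytic_mem_spec_hill_iff U
  have hbelow : BddBelow {x | F x ≤ 0} :=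
    ⟨-‖U.mul‖, fun x hx => neg_norm_mul_le_of_mem_spec_hill U ((hspec x).mpr hx)⟩
  have habove : ¬BddAbove {x | F x ≤ 0} := not_bddAbove_iff.mpr fun M => by
    obtain ⟨x, hMx, hx⟩ := exists_mem_spec_hill_gt U M
    exact ⟨x, (hspec x).mp hx, hMx⟩
  obtain ⟨α, β, hchain, hlim, hunion⟩ := BandStructure.exists_bands hF hbelow habove
  have ha_mem : a ∈ ⋃ n, Set.Icc (α n) (β n) := hunion ▸ (hspec a).mp ha
  have hE_notMem : E ∉ ⋃ n, Set.Icc (α n) (β n) := hunion ▸ mt (hspec E).mpr (hgap E hEab)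
  obtain ⟨n, hn⟩ := Set.mem_iUnion.mp ha_mem
  refine ⟨α, β, hchain, hlim, ?_, BandStructure.exists_mem_Ioo_of_notMem_iUnion hlim
    (hn.1.trans hEab.1.le) hE_notMem⟩
  rw [← Set.image_iUnion, ← hunion]
  ext z
  refine ⟨fun hz => ?_, fun ⟨x, hx, hxz⟩ => hxz ▸ (hspec x).mpr hx⟩
  have hreal := eq_ofReal_of_mem_spec (isSelfAdjoint_hill U) hz
  exact ⟨z.re, (hspec z.re).mp (hreal ▸ hz), hreal.symm⟩

theorem isSelfAdjoint_dirac (E : ℝ) : IsSelfAdjoint (dirac U E) :=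
  isSelfAdjoint_chiralDouble (isSelfAdjoint_shift (isSelfAdjoint_hill U) E)

theorem mem_spec_dirac_iff {z : ℂ} :
    z ∈ spec (dirac U E) ↔ E + z ∈ spec (hill U) ∨ E - z ∈ spec (hill U) := by
  rw [dirac, spec_chiralDouble, Set.mem_ofPred_eq, mem_spec_shift_iff, mem_spec_shift_iff,
    add_comm z, neg_add_eq_sub]

theorem spec_dirac (E : ℝ) :
    spec (dirac U E) = {z : ℂ | ∃ l ∈ spec (hill U), z = l - E ∨ z = -(l - E)} := by
  ext z
  rw [mem_spec_dirac_iff]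
  constructor
  · rintro (h | h)
    exacts [⟨_, h, Or.inl (by ring)⟩, ⟨_, h, Or.inr (by ring)⟩]
  · rintro ⟨l, hl, rfl | rfl⟩
    exacts [Or.inl (by rwa [add_sub_cancel]), Or.inr (by rwa [sub_neg_eq_add, add_sub_cancel])]

theorem mem_spec_dirac_iff_neg_mem {z : ℂ} : z ∈ spec (dirac U E) ↔ -z ∈ spec (dirac U E) := by
  rw [mem_spec_dirac_iff, mem_spec_dirac_iff, sub_neg_eq_add, ← sub_eq_add_neg, or_comm]

theorem spec_dirac_eq_iUnion {α β : ℕ → ℝ}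
    (h : spec (hill U) = ⋃ n, ((↑) : ℝ → ℂ) '' Set.Icc (α n) (β n)) :
    spec (dirac U E) = ⋃ n, ((↑) : ℝ → ℂ) ''
      (Set.Icc (α n - E) (β n - E) ∪ Set.Icc (-(β n - E)) (-(α n - E))) := by
  rw [spec_dirac, h]
  ext z
  simp only [Set.mem_ofPred_eq, Set.mem_iUnion]
  constructor
  · rintro ⟨l, ⟨n, x, hx, rfl⟩, rfl | rfl⟩
    · exact ⟨n, x - E, Or.inl ⟨by linarith [hx.1], by linarith [hx.2]⟩, by push_cast; ring⟩
    · exact ⟨n, -(x - E), Or.inr ⟨by linarith [hx.2], by linarith [hx.1]⟩, by push_cast; ring⟩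
  · rintro ⟨n, x, hx | hx, rfl⟩
    · exact ⟨_, ⟨n, x + E, ⟨by linarith [hx.1], by linarith [hx.2]⟩, rfl⟩,
        Or.inl (by push_cast; ring)⟩
    · exact ⟨_, ⟨n, E - x, ⟨by linarith [hx.2], by linarith [hx.1]⟩, rfl⟩,
        Or.inr (by push_cast; ring)⟩

theorem exists_gap_spec_dirac (hE : InOpenGap (spec (hill U)) E) :
    ∃ δ : ℝ, 0 < δ ∧ (δ : ℂ) ∈ spec (dirac U E) ∧ ((-δ : ℝ) : ℂ) ∈ spec (dirac U E) ∧
      ∀ x ∈ Set.Ioo (-δ) δ, (x : ℂ) ∉ spec (dirac U E) := by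
  obtain ⟨a, b, ha, hb, ⟨haE, hEb⟩, hgap⟩ := hE
  have hmem_iff (x : ℝ) : (x : ℂ) ∈ spec (dirac U E) ↔
      ((E + x : ℝ) : ℂ) ∈ spec (hill U) ∨ ((E - x : ℝ) : ℂ) ∈ spec (hill U) := by
    rw [mem_spec_dirac_iff, Complex.ofReal_add, Complex.ofReal_sub]
  have hmem : ((min (E - a) (b - E) : ℝ) : ℂ) ∈ spec (dirac U E) := by
    rw [hmem_iff]
    rcases min_choice (E - a) (b - E) with hmin | hmin <;> rw [hmin]
    exacts [Or.inr (by rwa [sub_sub_cancel]), Or.inl (by rwa [add_sub_cancel])]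
  refine ⟨min (E - a) (b - E), lt_min (sub_pos.mpr haE) (sub_pos.mpr hEb), hmem, ?_,
    fun x hx => ?_⟩
  · rwa [Complex.ofReal_neg, ← mem_spec_dirac_iff_neg_mem]
  · have hδa := min_le_left (E - a) (b - E)
    have hδb := min_le_right (E - a) (b - E)
    rw [hmem_iff, not_or]
    exact ⟨hgap _ ⟨by linarith [hx.1], by linarith [hx.2]⟩,
      hgap _ ⟨by linarith [hx.2], by linarith [hx.1]⟩⟩

end Dirac

end RealPlace

theorem mainTheorem3 {L : ℝ} (U : RealPlace.EvenPeriodicPotential L) (E : ℝ)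
    (hE : RealPlace.InOpenGap (UnboundedOp.spec (RealPlace.hill U)) E) :
    IsSelfAdjoint (globalDirac U E) ∧
    UnboundedOp.spec (globalDirac U E) = UnboundedOp.spec (RealPlace.dirac U E) ∧
    UnboundedOp.spec (RealPlace.dirac U E) =
      {z : ℂ | ∃ l ∈ UnboundedOp.spec (RealPlace.hill U), z = l - E ∨ z = -(l - E)} ∧
    (∀ z ∈ UnboundedOp.spec (globalDirac U E),
      UnboundedOp.HasInfiniteMultiplicityAt (globalDirac U E) z) ∧
    UnboundedOp.HasUniformInfiniteMultiplicity (globalDirac U E) ∧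
    (∃ α β : ℕ → ℝ,
      (∀ n, α n ≤ β n ∧ β n ≤ α (n + 1)) ∧
      Filter.Tendsto α Filter.atTop Filter.atTop ∧
      UnboundedOp.spec (RealPlace.hill U) =
        ⋃ n, ((↑) : ℝ → ℂ) '' Set.Icc (α n) (β n) ∧
      (∃ m, β m < E ∧ E < α (m + 1)) ∧
      UnboundedOp.spec (globalDirac U E) =
        ⋃ n, ((↑) : ℝ → ℂ) '' (Set.Icc (α n - E) (β n - E) ∪ Set.Icc (-(β n - E)) (-(α n - E)))) ∧
    (∀ z : ℂ, z ∈ UnboundedOp.spec (globalDirac U E) ↔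
      -z ∈ UnboundedOp.spec (globalDirac U E)) ∧
    (∃ δ : ℝ, 0 < δ ∧ (δ : ℂ) ∈ UnboundedOp.spec (globalDirac U E) ∧
      ((-δ : ℝ) : ℂ) ∈ UnboundedOp.spec (globalDirac U E) ∧
      ∀ x ∈ Set.Ioo (-δ) δ, (x : ℂ) ∉ UnboundedOp.spec (globalDirac U E)) := by
  have hA := RealPlace.isSelfAdjoint_dirac U E
  have hK := FinitePlaces.not_finiteDimensional_Hfin
  have hspec : UnboundedOp.spec (globalDirac U E) = UnboundedOp.spec (RealPlace.dirac U E) :=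
    UnboundedOp.spec_tensorId hA
  obtain ⟨α, β, hchain, hlim, hbands, hgap⟩ := RealPlace.exists_bands_hill U hE
  rw [hspec]
  exact ⟨UnboundedOp.isSelfAdjoint_tensorId hA, rfl, RealPlace.spec_dirac U E,
    fun _ hz => UnboundedOp.hasInfiniteMultiplicityAt_tensorId hA hK hz,
    UnboundedOp.hasUniformInfiniteMultiplicity_tensorId hA hK,
    ⟨α, β, hchain, hlim, hbands, hgap, RealPlace.spec_dirac_eq_iUnion U hbands⟩,
    fun _ => RealPlace.mem_spec_dirac_iff_neg_mem U, RealPlace.exists_gap_spec_dirac U hE⟩
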